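/- **Setting.** All functions are non-negative and (Lebesgue) measurable on $(0,\infty)$, all constants are positive and finite, integrals and Luxemburg norms take values in $[0,\infty]$, and $0\cdot\infty=0$. An *$N$-function* is $\Phi(x)=\int_0^x p(t)\,dt$, $x\in[0,\infty)$, where $p:[0,\infty)\to[0,\infty)$ is non-decreasing and right-continuous, $p(0)=0$, $p(s)>0$ for $s>0$ and $p(s)\to\infty$ as $s\to\infty$; we put $\Phi(\infty)=\infty$, $\Phi^{-1}(\infty)=\infty$. Its complementary function is $\tilde\Phi(x)=\int_0^x\tilde p(t)\,dt$ with $\tilde p(t)=\sup\{s: p(s)\le t\}$. We write $M\in\Delta_2$ if there is $\beta>0$ with $M(2t)\le\beta M(t)$ for all $t>0$, and $\Phi\prec\Psi$ if there is $C>0$ with $\sum_i\Psi\circ\Phi^{-1}(a_i)\le C\,\Psi\circ\Phi^{-1}\big(\sum_i a_i\big)$ for every non-negative sequence $(a_i)$. A *weight* is a measurable function $(0,\infty)\to[0,\infty)$; for a weight $v$ put $(Iv)(x)=\int_0^x v(t)\,dt$ and $$\|f\|_{M(v)}=\inf\Big\{\tau>0:\int_0^\infty M\big(|f(x)|/\tau\big)\,v(x)\,dx\le1\Big\}\qquad(\inf\emptyset=\infty).$$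 For $\alpha\in\mathbb R$ and measurable $\phi:(0,\infty)\to[0,\infty)$, the Dunkl–Hausdorff operator is $$(\mathcal H_{\alpha,\phi}f)(x)=\int_0^\infty\frac{\phi(t)}{t^{2\alpha+2}}\,f\Big(\frac xt\Big)\,dt .$$ **Theorem 2.1.** Let $\Phi,\Psi$ be $N$-functions with $\Phi,\tilde\Phi\in\Delta_2$ and $\Phi\prec\Psi$. Let $w_0,w_1,v$ be weights with $(Iv)(x)<\infty$ for all $x>0$ and $(Iv)(\infty)=\int_0^\infty v(t)\,dt=\infty$. Let $\alpha\in\mathbb R$ and suppose that there are constants $C_1,C_2,C_3,C_4>0$ with $$C_1\le\frac{\phi(x)}{x^{2\alpha}}\le C_2\quad(x\ge1),\qquad C_3\le\frac{\phi(x)}{x^{2\alpha+1}}\le C_4\quad(0<x<1).\tag{2.1}$$ Then there is a constant $C>0$ such that the modular inequality $$\Psi^{-1}\Big\{\int_0^\infty\Psi\big[w_1(x)(\mathcal H_{\alpha,\phi}f)(x)\big]w_0(x)\,dx\Big\}\le\Phi^{-1}\Big\{\int_0^\infty\Phi\big[Cf(x)\big]v(x)\,dx\Big\}\tag{2.2}$$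 holds for all non-increasing $f:(0,\infty)\to[0,\infty)$ if and only if there are constants $A_1,A_2,A_3>0$ such that, for all $r>0$ and $\varepsilon>0$, $$\Psi^{-1}\Big\{\int_r^\infty\Psi\Big[\frac{w_1(x)}{A_1x}\Big\|\frac{y\,\chi_{(0,r)}(y)}{\varepsilon(Iv)(y)}\Big\|_{\tilde\Phi(\varepsilon v)}\Big]w_0(x)\,dx\Big\}\le\Phi^{-1}(1/\varepsilon),\tag{2.3}$$ $$\Psi^{-1}\Big\{\int_0^r\Psi\Big[\frac{w_1(x)}{A_2}\Big\|\frac{\chi_{(r,\infty)}(y)}{\varepsilon(Iv)(y)}\Big\|_{\tilde\Phi(\varepsilon v)}\Big]w_0(x)\,dx\Big\}\le\Phi^{-1}(1/\varepsilon),\tag{2.4}$$ $$\Psi^{-1}\Big\{\int_0^r\Psi\Big[\frac{w_1(x)}{A_3}\Big\|\frac{\chi_{(r,\infty)}(y)\ln(y/r)}{\varepsilon(Iv)(y)}\Big\|_{\tilde\Phi(\varepsilon v)}\Big]w_0(x)\,dx\Big\}\le\Phi^{-1}(1/\varepsilon),\tag{2.5}$$ $$\Psi^{-1}\Big\{\int_0^r\Psi\Big[\frac{w_1(x)}{A_3}\Big\|\frac{\chi_{(r,\infty)}(y)}{\varepsilon(Iv)(y)}\Big\|_{\tilde\Phi(\varepsilon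 v)}\ln\Big(\frac rx\Big)\Big]w_0(x)\,dx\Big\}\le\Phi^{-1}(1/\varepsilon),\tag{2.6}$$ where the norms are taken in the variable $y\in(0,\infty)$. -/

import Mathlib

open MeasureTheory Set Filter
open scoped NNReal ENNReal Topology

noncomputable section

namespace DunklHausdorff

/-- `x ↦ ∫_0^x p(t) dt` for `p : [0,∞) → [0,∞)`, extended to `x = ∞` by `∫_0^∞ p(t) dt`. -/
def integralFrom (p : ℝ≥0 → ℝ≥0) (x : ℝ≥0∞) : ℝ≥0∞ :=
  ∫⁻ t in {t : ℝ | 0 < t ∧ ENNReal.ofReal t < x}, (p t.toNNReal : ℝ≥0∞)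

/-- An `N`-function, given by its generating function `φ : [0,∞) → [0,∞)` (which is determined by
the `N`-function, as its right derivative). -/
structure NFunction where
  /-- the generating function -/
  gen : ℝ≥0 → ℝ≥0
  gen_zero : gen 0 = 0
  gen_pos : ∀ s, 0 < s → 0 < gen s
  gen_tendsto : Tendsto gen atTop atTop
  gen_rightCont : ∀ s, ContinuousWithinAt gen (Ici s) s
  gen_mono : Monotone gen

/-- The values `Φ(x) = ∫_0^x φ(t) dt`, with `Φ(∞) = ∞`. -/
def NFunction.val (Φ : NFunction) : ℝ≥0∞ → ℝ≥0∞ := integralFrom Φ.gen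

/-- The generating function `t ↦ sup {s : φ(s) ≤ t}` of the complementary function. The set
contains `0` and is bounded above, because `φ` tends to infinity. -/
def NFunction.complGen (Φ : NFunction) (t : ℝ≥0) : ℝ≥0 := sSup {s : ℝ≥0 | Φ.gen s ≤ t}

/-- The complementary function of `Φ`. -/
def NFunction.compl (Φ : NFunction) : ℝ≥0∞ → ℝ≥0∞ := integralFrom Φ.complGen

/-- The inverse of `Φ`, as a map of `[0,∞]` (`Φ` is an increasing bijection of `[0,∞]`). -/
def NFunction.inv (Φ : NFunction) (y : ℝ≥0∞) : ℝ≥0∞ := sSup {x : ℝ≥0∞ | Φ.val x ≤ y}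

/-- The (global) `Δ₂` condition. -/
def DeltaTwo (M : ℝ≥0∞ → ℝ≥0∞) : Prop :=
  ∃ β : ℝ≥0, 0 < β ∧ ∀ t : ℝ≥0, 0 < t → M (2 * (t : ℝ≥0∞)) ≤ β * M t

/-- The order relation `Φ ≺ Ψ` between `N`-functions. -/
def Prec (Φ Ψ : NFunction) : Prop :=
  ∃ C : ℝ≥0, 0 < C ∧ ∀ a : ℕ → ℝ≥0,
    ∑' i, Ψ.val (Φ.inv (a i)) ≤ C * Ψ.val (Φ.inv (∑' i, (a i : ℝ≥0∞)))

/-- A weight: a non-negative (Lebesgue) measurable function on `(0,∞)`. Its values outside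
`(0,∞)` play no role. -/
def IsWeight (w : ℝ → ℝ≥0) : Prop := AEMeasurable w (volume.restrict (Ioi 0))

/-- `(Iv)(x) = ∫_0^x v(t) dt`. -/
def primitive (v : ℝ → ℝ≥0) (x : ℝ) : ℝ≥0∞ := ∫⁻ t in Ioo 0 x, (v t : ℝ≥0∞)

/-- The Luxemburg norm, with respect to `M` and the weight `v` on `(0,∞)`, of a non-negative
function `f`; it is `∞` if no `τ` is admissible. -/
def luxNorm (M : ℝ≥0∞ → ℝ≥0∞) (v : ℝ → ℝ≥0) (f : ℝ → ℝ≥0∞) : ℝ≥0∞ :=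
  sInf {τ : ℝ≥0∞ | 0 < τ ∧ τ < ∞ ∧ ∫⁻ x in Ioi (0 : ℝ), M (f x / τ) * (v x : ℝ≥0∞) ≤ 1}

/-- The Dunkl-Hausdorff operator `∫_0^∞ φ(t) t^{-(2α+2)} f(x/t) dt`, for `φ` and `f` non-negative
on `(0,∞)`. -/
def dunklHausdorff (α : ℝ) (φ : ℝ → ℝ) (f : ℝ → ℝ≥0) (x : ℝ) : ℝ≥0∞ :=
  ∫⁻ t in Ioi (0 : ℝ), ENNReal.ofReal (φ t / t ^ (2 * α + 2)) * (f (x / t) : ℝ≥0∞)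

/-- The two-sided power bounds on `φ`. -/
def PowerBounds (α : ℝ) (φ : ℝ → ℝ) : Prop :=
  ∃ C₁ C₂ C₃ C₄ : ℝ, 0 < C₁ ∧ 0 < C₂ ∧ 0 < C₃ ∧ 0 < C₄ ∧
    (∀ x : ℝ, 1 ≤ x → C₁ ≤ φ x / x ^ (2 * α) ∧ φ x / x ^ (2 * α) ≤ C₂) ∧
    (∀ x : ℝ, 0 < x → x < 1 →
      C₃ ≤ φ x / x ^ (2 * α + 1) ∧ φ x / x ^ (2 * α + 1) ≤ C₄)

/-- The weighted modular inequality with constant `C` for the function `f`. -/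
def ModularIneq (Φ Ψ : NFunction) (w₀ w₁ v : ℝ → ℝ≥0) (α : ℝ) (φ : ℝ → ℝ)
    (C : ℝ≥0) (f : ℝ → ℝ≥0) : Prop :=
  Ψ.inv (∫⁻ x in Ioi (0 : ℝ), Ψ.val (w₁ x * dunklHausdorff α φ f x) * w₀ x) ≤
    Φ.inv (∫⁻ x in Ioi (0 : ℝ), Φ.val (C * f x) * v x)

/-- The norm in `L_{Φ̃(εv)}` of `g χ_E / (ε (Iv))`. -/
def weightNorm (Φ : NFunction) (v : ℝ → ℝ≥0) (ε : ℝ≥0) (E : Set ℝ) (g : ℝ → ℝ) : ℝ≥0∞ :=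
  luxNorm Φ.compl (fun y => ε * v y)
    (E.indicator fun y => ENNReal.ofReal (g y) / (ε * primitive v y))

end DunklHausdorff

end

noncomputable section

namespace DunklHausdorff

/-! Write m = v dx and μ = w₀ dx on (0,∞). After the substitution u = x/t, the power bounds make the
operator comparable with the averaging operator plus its adjoint, (1/x)∫_0^x f + ∫_x^∞ f(t) dt/t
(`exists_dunklHausdorff_bounds`). Monotone functions are then traded for tails η(x,∞), where dη =
g/(Iv) dm and g ≥ 0 is arbitrary. If m charges every neighbourhood of 0, a non-increasing f lies
below such a tail with the modular of g at most that of 8f (`exists_tail_majorant`); otherwise the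
inequality forces w₁ = 0 μ-a.e. Conversely, Δ₂ for Φ gives a modular Hardy inequality bounding the
tail by g (`lintegral_val_tail_le`). By Tonelli the operator sends a tail to (1/x)∫_{y≤x} y dη +
η(x,∞) + ∫_{y>x} log(y/x) dη (`calderon_tail`). The first two terms correspond to (2.3) and (2.4);
the logarithm, which splits as log(y/ρ) + log(ρ/x), needs both (2.5) and (2.6).

Sufficiency: the value of each term at x is at most four times a dyadic level 2^j, and that level is
carried by a single block of y's lying on one side of x; for the logarithm there is a correction
governed by (2.6). On a block B, Hölder's inequality with ε = 1/∫_B Φ(g) dm turns the test condition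
into a bound by Ψ∘Φ⁻¹(∫_B Φ(g) dm) (`lintegral_val_block_le`). The blocks are disjoint, and Φ ≺ Ψ
sums these bounds. Truncating g keeps all levels finite; monotone convergence removes the
truncation.

Necessity: each test kernel is a minorant of part of the tail kernel. Δ₂ for Φ̃ yields an almost
extremal g in Hölder's inequality (`exists_dual_function`), and the modular inequality for its tail
is the test condition. -/

section

/-! ### Primitives of monotone functions -/

/-- The interval `(0, x)` of real numbers, for `x` in `[0, ∞]`. -/
def initialSeg (x : ℝ≥0∞) : Set ℝ := {t : ℝ | 0 < t ∧ ENNReal.ofReal t < x}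

lemma measurableSet_initialSeg (x : ℝ≥0∞) : MeasurableSet (initialSeg x) :=
  (measurableSet_lt measurable_const measurable_id).inter
    (measurableSet_lt ENNReal.measurable_ofReal measurable_const)

lemma initialSeg_coe (x : ℝ≥0) : initialSeg x = Ioo 0 (x : ℝ) := by
  ext t
  simp only [initialSeg, mem_ofPred_eq, mem_Ioo]
  refine and_congr_right fun ht => ?_
  rw [← ENNReal.ofReal_coe_nnreal, ENNReal.ofReal_lt_ofReal_iff_of_nonneg ht.le]

lemma initialSeg_top : initialSeg ∞ = Ioi 0 := by
  ext t; simp [initialSeg]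

lemma volume_initialSeg (x : ℝ≥0∞) : volume (initialSeg x) = x := by
  induction x with
  | top => simp [initialSeg_top]
  | coe x => simp [initialSeg_coe]

lemma initialSeg_mono {x y : ℝ≥0∞} (h : x ≤ y) : initialSeg x ⊆ initialSeg y :=
  fun _ ht => ⟨ht.1, ht.2.trans_le h⟩

variable {p : ℝ≥0 → ℝ≥0}

lemma integralFrom_def (p : ℝ≥0 → ℝ≥0) (x : ℝ≥0∞) :
    integralFrom p x = ∫⁻ t in initialSeg x, (p t.toNNReal : ℝ≥0∞) := rfl

lemma integralFrom_mono (p : ℝ≥0 → ℝ≥0) : Monotone (integralFrom p) :=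
  fun _ _ h => lintegral_mono_set (initialSeg_mono h)

lemma integralFrom_zero (p : ℝ≥0 → ℝ≥0) : integralFrom p 0 = 0 := by
  rw [integralFrom_def, ← ENNReal.coe_zero, initialSeg_coe]; simp

lemma integralFrom_le (hp : Monotone p) (x : ℝ≥0) : integralFrom p x ≤ p x * x := by
  calc integralFrom p x ≤ ∫⁻ _ in initialSeg x, (p x : ℝ≥0∞) := by
        refine setLIntegral_mono measurable_const fun t ht => ?_
        replace ht : t ∈ Ioo 0 (x : ℝ) := initialSeg_coe x ▸ ht
        exact ENNReal.coe_le_coe.2 (hp (Real.toNNReal_le_iff_le_coe.2 ht.2.le))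
    _ = p x * x := by rw [setLIntegral_const, volume_initialSeg]

lemma integralFrom_lt_top (hp : Monotone p) (x : ℝ≥0) : integralFrom p x < ∞ :=
  (integralFrom_le hp x).trans_lt (ENNReal.mul_lt_top ENNReal.coe_lt_top ENNReal.coe_lt_top)

lemma integralFrom_add_mul_le (hp : Monotone p) (x y : ℝ≥0) :
    integralFrom p x + p x * y ≤ integralFrom p (x + y : ℝ≥0) := by
  have hd : Disjoint (initialSeg x) (Ioo (x : ℝ) (x + y : ℝ≥0)) := by
    rw [initialSeg_coe]
    exact Set.disjoint_left.2 fun t h1 h2 => (h1.2.trans h2.1).false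
  calc integralFrom p x + p x * y
      ≤ integralFrom p x + ∫⁻ t in Ioo (x : ℝ) (x + y : ℝ≥0), (p t.toNNReal : ℝ≥0∞) := by
        gcongr
        calc (p x : ℝ≥0∞) * y = ∫⁻ _ in Ioo (x : ℝ) (x + y : ℝ≥0), (p x : ℝ≥0∞) := by
              rw [setLIntegral_const, Real.volume_Ioo]; simp
          _ ≤ _ := by
              refine setLIntegral_mono' measurableSet_Ioo fun t ht => ?_
              exact ENNReal.coe_le_coe.2 (hp (NNReal.le_toNNReal_of_coe_le ht.1.le))
    _ = ∫⁻ t in initialSeg x ∪ Ioo (x : ℝ) (x + y : ℝ≥0), (p t.toNNReal : ℝ≥0∞) :=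
        (lintegral_union measurableSet_Ioo hd).symm
    _ ≤ _ := by
        refine lintegral_mono_set ?_
        change _ ⊆ initialSeg (x + y : ℝ≥0)
        rw [initialSeg_coe, initialSeg_coe]
        rintro t (ht | ht)
        · exact ⟨ht.1, ht.2.trans_le (by push_cast; linarith [y.2])⟩
        · exact ⟨x.2.trans_lt ht.1, ht.2⟩

lemma integralFrom_sub_le (hp : Monotone p) {x y : ℝ≥0} (h : x ≤ y) :
    integralFrom p y ≤ integralFrom p x + p y * (y - x : ℝ≥0) := by
  calc integralFrom p y
      ≤ ∫⁻ t in initialSeg x ∪ Ico (x : ℝ) y, (p t.toNNReal : ℝ≥0∞) := by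
        refine lintegral_mono_set ?_
        change initialSeg y ⊆ _
        rw [initialSeg_coe, initialSeg_coe]
        intro t ht
        rcases lt_or_ge t x with htx | htx
        · exact .inl ⟨ht.1, htx⟩
        · exact .inr ⟨htx, ht.2⟩
    _ ≤ integralFrom p x + ∫⁻ t in Ico (x : ℝ) y, (p t.toNNReal : ℝ≥0∞) :=
        lintegral_union_le _ _ _
    _ ≤ integralFrom p x + ∫⁻ _ in Ico (x : ℝ) y, (p y : ℝ≥0∞) := by
        refine add_le_add le_rfl (setLIntegral_mono' measurableSet_Ico fun t ht => ?_)
        exact ENNReal.coe_le_coe.2 (hp (Real.toNNReal_le_iff_le_coe.2 ht.2.le))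
    _ = _ := by
        rw [setLIntegral_const, Real.volume_Ico, ← NNReal.coe_sub h, ENNReal.ofReal_coe_nnreal]

/-- On (x, 2x) the integrand is at least p x. Combined with Δ₂, this bounds t·p(t) by a multiple of
the primitive at t. -/
lemma gen_mul_le_integralFrom (hp : Monotone p) (x : ℝ≥0) :
    (p x : ℝ≥0∞) * x ≤ integralFrom p (2 * x) := by
  have := integralFrom_add_mul_le hp x x
  rw [← two_mul] at this
  push_cast at this
  exact le_add_self.trans this

/-- Convexity along rays: substitute t ↦ ct and use p(t) ≤ p(ct). This is how numerical factors move
between the outside and the inside of a modular. -/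
lemma mul_integralFrom_le (hp : Monotone p) {c : ℝ≥0} (hc : 1 ≤ c) (x : ℝ≥0∞) :
    c * integralFrom p x ≤ integralFrom p (c * x) := by
  have hc0 : (0 : ℝ) < c := by exact_mod_cast zero_lt_one.trans_le hc
  have himg : (fun t : ℝ => c * t) '' initialSeg x ⊆ initialSeg (c * x) := by
    rintro _ ⟨t, ht, rfl⟩
    refine ⟨mul_pos hc0 ht.1, ?_⟩
    rw [ENNReal.ofReal_mul hc0.le, ENNReal.ofReal_coe_nnreal]
    exact ENNReal.mul_lt_mul_right (by exact_mod_cast hc0.ne') ENNReal.coe_ne_top ht.2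
  calc c * integralFrom p x
      = ∫⁻ t in initialSeg x, c * (p t.toNNReal : ℝ≥0∞) := by
        rw [lintegral_const_mul' _ _ ENNReal.coe_ne_top, integralFrom_def]
    _ ≤ ∫⁻ t in initialSeg x, ENNReal.ofReal |(c : ℝ)| * (p (c * t).toNNReal : ℝ≥0∞) := by
        refine setLIntegral_mono' (measurableSet_initialSeg x) fun t ht => ?_
        rw [abs_of_pos hc0, ENNReal.ofReal_coe_nnreal]
        gcongr
        refine hp (Real.toNNReal_le_toNNReal ?_)
        exact le_mul_of_one_le_left ht.1.le (by exact_mod_cast hc)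
    _ = ∫⁻ t in (fun t : ℝ => c * t) '' initialSeg x, (p t.toNNReal : ℝ≥0∞) := by
        rw [lintegral_image_eq_lintegral_abs_deriv_mul (measurableSet_initialSeg x)
          (f' := fun _ => (c : ℝ))]
        · intro t _
          simpa using ((hasDerivAt_id t).const_mul (c : ℝ)).hasDerivWithinAt
        · exact fun a _ b _ h => mul_left_cancel₀ hc0.ne' h
    _ ≤ _ := lintegral_mono_set himg

lemma integralFrom_div_le (hp : Monotone p) {c : ℝ≥0} (hc : 1 ≤ c) (x : ℝ≥0∞) :
    integralFrom p (x / c) ≤ integralFrom p x / c := by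
  have hc0 : (c : ℝ≥0∞) ≠ 0 := by exact_mod_cast (zero_lt_one.trans_le hc).ne'
  rw [ENNReal.le_div_iff_mul_le (.inl hc0) (.inl ENNReal.coe_ne_top), mul_comm]
  have := mul_integralFrom_le hp hc (x / c)
  rwa [ENNReal.mul_div_cancel hc0 ENNReal.coe_ne_top] at this

/-! ### `N`-functions -/

namespace NFunction

variable (Φ Ψ : NFunction)

lemma bddAbove_complGen (t : ℝ≥0) : BddAbove {s : ℝ≥0 | Φ.gen s ≤ t} := by
  obtain ⟨b, hb⟩ := (Φ.gen_tendsto.eventually_gt_atTop t).exists_forall_of_atTop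
  exact ⟨b, fun s hs => le_of_not_ge fun h => (hb s h).not_ge hs⟩

lemma complGen_mono : Monotone Φ.complGen := fun _ b h =>
  csSup_le_csSup (Φ.bddAbove_complGen b) ⟨0, by simp [Φ.gen_zero]⟩
    fun _ hs => le_trans hs h

lemma le_complGen {s t : ℝ≥0} (h : Φ.gen s ≤ t) : s ≤ Φ.complGen t :=
  le_csSup (Φ.bddAbove_complGen t) h

lemma gen_le_of_lt_complGen {s t : ℝ≥0} (h : s < Φ.complGen t) : Φ.gen s ≤ t := by
  obtain ⟨u, hu, hsu⟩ := exists_lt_of_lt_csSup ⟨0, by simp [Φ.gen_zero]⟩ h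
  exact (Φ.gen_mono hsu.le).trans hu

lemma val_mono : Monotone Φ.val := integralFrom_mono _

lemma val_zero : Φ.val 0 = 0 := integralFrom_zero _

lemma val_lt_top (x : ℝ≥0) : Φ.val x < ∞ := integralFrom_lt_top Φ.gen_mono x

lemma compl_mono : Monotone Φ.compl := integralFrom_mono _

lemma compl_zero : Φ.compl 0 = 0 := integralFrom_zero _

lemma val_strictMono_coe {x y : ℝ≥0} (h : x < y) : Φ.val x < Φ.val y := by
  rcases eq_zero_or_pos x with rfl | hx
  · have h2 : 0 < y / 2 := half_pos h
    have := gen_mul_le_integralFrom Φ.gen_mono (y / 2)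
    have h2y : (2 : ℝ≥0∞) * (y / 2 : ℝ≥0) = y := by
      rw [← ENNReal.coe_two, ← ENNReal.coe_mul, mul_div_cancel₀ y two_ne_zero]
    rw [h2y] at this
    rw [ENNReal.coe_zero, val_zero]
    refine lt_of_lt_of_le ?_ this
    rw [← ENNReal.coe_mul]
    exact ENNReal.coe_pos.2 (mul_pos (Φ.gen_pos _ h2) h2)
  · have := integralFrom_add_mul_le Φ.gen_mono x (y - x)
    rw [add_tsub_cancel_of_le h.le] at this
    refine lt_of_lt_of_le (ENNReal.lt_add_right (Φ.val_lt_top x).ne ?_) this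
    rw [← ENNReal.coe_mul]
    exact (ENNReal.coe_pos.2 (mul_pos (Φ.gen_pos _ hx) (tsub_pos_of_lt h))).ne'

lemma val_top : Φ.val ∞ = ∞ := by
  have h1 : ∀ n : ℕ, (n : ℝ≥0∞) * Φ.val 1 ≤ Φ.val ∞ := fun n => by
    rcases Nat.eq_zero_or_pos n with rfl | hn
    · simp
    have := mul_integralFrom_le Φ.gen_mono (c := (n : ℝ≥0)) (by exact_mod_cast hn) 1
    exact le_trans (by simpa [val] using this) (Φ.val_mono le_top)
  have h0 : 0 < Φ.val 1 := by simpa [val_zero] using Φ.val_strictMono_coe (zero_lt_one (α := ℝ≥0))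
  refine top_le_iff.1 (le_trans ?_ (iSup_le h1))
  rw [← ENNReal.iSup_mul, ENNReal.iSup_natCast, ENNReal.top_mul h0.ne']

lemma val_strictMono : StrictMono Φ.val := by
  intro x y h
  lift x to ℝ≥0 using h.ne_top
  induction y with
  | top => rw [val_top]; exact Φ.val_lt_top x
  | coe y => exact Φ.val_strictMono_coe (ENNReal.coe_lt_coe.1 h)

/-- Intermediate value theorem: bounded generating values make `val` Lipschitz on bounded intervals,
and k · val 1 ≤ val k makes it unbounded. -/
lemma val_surjective : Function.Surjective Φ.val := by
  intro c
  rcases eq_or_ne c ∞ with rfl | hc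
  · exact ⟨∞, Φ.val_top⟩
  obtain ⟨n, hn⟩ : ∃ n : ℝ≥0, c ≤ Φ.val n := by
    by_contra! h
    have h0 : 0 < Φ.val 1 := by
      simpa [val_zero] using Φ.val_strictMono_coe (zero_lt_one (α := ℝ≥0))
    obtain ⟨k, hk⟩ := ENNReal.exists_nat_mul_gt h0.ne' hc
    have hk1 : 1 ≤ (k : ℝ≥0) := by
      rcases Nat.eq_zero_or_pos k with rfl | hk'
      · simp at hk
      · exact_mod_cast hk'
    have := mul_integralFrom_le Φ.gen_mono hk1 1
    rw [mul_one] at this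
    exact (h k).not_ge (hk.le.trans (by simpa [val] using this))
  have hcont : ContinuousOn (fun x : ℝ≥0 => (Φ.val x).toReal) (Icc 0 n) := by
    have hL : LipschitzOnWith (Φ.gen n) (fun x : ℝ≥0 => (Φ.val x).toReal) (Icc 0 n) := by
      have key : ∀ x ∈ Icc 0 n, ∀ y ∈ Icc 0 n, x ≤ y →
          dist (Φ.val x).toReal (Φ.val y).toReal ≤ Φ.gen n * dist x y := by
        intro x _ y hy hxy
        have h1 := integralFrom_sub_le Φ.gen_mono hxy
        have h2 : Φ.val y ≤ Φ.val x + Φ.gen n * (y - x : ℝ≥0) :=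
          h1.trans (add_le_add le_rfl (by gcongr; exact Φ.gen_mono hy.2))
        have h3 := ENNReal.toReal_mono (ENNReal.add_ne_top.2 ⟨(Φ.val_lt_top x).ne,
          ENNReal.mul_ne_top ENNReal.coe_ne_top ENNReal.coe_ne_top⟩) h2
        rw [ENNReal.toReal_add (Φ.val_lt_top x).ne
          (ENNReal.mul_ne_top ENNReal.coe_ne_top ENNReal.coe_ne_top), ENNReal.toReal_mul,
          ENNReal.coe_toReal, ENNReal.coe_toReal, NNReal.coe_sub hxy] at h3
        have h4 := ENNReal.toReal_mono (Φ.val_lt_top y).ne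
          (Φ.val_mono (ENNReal.coe_le_coe.2 hxy))
        have h5 : (x : ℝ) ≤ y := hxy
        rw [Real.dist_eq, NNReal.dist_eq, abs_sub_comm, abs_sub_comm (x : ℝ),
          abs_of_nonneg (sub_nonneg.2 h4), abs_of_nonneg (sub_nonneg.2 h5)]
        linarith
      refine LipschitzOnWith.of_dist_le_mul fun x hx y hy => ?_
      rcases le_total x y with h | h
      · exact key x hx y hy h
      · rw [dist_comm, dist_comm x y]; exact key y hy x hx h
    exact hL.continuousOn
  have := intermediate_value_Icc zero_le hcont
  obtain ⟨x, -, hx⟩ := this (show c.toReal ∈ _ by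
    simp only [ENNReal.coe_zero, val_zero, ENNReal.toReal_zero, mem_Icc]
    exact ⟨ENNReal.toReal_nonneg, ENNReal.toReal_mono (Φ.val_lt_top n).ne hn⟩)
  exact ⟨x, (ENNReal.toReal_eq_toReal_iff' (Φ.val_lt_top x).ne hc).1 hx⟩

/-- An `N`-function as an order automorphism of `[0, ∞]`. -/
def toOrderIso : ℝ≥0∞ ≃o ℝ≥0∞ :=
  Φ.val_strictMono.orderIsoOfSurjective Φ.val Φ.val_surjective

lemma inv_eq (y : ℝ≥0∞) : Φ.inv y = Φ.toOrderIso.symm y := by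
  have : {x : ℝ≥0∞ | Φ.val x ≤ y} = Iic (Φ.toOrderIso.symm y) := by
    ext x
    rw [mem_Iic, OrderIso.le_symm_apply]; rfl
  rw [inv, this, csSup_Iic]

lemma val_inv (y : ℝ≥0∞) : Φ.val (Φ.inv y) = y := by
  rw [inv_eq]; exact Φ.toOrderIso.apply_symm_apply y

lemma inv_val (x : ℝ≥0∞) : Φ.inv (Φ.val x) = x := by
  rw [inv_eq]; exact Φ.toOrderIso.symm_apply_apply x

lemma inv_mono : Monotone Φ.inv := fun a b h => by
  rw [inv_eq, inv_eq]; exact Φ.toOrderIso.symm.monotone h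

lemma inv_le_iff {x y : ℝ≥0∞} : Φ.inv y ≤ x ↔ y ≤ Φ.val x := by
  rw [inv_eq, OrderIso.symm_apply_le]; rfl

lemma val_iSup {ι : Sort*} (f : ι → ℝ≥0∞) : Φ.val (⨆ i, f i) = ⨆ i, Φ.val (f i) :=
  Φ.toOrderIso.map_iSup f

lemma measurable_val : Measurable Φ.val := Φ.val_mono.measurable

lemma val_eq_zero {x : ℝ≥0∞} : Φ.val x = 0 ↔ x = 0 := by
  rw [← Φ.val_strictMono.injective.eq_iff (a := x) (b := 0), Φ.val_zero]

lemma val_eq_top {x : ℝ≥0∞} : Φ.val x = ∞ ↔ x = ∞ := by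
  rw [← Φ.val_strictMono.injective.eq_iff (a := x) (b := ∞), Φ.val_top]

/-- Young's inequality. -/
lemma mul_le_val_add_compl (s t : ℝ≥0∞) : s * t ≤ Φ.val s + Φ.compl t := by
  have hm : Measurable fun z : ℝ × ℝ =>
      {z : ℝ × ℝ | z.1 ≤ Φ.complGen z.2.toNNReal}.indicator (1 : ℝ × ℝ → ℝ≥0∞) z := by
    refine measurable_one.indicator (measurableSet_le measurable_fst ?_)
    exact measurable_coe_nnreal_real.comp (Φ.complGen_mono.measurable.comp
      (measurable_real_toNNReal.comp measurable_snd))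
  calc s * t = ∫⁻ _ in initialSeg s, ∫⁻ _ in initialSeg t, 1 := by
        simp [volume_initialSeg, mul_comm]
    _ ≤ ∫⁻ a in initialSeg s, (Φ.gen a.toNNReal + ∫⁻ b in initialSeg t,
          {z : ℝ × ℝ | z.1 ≤ Φ.complGen z.2.toNNReal}.indicator 1 (a, b)) := by
        refine setLIntegral_mono' (measurableSet_initialSeg s) fun a ha => ?_
        -- Either b < gen a, or gen a ≤ b and hence a ≤ complGen b: the two subgraphs cover the
        -- rectangle.
        have : ∀ b ∈ initialSeg t, (1 : ℝ≥0∞) ≤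
            (initialSeg (Φ.gen a.toNNReal)).indicator 1 b +
            {z : ℝ × ℝ | z.1 ≤ Φ.complGen z.2.toNNReal}.indicator 1 (a, b) := by
          intro b hb
          by_cases h : Φ.gen a.toNNReal ≤ b.toNNReal
          · have := Φ.le_complGen h
            rw [indicator_of_mem (s := {z : ℝ × ℝ | z.1 ≤ Φ.complGen z.2.toNNReal})]
            · simp
            · exact Real.toNNReal_le_iff_le_coe.1 this
          · rw [indicator_of_mem]
            · simp
            · exact ⟨hb.1, ENNReal.coe_lt_coe.2 (not_le.1 h)⟩
        refine (setLIntegral_mono' (measurableSet_initialSeg t) this).trans ?_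
        rw [lintegral_add_left (measurable_one.indicator (measurableSet_initialSeg _))]
        gcongr
        rw [lintegral_indicator (measurableSet_initialSeg _)]
        simp only [Pi.one_apply, lintegral_one, MeasurableSet.univ, Measure.restrict_apply,
          univ_inter]
        exact (Measure.restrict_apply_le _ _).trans (volume_initialSeg _).le
    _ = Φ.val s + ∫⁻ a in initialSeg s, ∫⁻ b in initialSeg t,
          {z : ℝ × ℝ | z.1 ≤ Φ.complGen z.2.toNNReal}.indicator 1 (a, b) := by
        rw [lintegral_add_left]
        · rfl
        · exact measurable_coe_nnreal_ennreal.comp (Φ.gen_mono.measurable.comp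
            measurable_real_toNNReal)
    _ = Φ.val s + ∫⁻ b in initialSeg t, ∫⁻ a in initialSeg s,
          {z : ℝ × ℝ | z.1 ≤ Φ.complGen z.2.toNNReal}.indicator 1 (a, b) := by
        rw [lintegral_lintegral_swap]
        exact hm.aemeasurable
    _ ≤ Φ.val s + Φ.compl t := by
        gcongr
        refine lintegral_mono fun b => ?_
        calc _ ≤ ∫⁻ a in Ioi 0, (Iic (Φ.complGen b.toNNReal : ℝ)).indicator 1 a :=
              lintegral_mono_set fun a ha => ha.1
          _ = _ := by
              rw [lintegral_indicator measurableSet_Iic]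
              simp [Measure.restrict_restrict, Iic_inter_Ioi]

/-- The form in which Δ₂ for Φ is used; it drives Hardy's inequality for tails. -/
lemma exists_gen_mul_le (h : DeltaTwo Φ.val) : ∃ β : ℝ≥0, 1 ≤ β ∧
    ∀ t : ℝ≥0, (Φ.gen t : ℝ≥0∞) * t ≤ β * Φ.val t := by
  obtain ⟨β, -, hβ⟩ := h
  refine ⟨max 1 β, le_max_left _ _, fun t => ?_⟩
  rcases eq_zero_or_pos t with rfl | ht
  · simp
  refine (gen_mul_le_integralFrom Φ.gen_mono t).trans ((hβ t ht).trans ?_)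
  gcongr
  exact le_max_right _ _

lemma exists_complGen_mul_le (h : DeltaTwo Φ.compl) : ∃ β : ℝ≥0, 1 ≤ β ∧
    ∀ t : ℝ≥0, (Φ.complGen t : ℝ≥0∞) * t ≤ β * Φ.compl t := by
  obtain ⟨β, -, hβ⟩ := h
  refine ⟨max 1 β, le_max_left _ _, fun t => ?_⟩
  rcases eq_zero_or_pos t with rfl | ht
  · simp
  refine (gen_mul_le_integralFrom Φ.complGen_mono t).trans ((hβ t ht).trans ?_)
  gcongr
  exact le_max_right _ _

/-- Below complGen t the generating function is at most t. With `exists_complGen_mul_le` this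
controls Φ(complGen t) by Φ̃(t), which is what the converse of Hölder's inequality needs. -/
lemma val_complGen_le (t : ℝ≥0) : Φ.val (Φ.complGen t) ≤ Φ.complGen t * t := by
  calc Φ.val (Φ.complGen t) ≤ ∫⁻ _ in initialSeg (Φ.complGen t), (t : ℝ≥0∞) := by
        refine setLIntegral_mono' (measurableSet_initialSeg _) fun a ha => ?_
        exact ENNReal.coe_le_coe.2 (Φ.gen_le_of_lt_complGen (ENNReal.coe_lt_coe.1 ha.2))
    _ = _ := by rw [setLIntegral_const, volume_initialSeg, mul_comm]

end NFunction

variable {Φ Ψ : NFunction}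

/-- The relation `Φ ≺ Ψ`, for sums over an arbitrary countable index set. -/
lemma Prec.exists_tsum_le (h : Prec Φ Ψ) : ∃ C : ℝ≥0, 1 ≤ C ∧ ∀ {ι : Type} [Countable ι]
    (a : ι → ℝ≥0∞), ∑' i, Ψ.val (Φ.inv (a i)) ≤ C * Ψ.val (Φ.inv (∑' i, a i)) := by
  obtain ⟨C, -, hC⟩ := h
  refine ⟨max 1 C, le_max_left _ _, fun {ι} _ a => ?_⟩
  -- `Prec` speaks of finite entries only; an infinite entry makes the right side infinite, as the
  -- constant is at least 1.
  by_cases hfin : ∃ i, a i = ∞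
  · obtain ⟨i, hi⟩ := hfin
    have : ∑' i, a i = ∞ := ENNReal.tsum_eq_top_of_eq_top ⟨i, hi⟩
    have h1 : Φ.inv ∞ = ∞ := by rw [← Φ.val_top, Φ.inv_val, Φ.val_top]
    rw [this, h1, Ψ.val_top, ENNReal.mul_top]
    · exact le_top
    · exact_mod_cast (zero_lt_one.trans_le (le_max_left 1 C)).ne'
  push Not at hfin
  lift a to ι → ℝ≥0 using hfin
  obtain ⟨e, he⟩ := Countable.exists_injective_nat ι
  have hz : Ψ.val (Φ.inv 0) = 0 := by
    have : Φ.inv 0 = 0 := by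
      conv_lhs => rw [← Φ.val_zero]
      exact Φ.inv_val 0
    rw [this, Ψ.val_zero]
  have hext : ∀ F : ℝ≥0∞ → ℝ≥0∞, F 0 = 0 →
      ∑' n, F ((Function.extend e a 0 n : ℝ≥0) : ℝ≥0∞) = ∑' i, F (a i) := by
    intro F hF
    rw [← tsum_extend_zero he]
    congr 1
    ext n
    by_cases hn : ∃ i, e i = n
    · obtain ⟨i, rfl⟩ := hn
      rw [he.extend_apply, he.extend_apply]
    · rw [Function.extend_apply' _ _ _ hn, Function.extend_apply' _ _ _ hn]
      simpa using hF
  have := hC (Function.extend e a 0)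
  rw [hext (fun x => Ψ.val (Φ.inv x)) hz, hext (fun x => x) rfl] at this
  refine this.trans ?_
  gcongr
  exact le_max_right _ _

end

section

/-! ### Level points of atomless measures on the line -/

lemma measure_Ioi_le_of_forall_gt {κ : Measure ℝ} {r : ℝ} {c : ℝ≥0∞}
    (h : ∀ y, r < y → κ (Ioi y) ≤ c) : κ (Ioi r) ≤ c := by
  obtain ⟨u, hu, hur, hlim⟩ := exists_seq_strictAnti_tendsto r
  have hU : Ioi r = ⋃ n, Ioi (u n) := by
    ext y
    simp only [mem_Ioi, mem_iUnion]
    refine ⟨fun hy => ((hlim.eventually (gt_mem_nhds hy)).exists), fun ⟨n, hn⟩ => (hur n).trans hn⟩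
  rw [hU, Monotone.measure_iUnion]
  · exact iSup_le fun n => h _ (hur n)
  · exact fun a b hab => Ioi_subset_Ioi (hu.antitone hab)

/-- Without atoms the tail function is continuous, so the level c is attained. Taking r as the
supremum of the points with larger tail makes the strict superlevel set exactly (-∞, r), even if the
tail has flat stretches. -/
lemma exists_level_Ioi {κ : Measure ℝ} [NullSingletonClass κ] {a : ℝ} {c : ℝ≥0∞}
    (hfin : κ (Ioi a) ≠ ∞) (hc : 0 < c) (hca : c < κ (Ioi a)) :
    ∃ r, a < r ∧ κ (Ioi r) = c ∧ ∀ y, c < κ (Ioi y) ↔ y < r := by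
  set T := {y | c < κ (Ioi y)} with hT
  have hanti : Antitone fun y => κ (Ioi y) := fun x y h => measure_mono (Ioi_subset_Ioi h)
  have haT : a ∈ T := hca
  have hbdd : BddAbove T := by
    have hlim : Tendsto (fun n : ℕ => κ (Ioi (a + n))) atTop (𝓝 (κ (⋂ n : ℕ, Ioi (a + n)))) := by
      refine tendsto_measure_iInter_atTop (fun n => measurableSet_Ioi.nullMeasurableSet) ?_
        ⟨0, by simpa using hfin⟩
      intro m n h
      exact Ioi_subset_Ioi (by simpa using h)
    have he : ⋂ n : ℕ, Ioi (a + (n : ℝ)) = ∅ := by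
      ext y
      simp only [mem_iInter, mem_Ioi, mem_empty_iff_false, iff_false, not_forall, not_lt]
      obtain ⟨n, hn⟩ := exists_nat_ge (y - a)
      exact ⟨n, by linarith⟩
    rw [he, measure_empty] at hlim
    obtain ⟨n, hn⟩ := (hlim.eventually (gt_mem_nhds hc)).exists
    exact ⟨a + n, fun y hy => le_of_lt (lt_of_not_ge fun h =>
      (hn.trans hy).not_ge (hanti h))⟩
  set r := sSup T
  have hlt : ∀ y, y < r → c < κ (Ioi y) := fun y hy => by
    obtain ⟨z, hz, hyz⟩ := exists_lt_of_lt_csSup ⟨a, haT⟩ hy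
    exact lt_of_lt_of_le hz (hanti hyz.le)
  have hle : κ (Ioi r) ≤ c := measure_Ioi_le_of_forall_gt fun y hy =>
    not_lt.1 fun h => (le_csSup hbdd h).not_gt hy
  have har : a < r := (le_csSup hbdd haT).lt_of_ne fun h => by
    rw [show r = a from h.symm] at hle; exact hle.not_gt hca
  refine ⟨r, har, hle.antisymm ?_, fun y => ⟨fun h => ?_, hlt y⟩⟩
  · obtain ⟨u, hu, hur, hlim⟩ := exists_seq_strictMono_tendsto r
    have hI : Ici r = ⋂ n, Ioi (u n) := by
      ext y
      simp only [mem_Ici, mem_iInter, mem_Ioi]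
      exact ⟨fun h n => (hur n).trans_le h, fun h => le_of_tendsto' hlim fun n => (h n).le⟩
    rw [← measure_congr (Ioi_ae_eq_Ici (μ := κ)).symm, hI]
    obtain ⟨n, hn⟩ := (hlim.eventually (lt_mem_nhds har)).exists
    refine ge_of_tendsto' (tendsto_measure_iInter_atTop
      (fun n => measurableSet_Ioi.nullMeasurableSet)
      (fun m n h => Ioi_subset_Ioi (hu.monotone h)) ⟨n, ?_⟩) fun n => (hlt _ (hur n)).le
    exact ((hanti hn.le).trans_lt hfin.lt_top).ne
  · exact lt_of_not_ge fun hry => ((hanti hry).trans hle).not_gt h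

lemma exists_level_Iic {κ : Measure ℝ} [NullSingletonClass κ] {a : ℝ} {c : ℝ≥0∞}
    (hfin : κ (Iic a) ≠ ∞) (hc : 0 < c) (hca : c < κ (Iic a)) :
    ∃ r, r < a ∧ κ (Iic r) = c ∧ ∀ y, c < κ (Iic y) ↔ r < y := by
  have hmap : ∀ y, (κ.map Neg.neg) (Ioi (-y)) = κ (Iic y) := fun y => by
    rw [Measure.map_apply measurable_neg measurableSet_Ioi,
      measure_congr (Iio_ae_eq_Iic (μ := κ)).symm]
    congr 1
    ext z; simp
  have : NullSingletonClass (κ.map Neg.neg) := ⟨fun x => by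
    rw [Measure.map_apply measurable_neg (measurableSet_singleton x)]
    have : Neg.neg ⁻¹' {x} = ({-x} : Set ℝ) := by ext z; simp
    rw [this, measure_singleton]⟩
  obtain ⟨r, h1, h2, h3⟩ := exists_level_Ioi (κ := κ.map Neg.neg) (a := -a) (c := c)
    (by rwa [hmap]) hc (by rwa [hmap])
  refine ⟨-r, by linarith, by rw [← hmap, neg_neg, h2], fun y => ?_⟩
  rw [← hmap, h3, neg_lt]

lemma measure_Ico_level {κ : Measure ℝ} [NullSingletonClass κ] {r s : ℝ} (h : r ≤ s)
    (hfin : κ (Ioi s) ≠ ∞) : κ (Ico r s) = κ (Ioi r) - κ (Ioi s) := by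
  rw [measure_congr (Ico_ae_eq_Ioc (μ := κ)), ← Ioi_sdiff_Ioi, measure_sdiff (Ioi_subset_Ioi h)
    measurableSet_Ioi.nullMeasurableSet hfin]

lemma measure_Ioc_level {κ : Measure ℝ} {r s : ℝ} (h : r ≤ s)
    (hfin : κ (Iic r) ≠ ∞) : κ (Ioc r s) = κ (Iic s) - κ (Iic r) := by
  have : Iic s \ Iic r = Ioc r s := by ext; simp [and_comm]
  rw [← this, measure_sdiff (Iic_subset_Iic.2 h)
    measurableSet_Iic.nullMeasurableSet hfin]

lemma exists_zpow_level {c : ℝ≥0∞} (h0 : c ≠ 0) (ht : c ≠ ∞) :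
    ∃ j : ℤ, (2 : ℝ≥0∞) ^ j < c ∧ c ≤ 2 ^ (j + 1) := by
  obtain ⟨j, hj⟩ := ENNReal.exists_mem_Ioc_zpow h0 ht (y := 2) (by norm_num) (by norm_num)
  exact ⟨j, hj.1, hj.2⟩

lemma two_zpow_add_one (j : ℤ) : (2 : ℝ≥0∞) ^ (j + 1) = 2 * 2 ^ j := by
  rw [ENNReal.zpow_add two_ne_zero (by norm_num), zpow_one, mul_comm]

lemma two_zpow_pos (j : ℤ) : (0 : ℝ≥0∞) < 2 ^ j := ENNReal.zpow_pos two_ne_zero (by norm_num) j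

lemma two_zpow_ne_top (j : ℤ) : (2 : ℝ≥0∞) ^ j ≠ ∞ :=
  (ENNReal.zpow_lt_top two_ne_zero (by norm_num) j).ne

lemma two_zpow_mono {i j : ℤ} (h : i ≤ j) : (2 : ℝ≥0∞) ^ i ≤ 2 ^ j :=
  ENNReal.zpow_le_of_le (by norm_num) h

/-- The dyadic level sets of a function are pairwise disjoint. -/
lemma pairwise_disjoint_dyadic (F : ℝ → ℝ≥0∞) :
    Pairwise (Function.onFun Disjoint fun j : ℤ => {y | 2 ^ j < F y ∧ F y ≤ 2 ^ (j + 1)}) := by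
  have : ∀ i j : ℤ, i < j → Disjoint {y | 2 ^ i < F y ∧ F y ≤ 2 ^ (i + 1)}
      {y | 2 ^ j < F y ∧ F y ≤ 2 ^ (j + 1)} := fun i j h => by
    rw [Set.disjoint_left]
    rintro y ⟨-, h1⟩ ⟨h2, -⟩
    exact (h2.trans_le (h1.trans (two_zpow_mono h))).false
  intro i j hij
  rcases lt_or_gt_of_ne hij with h | h
  · exact this i j h
  · exact (this j i h).symm

end

section

variable {Φ Ψ : NFunction} {m μ : Measure ℝ}

/-! ### The dual norms and blocks -/

/-- The Luxemburg norm over `B`, with respect to `Φ̃` and `ε m`, of `k / (ε m(-∞, ·))`. -/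
def dualNorm (Φ : NFunction) (m : Measure ℝ) (ε : ℝ≥0) (B : Set ℝ) (k : ℝ → ℝ≥0∞) : ℝ≥0∞ :=
  sInf {τ : ℝ≥0∞ | 0 < τ ∧ τ < ∞ ∧ ∫⁻ y in B, Φ.compl (k y / (ε * m (Iio y)) / τ) * ε ∂m ≤ 1}

lemma dualNorm_mono {ε : ℝ≥0} {B B' : Set ℝ} (h : B ≤ᵐ[m] B') (k : ℝ → ℝ≥0∞) :
    dualNorm Φ m ε B k ≤ dualNorm Φ m ε B' k :=
  sInf_le_sInf fun _ hτ => ⟨hτ.1, hτ.2.1, (lintegral_mono_set' h).trans hτ.2.2⟩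

lemma measurable_measure_Iio (m : Measure ℝ) : Measurable fun y => m (Iio y) :=
  Monotone.measurable fun _ _ h => measure_mono (Iio_subset_Iio h)

/-- Points before which a measure vanishes form a null set. -/
lemma ae_measure_Iio_pos [NullSingletonClass m] : ∀ᵐ y ∂m, 0 < m (Iio y) := by
  simp only [pos_iff_ne_zero]
  rw [ae_iff]
  simp only [ne_eq, not_not]
  refine measure_null_of_locally_null _ fun x hx => ?_
  -- If x is not the last such point, a null half-line is a neighbourhood of it; if it is the last,
  -- the whole set lies in (-∞, x], which is null because x is not an atom.
  by_cases h : ∃ y, x < y ∧ m (Iio y) = 0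
  · obtain ⟨y, hxy, hy⟩ := h
    exact ⟨Iio y, mem_nhdsWithin_of_mem_nhds (Iio_mem_nhds hxy), hy⟩
  · push Not at h
    refine ⟨Iic x, mem_of_superset self_mem_nhdsWithin fun y hy => not_lt.1 fun hxy =>
      h y hxy hy, ?_⟩
    rw [← measure_congr (Iio_ae_eq_Iic (μ := m))]
    exact hx

/-- The part of Hölder's inequality with constant `2`. -/
lemma lintegral_le_two_mul_dualNorm [NullSingletonClass m] {ε : ℝ≥0}
    (hε : 0 < ε) {B : Set ℝ} {k g : ℝ → ℝ≥0∞} (hg : Measurable g)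
    (h : ε * ∫⁻ y in B, Φ.val (g y) ∂m ≤ 1) :
    ∫⁻ y in B, k y * (g y / m (Iio y)) ∂m ≤ 2 * dualNorm Φ m ε B k := by
  have hε0 : (ε : ℝ≥0∞) ≠ 0 := by exact_mod_cast hε.ne'
  rw [mul_comm, ← ENNReal.div_le_iff two_ne_zero (by norm_num)]
  refine le_sInf fun τ ⟨hτ0, hτ, hτ1⟩ => ?_
  rw [ENNReal.div_le_iff two_ne_zero (by norm_num)]
  calc ∫⁻ y in B, k y * (g y / m (Iio y)) ∂m
      -- Young's inequality for the pair g and k/(ε m(-∞,y) τ), scaled by τε; afterwards each of the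
      -- two modulars contributes at most 1.
      ≤ ∫⁻ y in B, τ * (ε * Φ.val (g y) + Φ.compl (k y / (ε * m (Iio y)) / τ) * ε) ∂m := by
        refine lintegral_mono_ae ?_
        filter_upwards [ae_restrict_of_ae (ae_measure_Iio_pos (m := m))] with y hy
        calc k y * (g y / m (Iio y))
            = τ * (ε * (g y * (k y / (ε * m (Iio y)) / τ))) := by
              simp only [div_eq_mul_inv]
              rw [ENNReal.mul_inv (.inl hε0) (.inl ENNReal.coe_ne_top)]
              have h1 := ENNReal.mul_inv_cancel hε0 ENNReal.coe_ne_top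
              have h2 := ENNReal.mul_inv_cancel hτ0.ne' hτ.ne
              calc _ = (ε * (ε : ℝ≥0∞)⁻¹) * (τ * τ⁻¹) * (k y * (g y * (m (Iio y))⁻¹)) := by
                    rw [h1, h2]; simp
                _ = _ := by ring
          _ ≤ τ * (ε * (Φ.val (g y) + Φ.compl (k y / (ε * m (Iio y)) / τ))) := by
              gcongr; exact Φ.mul_le_val_add_compl _ _
          _ = _ := by ring
    _ = τ * (ε * ∫⁻ y in B, Φ.val (g y) ∂m +
          ∫⁻ y in B, Φ.compl (k y / (ε * m (Iio y)) / τ) * ε ∂m) := by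
        have hΦg : Measurable fun y => Φ.val (g y) := Φ.measurable_val.comp hg
        rw [lintegral_const_mul' _ _ hτ.ne, lintegral_add_left (hΦg.const_mul _),
          lintegral_const_mul _ hΦg]
    _ ≤ τ * (1 + 1) := by gcongr
    _ = τ * 2 := by norm_num

lemma NFunction.inv_top (Φ : NFunction) : Φ.inv ∞ = ∞ := by
  conv_lhs => rw [← Φ.val_top]
  exact Φ.inv_val ∞

/-- The freedom in ε replaces homogeneity: with ε the reciprocal of the modular of g on B, Hölder's
inequality applies and the right side of the test becomes that modular. If the modular is 0, g
vanishes a.e. on B; if it is ∞, nothing is claimed. -/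
lemma lintegral_val_block_le [NullSingletonClass m] {B : Set ℝ}
    {k g w ω : ℝ → ℝ≥0∞} (hg : Measurable g)
    (test : ∀ ε : ℝ≥0, 0 < ε →
      ∫⁻ x, Ψ.val (w x * (ω x * (2 * dualNorm Φ m ε B k))) ∂μ ≤ Ψ.val (Φ.inv (1 / ε))) :
    ∫⁻ x, Ψ.val (w x * (ω x * ∫⁻ y in B, k y * (g y / m (Iio y)) ∂m)) ∂μ ≤
      Ψ.val (Φ.inv (∫⁻ y in B, Φ.val (g y) ∂m)) := by
  obtain ⟨a, ha⟩ : ∃ a, a = ∫⁻ y in B, Φ.val (g y) ∂m := ⟨_, rfl⟩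
  rw [← ha]
  rcases eq_or_ne a ∞ with hat | hat
  · rw [hat, Φ.inv_top, Ψ.val_top]; exact le_top
  rcases eq_or_ne a 0 with ha0 | ha0
  · have h0 : ∀ᵐ y ∂m.restrict B, g y = 0 := by
      rw [ha, lintegral_eq_zero_iff (f := fun y => Φ.val (g y)) (Φ.measurable_val.comp hg)] at ha0
      filter_upwards [ha0] with y hy using Φ.val_eq_zero.1 hy
    have : ∫⁻ y in B, k y * (g y / m (Iio y)) ∂m = 0 := by
      rw [lintegral_congr_ae (g := fun _ => 0)]
      · simp
      · filter_upwards [h0] with y hy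
        simp [hy]
    simp [this, Ψ.val_zero]
  lift a to ℝ≥0 using hat
  have ha' : a ≠ 0 := by exact_mod_cast ha0
  have key := test a⁻¹ (by positivity)
  have h1 : (1 : ℝ≥0∞) / (a⁻¹ : ℝ≥0) = a := by
    rw [ENNReal.coe_inv ha', one_div, inv_inv]
  rw [h1] at key
  refine le_trans (lintegral_mono fun x => Ψ.val_mono ?_) key
  gcongr
  refine lintegral_le_two_mul_dualNorm (by positivity) hg ?_
  rw [← ha, ENNReal.coe_inv ha', ENNReal.inv_mul_cancel ha0 ENNReal.coe_ne_top]

/-- Summation of the block estimates over disjoint blocks. -/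
lemma lintegral_val_iSup_blocks_le [NullSingletonClass m]
    {ι : Type} [Countable ι] {C : ℝ≥0∞}
    (hC : ∀ a : ι → ℝ≥0∞, ∑' i, Ψ.val (Φ.inv (a i)) ≤ C * Ψ.val (Φ.inv (∑' i, a i)))
    {B : ι → Set ℝ} (hB : ∀ i, MeasurableSet (B i)) (hd : Pairwise (Function.onFun Disjoint B))
    {k ω : ι → ℝ → ℝ≥0∞} {g w : ℝ → ℝ≥0∞} (hω : ∀ i, Measurable (ω i)) (hg : Measurable g)
    (hw : AEMeasurable w μ)
    (test : ∀ i, ∀ ε : ℝ≥0, 0 < ε →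
      ∫⁻ x, Ψ.val (w x * (ω i x * (2 * dualNorm Φ m ε (B i) (k i)))) ∂μ ≤
        Ψ.val (Φ.inv (1 / ε))) :
    ∫⁻ x, Ψ.val (⨆ i, w x * (ω i x * ∫⁻ y in B i, k i y * (g y / m (Iio y)) ∂m)) ∂μ ≤
      C * Ψ.val (Φ.inv (∫⁻ y, Φ.val (g y) ∂m)) := by
  calc _ ≤ ∫⁻ x, ∑' i, Ψ.val (w x * (ω i x * ∫⁻ y in B i, k i y * (g y / m (Iio y)) ∂m)) ∂μ := by
        refine lintegral_mono fun x => ?_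
        rw [Ψ.val_iSup]
        exact iSup_le fun i => ENNReal.le_tsum i
    _ = ∑' i, ∫⁻ x, Ψ.val (w x * (ω i x * ∫⁻ y in B i, k i y * (g y / m (Iio y)) ∂m)) ∂μ := by
        refine lintegral_tsum fun i => ?_
        exact Ψ.measurable_val.comp_aemeasurable (hw.mul ((hω i).mul_const _).aemeasurable)
    _ ≤ ∑' i, Ψ.val (Φ.inv (∫⁻ y in B i, Φ.val (g y) ∂m)) :=
        ENNReal.tsum_le_tsum fun i => lintegral_val_block_le hg (test i)
    _ ≤ C * Ψ.val (Φ.inv (∑' i, ∫⁻ y in B i, Φ.val (g y) ∂m)) := hC _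
    _ ≤ _ := by
        gcongr
        refine Ψ.val_mono (Φ.inv_mono ?_)
        rw [← lintegral_iUnion hB hd]
        exact setLIntegral_le_lintegral _ _

end

section

/-! ### Iterated tails -/

lemma lintegral_inv_Ioo {x y : ℝ} (hx : 0 < x) (hxy : x ≤ y) :
    ∫⁻ t in Ioo x y, (ENNReal.ofReal t)⁻¹ = ENNReal.ofReal (Real.log (y / x)) := by
  have h0 : (0 : ℝ) ∉ uIcc x y := by
    rw [uIcc_of_le hxy]; exact fun h => hx.not_ge h.1
  have hint : IntegrableOn (fun t : ℝ => t⁻¹) (Ioo x y) :=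
    (ContinuousOn.integrableOn_Icc (continuousOn_inv₀.mono fun t ht =>
      (hx.trans_le ht.1).ne')).mono_set Ioo_subset_Icc_self
  rw [← integral_inv h0, intervalIntegral.integral_of_le hxy, integral_Ioc_eq_integral_Ioo,
    ofReal_integral_eq_lintegral_ofReal hint]
  · refine setLIntegral_congr_fun measurableSet_Ioo fun t ht => ?_
    exact (ENNReal.ofReal_inv_of_pos (hx.trans ht.1)).symm
  · filter_upwards [ae_restrict_mem measurableSet_Ioo] with t ht
    exact inv_nonneg.2 (hx.trans ht.1).le

/-- Tonelli's theorem for weighted integrals of tails. -/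
lemma lintegral_tail_mul (η : Measure ℝ) [SFinite η] (s : Set ℝ)
    {f : ℝ → ℝ≥0∞} (hf : Measurable f) :
    ∫⁻ t in s, η (Ioi t) * f t = ∫⁻ y, (∫⁻ t in s ∩ Iio y, f t) ∂η := by
  have hm : Measurable (Function.uncurry fun t y : ℝ => {z : ℝ × ℝ | z.1 < z.2}.indicator
      (fun z => f z.1) (t, y)) :=
    (hf.comp measurable_fst).indicator (measurableSet_lt measurable_fst measurable_snd)
  calc ∫⁻ t in s, η (Ioi t) * f t
      = ∫⁻ t in s, ∫⁻ y, {z : ℝ × ℝ | z.1 < z.2}.indicator (fun z => f z.1) (t, y) ∂η := by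
        refine lintegral_congr fun t => ?_
        have : (fun y => {z : ℝ × ℝ | z.1 < z.2}.indicator (fun z => f z.1) (t, y)) =
            (Ioi t).indicator fun _ => f t := by
          ext y; simp [indicator]
        rw [this, lintegral_indicator_const measurableSet_Ioi, mul_comm]
    _ = ∫⁻ y, (∫⁻ t in s, {z : ℝ × ℝ | z.1 < z.2}.indicator (fun z => f z.1) (t, y)) ∂η :=
        lintegral_lintegral_swap hm.aemeasurable
    _ = _ := by
        refine lintegral_congr fun y => ?_
        have : (fun t => {z : ℝ × ℝ | z.1 < z.2}.indicator (fun z => f z.1) (t, y)) =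
            (Iio y).indicator f := by
          ext t; simp [indicator]
        rw [this, setLIntegral_indicator measurableSet_Iio, inter_comm]

/-- The origin of the logarithm: 1/t is integrated over x < t < y. Read from right to left, it
exhibits the logarithmic potential as the tail of a measure with a density. -/
lemma lintegral_tail_div (η : Measure ℝ) [SFinite η] {x : ℝ} (hx : 0 < x) :
    ∫⁻ t in Ioi x, η (Ioi t) / ENNReal.ofReal t =
      ∫⁻ y in Ioi x, ENNReal.ofReal (Real.log (y / x)) ∂η := by
  simp_rw [div_eq_mul_inv]
  rw [lintegral_tail_mul η _ (f := fun t => (ENNReal.ofReal t)⁻¹) ENNReal.measurable_ofReal.inv,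
    ← lintegral_indicator measurableSet_Ioi]
  refine lintegral_congr fun y => ?_
  rw [Ioi_inter_Iio]
  by_cases h : x < y
  · rw [indicator_of_mem (mem_Ioi.2 h), lintegral_inv_Ioo hx h.le, div_eq_mul_inv]
  · rw [indicator_of_notMem (by simpa using h), Ioo_eq_empty h]
    simp

/-- A point y > 0 is counted with weight min(x, y), the length of (0, x) below it. -/
lemma lintegral_tail_Ioo (η : Measure ℝ) [SFinite η] (x : ℝ) :
    ∫⁻ t in Ioo 0 x, η (Ioi t) =
      ∫⁻ y in Iic x, ENNReal.ofReal y ∂η + ENNReal.ofReal x * η (Ioi x) := by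
  have := lintegral_tail_mul η (Ioo 0 x) (measurable_const (a := 1))
  simp only [mul_one, lintegral_one, Measure.restrict_apply MeasurableSet.univ, univ_inter] at this
  rw [this, ← lintegral_add_compl _ (measurableSet_Iic (a := x)), compl_Iic]
  congr 1
  · refine setLIntegral_congr_fun measurableSet_Iic fun y hy => ?_
    have : Ioo 0 x ∩ Iio y = Ioo 0 y := by
      ext t; simp only [mem_inter_iff, mem_Ioo, mem_Iio]
      exact ⟨fun h => ⟨h.1.1, h.2⟩, fun h => ⟨⟨h.1, h.2.trans_le hy⟩, h.2⟩⟩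
    simp [this]
  · rw [← setLIntegral_const]
    refine setLIntegral_congr_fun measurableSet_Ioi fun y hy => ?_
    have : Ioo 0 x ∩ Iio y = Ioo 0 x := inter_eq_left.2 fun t ht => ht.2.trans hy
    simp [this]

/-- The logarithmic potential splits at an intermediate point. -/
lemma lintegral_log_le (η : Measure ℝ) [NullSingletonClass η] {r s : ℝ} (hr : 0 < r)
    (hrs : r ≤ s) :
    ∫⁻ y in Ioi r, ENNReal.ofReal (Real.log (y / r)) ∂η ≤
      ∫⁻ y in Ico r s, ENNReal.ofReal (Real.log (y / r)) ∂η +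
      (ENNReal.ofReal (Real.log (s / r)) * η (Ioi s) +
        ∫⁻ y in Ioi s, ENNReal.ofReal (Real.log (y / s)) ∂η) := by
  have hs := hr.trans_le hrs
  calc _ ≤ ∫⁻ y in Ico r s ∪ Ici s, ENNReal.ofReal (Real.log (y / r)) ∂η := by
        refine lintegral_mono_set fun y hy => ?_
        rcases lt_or_ge y s with h | h
        · exact .inl ⟨le_of_lt hy, h⟩
        · exact .inr h
    _ ≤ _ := lintegral_union_le _ _ _
    _ = ∫⁻ y in Ico r s, ENNReal.ofReal (Real.log (y / r)) ∂η +
        ∫⁻ y in Ioi s, ENNReal.ofReal (Real.log (y / r)) ∂η := by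
        rw [Measure.restrict_congr_set (Ioi_ae_eq_Ici (μ := η) (a := s))]
    _ ≤ _ := by
        refine add_le_add le_rfl ?_
        rw [← setLIntegral_const, ← lintegral_add_left measurable_const]
        refine setLIntegral_mono' measurableSet_Ioi fun y hy => ?_
        have hy0 : 0 < y := hs.trans hy
        rw [← ENNReal.ofReal_add (Real.log_nonneg ((one_le_div hr).2 hrs))
          (Real.log_nonneg ((one_le_div hs).2 (le_of_lt hy))), ← Real.log_mul (by positivity)
          (by positivity)]
        refine ENNReal.ofReal_le_ofReal (le_of_eq ?_)
        congr 1
        field_simp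

/-! ### Dyadic level data -/

/-- The band of levels (2^j, 2^(j+1]] is an interval of κ-mass 2^j, as large as its lower level;
this lets one block account for the whole tail. -/
lemma exists_dyadic_Ioi {κ : Measure ℝ} [NullSingletonClass κ] {a : ℝ} (hfin : κ (Ioi a) ≠ ∞)
    {j : ℤ} (h : 2 ^ (j + 1) < κ (Ioi a)) :
    ∃ r s, a < r ∧ r ≤ s ∧ κ (Ioi r) = 2 ^ (j + 1) ∧ κ (Ioi s) = 2 ^ j ∧
      (∀ y, 2 ^ (j + 1) < κ (Ioi y) ↔ y < r) ∧
      {y | 2 ^ j < κ (Ioi y) ∧ κ (Ioi y) ≤ 2 ^ (j + 1)} = Ico r s := by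
  obtain ⟨r, har, hr, hr'⟩ := exists_level_Ioi hfin (two_zpow_pos _) h
  obtain ⟨s, has, hs, hs'⟩ := exists_level_Ioi hfin (two_zpow_pos _)
    ((two_zpow_mono (by omega : j ≤ j + 1)).trans_lt h)
  refine ⟨r, s, har, ?_, hr, hs, hr', ?_⟩
  · refine not_lt.1 fun hsr => ?_
    have := (hr' s).2 hsr
    rw [hs] at this
    exact this.not_ge (two_zpow_mono (by omega))
  · ext y
    rw [mem_ofPred_eq, hs', ← not_lt, hr', not_lt, mem_Ico, and_comm]

lemma exists_dyadic_Iic {κ : Measure ℝ} [NullSingletonClass κ] {a : ℝ} (hfin : κ (Iic a) ≠ ∞)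
    {j : ℤ} (h : 2 ^ (j + 1) < κ (Iic a)) :
    ∃ r s, s < a ∧ r ≤ s ∧ κ (Iic r) = 2 ^ j ∧ κ (Iic s) = 2 ^ (j + 1) ∧
      (∀ y, 2 ^ (j + 1) < κ (Iic y) ↔ s < y) ∧
      {y | 2 ^ j < κ (Iic y) ∧ κ (Iic y) ≤ 2 ^ (j + 1)} = Ioc r s := by
  obtain ⟨s, has, hs, hs'⟩ := exists_level_Iic hfin (two_zpow_pos _) h
  obtain ⟨r, har, hr, hr'⟩ := exists_level_Iic hfin (two_zpow_pos _)
    ((two_zpow_mono (by omega : j ≤ j + 1)).trans_lt h)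
  refine ⟨r, s, has, ?_, hr, hs, hs', ?_⟩
  · refine not_lt.1 fun hsr => ?_
    have := (hs' r).2 hsr
    rw [hr] at this
    exact this.not_ge (two_zpow_mono (by omega))
  · ext y
    rw [mem_ofPred_eq, hr', ← not_lt, hs', not_lt, mem_Ioc]

lemma two_zpow_add_one_sub (j : ℤ) : (2 : ℝ≥0∞) ^ (j + 1) - 2 ^ j = 2 ^ j := by
  rw [two_zpow_add_one, two_mul]
  exact ENNReal.add_sub_cancel_right (two_zpow_ne_top j)

lemma two_zpow_add_two (j : ℤ) : (2 : ℝ≥0∞) ^ (j + 1 + 1) = 4 * 2 ^ j := by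
  rw [two_zpow_add_one, two_zpow_add_one, ← mul_assoc]; norm_num

/-- Going one level below the dyadic band of c places a point of value c strictly beyond the block
of level j, at the price of a factor 4. -/
lemma exists_zpow_level_sub_one {c : ℝ≥0∞} (h0 : c ≠ 0) (ht : c ≠ ∞) :
    ∃ j : ℤ, (2 : ℝ≥0∞) ^ (j + 1) < c ∧ c ≤ 4 * 2 ^ j := by
  obtain ⟨j, h1, h2⟩ := exists_zpow_level h0 ht
  refine ⟨j - 1, by simpa using h1, ?_⟩
  rw [← two_zpow_add_two]; simpa using h2

/-- The test conditions, with a common constant. -/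
structure TestBounds (Φ Ψ : NFunction) (m μ : Measure ℝ) (w : ℝ → ℝ≥0∞) (A : ℝ≥0) : Prop where
  mean : ∀ (r : ℝ) (ε : ℝ≥0), 0 < r → 0 < ε →
    ∫⁻ x in Ioi r, Ψ.val (w x * ((A : ℝ≥0∞)⁻¹ * (ENNReal.ofReal x)⁻¹ *
      dualNorm Φ m ε (Iio r) ENNReal.ofReal)) ∂μ ≤ Ψ.val (Φ.inv (1 / ε))
  tail : ∀ (r : ℝ) (ε : ℝ≥0), 0 < r → 0 < ε →
    ∫⁻ x in Iio r, Ψ.val (w x * ((A : ℝ≥0∞)⁻¹ *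
      dualNorm Φ m ε (Ioi r) 1)) ∂μ ≤ Ψ.val (Φ.inv (1 / ε))
  logTail : ∀ (r : ℝ) (ε : ℝ≥0), 0 < r → 0 < ε →
    ∫⁻ x in Iio r, Ψ.val (w x * ((A : ℝ≥0∞)⁻¹ *
      dualNorm Φ m ε (Ioi r) fun y => ENNReal.ofReal (Real.log (y / r)))) ∂μ ≤
      Ψ.val (Φ.inv (1 / ε))
  tailLog : ∀ (r : ℝ) (ε : ℝ≥0), 0 < r → 0 < ε →
    ∫⁻ x in Iio r, Ψ.val (w x * ((A : ℝ≥0∞)⁻¹ * ENNReal.ofReal (Real.log (r / x)) *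
      dualNorm Φ m ε (Ioi r) 1)) ∂μ ≤ Ψ.val (Φ.inv (1 / ε))

end

section

variable {Φ Ψ : NFunction} {m μ : Measure ℝ} {w g : ℝ → ℝ≥0∞} {A : ℝ≥0} {C : ℝ≥0∞}

/-! ### Sufficiency of the test conditions -/

/-- The density of `g` with respect to `m`, divided by the distribution function of `m`. -/
def hardyMeasure (m : Measure ℝ) (g : ℝ → ℝ≥0∞) : Measure ℝ :=
  m.withDensity fun y => g y / m (Iio y)

lemma measurable_hardyDensity (hg : Measurable g) : Measurable fun y => g y / m (Iio y) :=
  hg.div (measurable_measure_Iio m)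

lemma lintegral_hardyMeasure (hg : Measurable g) {k : ℝ → ℝ≥0∞} (hk : Measurable k) :
    ∫⁻ y, k y ∂hardyMeasure m g = ∫⁻ y, k y * (g y / m (Iio y)) ∂m := by
  rw [hardyMeasure, lintegral_withDensity_eq_lintegral_mul _ (measurable_hardyDensity hg) hk]
  simp [mul_comm]

lemma setLIntegral_hardyMeasure (hg : Measurable g) {k : ℝ → ℝ≥0∞} (hk : Measurable k)
    {B : Set ℝ} (hB : MeasurableSet B) :
    ∫⁻ y in B, k y ∂hardyMeasure m g = ∫⁻ y in B, k y * (g y / m (Iio y)) ∂m := by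
  rw [hardyMeasure, setLIntegral_withDensity_eq_setLIntegral_mul _ (measurable_hardyDensity hg)
    hk hB]
  simp [mul_comm]

/-- The majorant is the supremum over the blocks, so its bound does not depend on their number. The
factor ω i may carry the cutoff to the side of the block on which a test condition is available. -/
lemma exists_block_majorant [NullSingletonClass m] {ι : Type} [Countable ι]
    (hC : ∀ a : ι → ℝ≥0∞, ∑' i, Ψ.val (Φ.inv (a i)) ≤ C * Ψ.val (Φ.inv (∑' i, a i)))
    {B : ι → Set ℝ} (hB : ∀ i, MeasurableSet (B i)) (hd : Pairwise (Function.onFun Disjoint B))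
    {k ω : ι → ℝ → ℝ≥0∞} (hk : ∀ i, Measurable (k i)) (hω : ∀ i, Measurable (ω i))
    (hg : Measurable g) (hw : AEMeasurable w μ)
    (test : ∀ i, ∀ ε : ℝ≥0, 0 < ε →
      ∫⁻ x, Ψ.val (w x * (ω i x * (2 * dualNorm Φ m ε (B i) (k i)))) ∂μ ≤
        Ψ.val (Φ.inv (1 / ε))) :
    ∃ U : ℝ → ℝ≥0∞, AEMeasurable U μ ∧
      ∫⁻ x, Ψ.val (U x) ∂μ ≤ C * Ψ.val (Φ.inv (∫⁻ y, Φ.val (g y) ∂m)) ∧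
      ∀ i x, w x * (ω i x * ∫⁻ y in B i, k i y ∂hardyMeasure m g) ≤ U x := by
  refine ⟨_, ?_, lintegral_val_iSup_blocks_le hC hB hd hω hg hw test, fun i x => ?_⟩
  · exact AEMeasurable.iSup fun i => hw.mul ((hω i).mul_const _).aemeasurable
  · rw [setLIntegral_hardyMeasure hg (hk i) (hB i)]
    exact le_iSup (fun i => w x * (ω i x * ∫⁻ y in B i, k i y * (g y / m (Iio y)) ∂m)) i

lemma lintegral_val_indicator_mul {s : Set ℝ} (hs : MeasurableSet s) (ω : ℝ → ℝ≥0∞)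
    (c : ℝ≥0∞) :
    ∫⁻ x, Ψ.val (w x * (s.indicator ω x * c)) ∂μ = ∫⁻ x in s, Ψ.val (w x * (ω x * c)) ∂μ := by
  rw [← lintegral_indicator hs]
  refine lintegral_congr fun x => ?_
  by_cases hx : x ∈ s <;> simp [hx, Ψ.val_zero]

/-- The factor 2 of Hölder's inequality is absorbed by (2A)⁻¹ in the majorants below. -/
lemma two_mul_inv_two_mul (a : ℝ≥0∞) : 2 * (2 * a)⁻¹ = a⁻¹ := by
  rw [ENNReal.mul_inv (.inl two_ne_zero) (.inl (by norm_num)), ← mul_assoc,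
    ENNReal.mul_inv_cancel two_ne_zero (by norm_num), one_mul]

/-! ### Majorants for the averaging, tail and logarithmic terms -/

section Families

variable [NullSingletonClass m]
  (hC : ∀ {ι : Type} [Countable ι] (a : ι → ℝ≥0∞),
    ∑' i, Ψ.val (Φ.inv (a i)) ≤ C * Ψ.val (Φ.inv (∑' i, a i)))
  (hT : TestBounds Φ Ψ m μ w A) (hg : Measurable g) (hw : AEMeasurable w μ)
include hC hT hg hw

/-- The integral of y over y ≤ x is the distribution function of an atomless κ. If its value at x
exceeds 2^(j+1), the block of level j lies to the left of x and has κ-mass 2^j, at least a quarter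
of that value for suitable j. The test condition is applied at the right end of the block. -/
lemma exists_majorant_mean (h0 : m (Iic 0) = 0)
    (hfin : ∀ x, ∫⁻ y in Iic x, ENNReal.ofReal y ∂hardyMeasure m g ≠ ∞) :
    ∃ U : ℝ → ℝ≥0∞, AEMeasurable U μ ∧
      ∫⁻ x, Ψ.val (U x) ∂μ ≤ C * Ψ.val (Φ.inv (∫⁻ y, Φ.val (g y) ∂m)) ∧
      ∀ x, w x * ((2 * (A : ℝ≥0∞))⁻¹ * (ENNReal.ofReal x)⁻¹ *
        ∫⁻ y in Iic x, ENNReal.ofReal y ∂hardyMeasure m g) ≤ 4 * U x := by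
  set η := hardyMeasure m g with hη
  have : NullSingletonClass η := nullSingletonClass_withDensity _
  set κ := η.withDensity ENNReal.ofReal with hκ
  have : NullSingletonClass κ := nullSingletonClass_withDensity _
  have hκF : ∀ x, κ (Iic x) = ∫⁻ y in Iic x, ENNReal.ofReal y ∂η := fun x =>
    withDensity_apply _ measurableSet_Iic
  have hκB : ∀ B, MeasurableSet B → κ B = ∫⁻ y in B, ENNReal.ofReal y ∂η := fun B hB =>
    withDensity_apply _ hB
  simp_rw [← hκF] at hfin ⊢
  have hκ0 : κ (Iic 0) = 0 := by
    rw [hκF, Measure.restrict_eq_zero.2, lintegral_zero_measure]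
    exact withDensity_absolutelyContinuous _ _ h0
  -- Only levels that are surpassed somewhere are indexed, so that both ends of every block exist.
  let ι := {j : ℤ // ∃ x, 2 ^ (j + 1) < κ (Iic x)}
  have hdata : ∀ j : ι, ∃ r s, r ≤ s ∧ κ (Iic r) = 2 ^ j.1 ∧ κ (Iic s) = 2 ^ (j.1 + 1) ∧
      (∀ y, 2 ^ (j.1 + 1) < κ (Iic y) ↔ s < y) ∧
      {y | 2 ^ j.1 < κ (Iic y) ∧ κ (Iic y) ≤ 2 ^ (j.1 + 1)} = Ioc r s := by
    rintro ⟨j, x, hx⟩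
    obtain ⟨r, s, -, h⟩ := exists_dyadic_Iic (hfin x) hx
    exact ⟨r, s, h⟩
  choose r s hrs hr hs hlev hB using hdata
  have hs0 : ∀ j, 0 < s j := fun j => by
    by_contra! h
    have : κ (Iic (s j)) ≤ 0 := hκ0 ▸ measure_mono (Iic_subset_Iic.2 h)
    rw [hs] at this
    exact this.not_gt (two_zpow_pos _)
  obtain ⟨U, hU, hU1, hU2⟩ := exists_block_majorant (Φ := Φ) (Ψ := Ψ) (m := m) (μ := μ) (g := g)
    (w := w) (C := C) (B := fun j : ι => Ioc (r j) (s j)) (k := fun _ => ENNReal.ofReal)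
    (ω := fun j => (Ioi (s j)).indicator fun x => (2 * (A : ℝ≥0∞))⁻¹ * (ENNReal.ofReal x)⁻¹)
    hC (fun _ => measurableSet_Ioc) (by
      intro i j hij
      have := pairwise_disjoint_dyadic (fun y => κ (Iic y))
        (fun h => hij (Subtype.ext h) : i.1 ≠ j.1)
      simp only [Function.onFun] at this ⊢
      rwa [hB, hB] at this)
    (fun _ => ENNReal.measurable_ofReal)
    (fun j => (measurable_const.mul ENNReal.measurable_ofReal.inv).indicator measurableSet_Ioi)
    hg hw (by
      intro j ε hε
      rw [lintegral_val_indicator_mul measurableSet_Ioi]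
      refine le_trans (lintegral_mono fun x => Ψ.val_mono ?_) (hT.mean (s j) ε (hs0 j) hε)
      gcongr w x * ?_
      calc _ = 2 * (2 * (A : ℝ≥0∞))⁻¹ * (ENNReal.ofReal x)⁻¹ *
            dualNorm Φ m ε (Ioc (r j) (s j)) ENNReal.ofReal := by ring
        _ ≤ _ := by
          rw [two_mul_inv_two_mul]
          gcongr
          refine dualNorm_mono ?_ _
          refine EventuallyLE.trans (LE.le.eventuallyLE ?_) (Iio_ae_eq_Iic (μ := m)).symm.le
          exact fun y hy => hy.2)
  refine ⟨U, hU, hU1, fun x => ?_⟩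
  rcases eq_or_ne (κ (Iic x)) 0 with hx | hx
  · simp [hx]
  obtain ⟨j, hj1, hj2⟩ := exists_zpow_level_sub_one hx (hfin x)
  have := hU2 ⟨j, x, hj1⟩ x
  rw [indicator_of_mem (show x ∈ Ioi (s ⟨j, x, hj1⟩) from (hlev ⟨j, x, hj1⟩ x).1 hj1),
    ← hη, ← hκB _ measurableSet_Ioc,
    measure_Ioc_level (hrs _) (by rw [hr]; exact two_zpow_ne_top _), hr, hs,
    two_zpow_add_one_sub] at this
  calc _ ≤ w x * ((2 * (A : ℝ≥0∞))⁻¹ * (ENNReal.ofReal x)⁻¹ * (4 * 2 ^ j)) := by gcongr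
    _ = 4 * (w x * ((2 * (A : ℝ≥0∞))⁻¹ * (ENNReal.ofReal x)⁻¹ * 2 ^ j)) := by ring
    _ ≤ _ := by gcongr

/-- The mirror image of the averaging case, with levels of η(x,∞) and blocks to the right of x. The
same blocks give the second majorant: the block chosen for η(ρ,∞) starts at some r j > ρ, so
log(ρ/x) ≤ log(r j/x) and `tailLog` applies at r j. -/
lemma exists_majorant_tail
    (hfin : ∀ x, hardyMeasure m g (Ioi x) ≠ ∞) :
    ∃ U U' : ℝ → ℝ≥0∞, AEMeasurable U μ ∧ AEMeasurable U' μ ∧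
      ∫⁻ x, Ψ.val (U x) ∂μ ≤ C * Ψ.val (Φ.inv (∫⁻ y, Φ.val (g y) ∂m)) ∧
      ∫⁻ x, Ψ.val (U' x) ∂μ ≤ C * Ψ.val (Φ.inv (∫⁻ y, Φ.val (g y) ∂m)) ∧
      (∀ x, 0 < x → w x * ((2 * (A : ℝ≥0∞))⁻¹ * hardyMeasure m g (Ioi x)) ≤ 4 * U x) ∧
      ∀ x ρ, 0 < x → x ≤ ρ → w x * ((2 * (A : ℝ≥0∞))⁻¹ * ENNReal.ofReal (Real.log (ρ / x)) *
        hardyMeasure m g (Ioi ρ)) ≤ 4 * U' x := by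
  set η := hardyMeasure m g with hη
  have : NullSingletonClass η := nullSingletonClass_withDensity _
  let ι := {j : ℤ // ∃ x, 0 < x ∧ 2 ^ (j + 1) < η (Ioi x)}
  have hdata : ∀ j : ι, ∃ r s, 0 < r ∧ r ≤ s ∧ η (Ioi r) = 2 ^ (j.1 + 1) ∧ η (Ioi s) = 2 ^ j.1 ∧
      (∀ y, 2 ^ (j.1 + 1) < η (Ioi y) ↔ y < r) ∧
      {y | 2 ^ j.1 < η (Ioi y) ∧ η (Ioi y) ≤ 2 ^ (j.1 + 1)} = Ico r s := by
    rintro ⟨j, x, hx0, hx⟩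
    obtain ⟨r, s, hr, h⟩ := exists_dyadic_Ioi (hfin x) hx
    exact ⟨r, s, hx0.trans hr, h⟩
  choose r s hr0 hrs hr hs hlev hB using hdata
  have hdisj : Pairwise (Function.onFun Disjoint fun j : ι => Ico (r j) (s j)) := by
    intro i j hij
    have := pairwise_disjoint_dyadic (fun y => η (Ioi y))
      (fun h => hij (Subtype.ext h) : i.1 ≠ j.1)
    simp only [Function.onFun] at this ⊢
    rwa [hB, hB] at this
  have hsub : ∀ j ε, dualNorm Φ m ε (Ico (r j) (s j)) 1 ≤ dualNorm Φ m ε (Ioi (r j)) 1 := by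
    refine fun j ε => dualNorm_mono ?_ _
    refine EventuallyLE.trans (LE.le.eventuallyLE ?_) (Ioi_ae_eq_Ici (μ := m)).symm.le
    exact fun y hy => hy.1
  have hηB : ∀ j, ∫⁻ _ in Ico (r j) (s j), (1 : ℝ → ℝ≥0∞) 1 ∂η = 2 ^ j.1 := fun j => by
    simp only [Pi.one_apply, lintegral_one, Measure.restrict_apply MeasurableSet.univ, univ_inter]
    rw [measure_Ico_level (hrs _) (by rw [hs]; exact two_zpow_ne_top _), hr, hs,
      two_zpow_add_one_sub]
  obtain ⟨U, hU, hU1, hU2⟩ := exists_block_majorant (Φ := Φ) (Ψ := Ψ) (m := m) (μ := μ) (g := g)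
    (w := w) (C := C) (B := fun j : ι => Ico (r j) (s j)) (k := fun _ => 1)
    (ω := fun j => (Iio (r j)).indicator fun _ => (2 * (A : ℝ≥0∞))⁻¹)
    hC (fun _ => measurableSet_Ico) hdisj (fun _ => measurable_one)
    (fun j => measurable_const.indicator measurableSet_Iio)
    hg hw (by
      intro j ε hε
      rw [lintegral_val_indicator_mul measurableSet_Iio]
      refine le_trans (lintegral_mono fun x => Ψ.val_mono ?_) (hT.tail (r j) ε (hr0 j) hε)
      gcongr w x * ?_
      calc _ = 2 * (2 * (A : ℝ≥0∞))⁻¹ * dualNorm Φ m ε (Ico (r j) (s j)) 1 := by ring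
        _ ≤ _ := by
          rw [two_mul_inv_two_mul]
          gcongr
          exact hsub j ε)
  have hmeas : ∀ ρ, Measurable fun x => (2 * (A : ℝ≥0∞))⁻¹ *
      ENNReal.ofReal (Real.log (ρ / x)) := fun ρ =>
    measurable_const.mul
      (Real.measurable_log.comp (measurable_const.div measurable_id)).ennreal_ofReal
  obtain ⟨U', hU', hU1', hU2'⟩ := exists_block_majorant (Φ := Φ) (Ψ := Ψ) (m := m) (μ := μ)
    (g := g) (w := w) (C := C) (B := fun j : ι => Ico (r j) (s j)) (k := fun _ => 1)
    (ω := fun j => (Iio (r j)).indicator fun x => (2 * (A : ℝ≥0∞))⁻¹ *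
      ENNReal.ofReal (Real.log (r j / x)))
    hC (fun _ => measurableSet_Ico) hdisj (fun _ => measurable_one)
    (fun j => (hmeas _).indicator measurableSet_Iio)
    hg hw (by
      intro j ε hε
      rw [lintegral_val_indicator_mul measurableSet_Iio]
      refine le_trans (lintegral_mono fun x => Ψ.val_mono ?_) (hT.tailLog (r j) ε (hr0 j) hε)
      gcongr w x * ?_
      calc _ = 2 * (2 * (A : ℝ≥0∞))⁻¹ * ENNReal.ofReal (Real.log (r j / x)) *
            dualNorm Φ m ε (Ico (r j) (s j)) 1 := by ring
        _ ≤ _ := by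
          rw [two_mul_inv_two_mul]
          gcongr
          exact hsub j ε)
  refine ⟨U, U', hU, hU', hU1, hU1', fun x hx0 => ?_, fun x ρ hx0 hxρ => ?_⟩
  · rcases eq_or_ne (η (Ioi x)) 0 with hx | hx
    · simp [hx]
    obtain ⟨j, hj1, hj2⟩ := exists_zpow_level_sub_one hx (hfin x)
    have := hU2 ⟨j, x, hx0, hj1⟩ x
    rw [indicator_of_mem (show x ∈ Iio (r ⟨j, x, hx0, hj1⟩) from
      (hlev ⟨j, x, hx0, hj1⟩ x).1 hj1)] at this
    replace this := (congrArg _ (congrArg _ (hηB ⟨j, x, hx0, hj1⟩).symm)).trans_le this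
    calc _ ≤ w x * ((2 * (A : ℝ≥0∞))⁻¹ * (4 * 2 ^ j)) := by gcongr
      _ = 4 * (w x * ((2 * (A : ℝ≥0∞))⁻¹ * 2 ^ j)) := by ring
      _ ≤ _ := by gcongr
  · rcases eq_or_ne (η (Ioi ρ)) 0 with hx | hx
    · simp [hx]
    have hρ0 := hx0.trans_le hxρ
    obtain ⟨j, hj1, hj2⟩ := exists_zpow_level_sub_one hx (hfin ρ)
    have := hU2' ⟨j, ρ, hρ0, hj1⟩ x
    have hρr : ρ < r ⟨j, ρ, hρ0, hj1⟩ := (hlev ⟨j, ρ, hρ0, hj1⟩ ρ).1 hj1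
    rw [indicator_of_mem (show x ∈ Iio (r ⟨j, ρ, hρ0, hj1⟩) from hxρ.trans_lt hρr)] at this
    replace this := (congrArg _ (congrArg _ (hηB ⟨j, ρ, hρ0, hj1⟩).symm)).trans_le this
    calc _ ≤ w x * ((2 * (A : ℝ≥0∞))⁻¹ *
          ENNReal.ofReal (Real.log (r ⟨j, ρ, hρ0, hj1⟩ / x)) * (4 * 2 ^ j)) := by
          gcongr
      _ = 4 * (w x * ((2 * (A : ℝ≥0∞))⁻¹ *
          ENNReal.ofReal (Real.log (r ⟨j, ρ, hρ0, hj1⟩ / x)) * 2 ^ j)) := by ring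
      _ ≤ _ := by gcongr

/-- The logarithmic potential over (x,∞) is not additive in blocks, because its kernel depends on x.
Splitting it at the right end of a block leaves an integral over the block, handled by `logTail`,
and a correction log(ρ/x) η(ρ,∞), which is left to the second majorant of `exists_majorant_tail`. -/
lemma exists_majorant_logTail [SFinite m]
    (hfin : hardyMeasure m g univ ≠ ∞)
    (hKfin : ∀ x, 0 < x →
      ∫⁻ y in Ioi x, ENNReal.ofReal (Real.log (y / x)) ∂hardyMeasure m g ≠ ∞) :
    ∃ U : ℝ → ℝ≥0∞, AEMeasurable U μ ∧
      ∫⁻ x, Ψ.val (U x) ∂μ ≤ C * Ψ.val (Φ.inv (∫⁻ y, Φ.val (g y) ∂m)) ∧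
      ∀ x, 0 < x → ∃ ρ, x ≤ ρ ∧ w x * ((2 * (A : ℝ≥0∞))⁻¹ *
        ∫⁻ y in Ioi x, ENNReal.ofReal (Real.log (y / x)) ∂hardyMeasure m g) ≤ 4 * U x +
        4 * (w x * ((2 * (A : ℝ≥0∞))⁻¹ * ENNReal.ofReal (Real.log (ρ / x)) *
        hardyMeasure m g (Ioi ρ))) := by
  set η := hardyMeasure m g with hη
  have : NullSingletonClass η := nullSingletonClass_withDensity _
  have : IsFiniteMeasure η := ⟨hfin.lt_top⟩
  -- For x > 0 the potential is the tail κ(x,∞) of this atomless measure, so the dyadic level lemmas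
  -- apply to it.
  set κ := (volume.restrict (Ioi (0 : ℝ))).withDensity fun t => η (Ioi t) / ENNReal.ofReal t
    with hκ
  have : NullSingletonClass κ := nullSingletonClass_withDensity _
  have hκK : ∀ x, 0 < x → κ (Ioi x) = ∫⁻ y in Ioi x, ENNReal.ofReal (Real.log (y / x)) ∂η := by
    intro x hx
    rw [hκ, withDensity_apply _ measurableSet_Ioi, Measure.restrict_restrict measurableSet_Ioi,
      inter_eq_left.2 (Ioi_subset_Ioi hx.le), lintegral_tail_div η hx]
  let ι := {j : ℤ // ∃ x, 0 < x ∧ 2 ^ (j + 1) < κ (Ioi x)}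
  have hdata : ∀ j : ι, ∃ r s, 0 < r ∧ r ≤ s ∧ κ (Ioi r) = 2 ^ (j.1 + 1) ∧ κ (Ioi s) = 2 ^ j.1 ∧
      (∀ y, 2 ^ (j.1 + 1) < κ (Ioi y) ↔ y < r) ∧
      {y | 2 ^ j.1 < κ (Ioi y) ∧ κ (Ioi y) ≤ 2 ^ (j.1 + 1)} = Ico r s := by
    rintro ⟨j, x, hx0, hx⟩
    obtain ⟨r, s, hr, h⟩ := exists_dyadic_Ioi (by rw [hκK x hx0]; exact hKfin x hx0) hx
    exact ⟨r, s, hx0.trans hr, h⟩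
  choose r s hr0 hrs hr hs hlev hB using hdata
  have hlogm : ∀ r, Measurable fun y => ENNReal.ofReal (Real.log (y / r)) := fun r =>
    (Real.measurable_log.comp (measurable_id.div_const r)).ennreal_ofReal
  obtain ⟨U, hU, hU1, hU2⟩ := exists_block_majorant (Φ := Φ) (Ψ := Ψ) (m := m) (μ := μ) (g := g)
    (w := w) (C := C) (B := fun j : ι => Ico (r j) (s j))
    (k := fun j y => ENNReal.ofReal (Real.log (y / r j)))
    (ω := fun j => (Iio (r j)).indicator fun _ => (2 * (A : ℝ≥0∞))⁻¹)
    hC (fun _ => measurableSet_Ico) (by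
      intro i j hij
      have := pairwise_disjoint_dyadic (fun y => κ (Ioi y))
        (fun h => hij (Subtype.ext h) : i.1 ≠ j.1)
      simp only [Function.onFun] at this ⊢
      rwa [hB, hB] at this)
    (fun j => hlogm (r j)) (fun j => measurable_const.indicator measurableSet_Iio)
    hg hw (by
      intro j ε hε
      rw [lintegral_val_indicator_mul measurableSet_Iio]
      refine le_trans (lintegral_mono fun x => Ψ.val_mono ?_) (hT.logTail (r j) ε (hr0 j) hε)
      gcongr w x * ?_
      calc _ = 2 * (2 * (A : ℝ≥0∞))⁻¹ * dualNorm Φ m ε (Ico (r j) (s j))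
            fun y => ENNReal.ofReal (Real.log (y / r j)) := by ring
        _ ≤ _ := by
          rw [two_mul_inv_two_mul]
          gcongr
          refine dualNorm_mono ?_ _
          refine EventuallyLE.trans (LE.le.eventuallyLE ?_) (Ioi_ae_eq_Ici (μ := m)).symm.le
          exact fun y hy => hy.1)
  refine ⟨U, hU, hU1, fun x hx0 => ?_⟩
  rw [← hκK x hx0]
  rcases eq_or_ne (κ (Ioi x)) 0 with hx | hx
  · exact ⟨x, le_rfl, by simp [hx]⟩
  obtain ⟨j, hj1, hj2⟩ := exists_zpow_level_sub_one hx (by rw [hκK x hx0]; exact hKfin x hx0)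
  set i : ι := ⟨j, x, hx0, hj1⟩ with hi
  have hxr : x < r i := (hlev i x).1 hj1
  have := hU2 i x
  rw [indicator_of_mem (show x ∈ Iio (r i) from hxr)] at this
  refine ⟨s i, (hxr.trans_le (hrs i)).le, ?_⟩
  have hsplit := lintegral_log_le η (hr0 i) (hrs i)
  rw [← hκK _ (hr0 i), ← hκK _ ((hr0 i).trans_le (hrs i)), hr, hs, two_zpow_add_one, two_mul,
    ← add_assoc] at hsplit
  -- The potential is 2·2^j at r and 2^j at s. Cancelling the latter bounds 2^j by the block
  -- integral plus log(s/r) η(s,∞), whence ρ = s.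
  replace hsplit := ENNReal.le_of_add_le_add_right (two_zpow_ne_top _) hsplit
  have hlog : ENNReal.ofReal (Real.log (s i / r i)) ≤ ENNReal.ofReal (Real.log (s i / x)) := by
    have := hr0 i
    have := (hr0 i).trans_le (hrs i)
    gcongr
  calc _ ≤ w x * ((2 * (A : ℝ≥0∞))⁻¹ * (4 * 2 ^ j)) := by gcongr
    _ ≤ w x * ((2 * (A : ℝ≥0∞))⁻¹ * (4 *
          (∫⁻ y in Ico (r i) (s i), ENNReal.ofReal (Real.log (y / r i)) ∂η +
          ENNReal.ofReal (Real.log (s i / x)) * η (Ioi (s i))))) := by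
        gcongr
        exact hsplit.trans (by gcongr)
    _ = 4 * (w x * ((2 * (A : ℝ≥0∞))⁻¹ *
          ∫⁻ y in Ico (r i) (s i), ENNReal.ofReal (Real.log (y / r i)) ∂η)) +
        4 * (w x * ((2 * (A : ℝ≥0∞))⁻¹ * ENNReal.ofReal (Real.log (s i / x)) *
          η (Ioi (s i)))) := by ring
    _ ≤ _ := by gcongr

end Families

end

/-! ### The tail kernel, truncation, and the inequality for tails -/

section

variable {Φ Ψ : NFunction} {m μ : Measure ℝ} {w g : ℝ → ℝ≥0∞} {A : ℝ≥0}

/-- The kernel of the sum of the averaging operator and its adjoint, applied to tails. -/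
def tailKernel (x y : ℝ) : ℝ≥0∞ :=
  (Iic x).indicator (fun y => (ENNReal.ofReal x)⁻¹ * ENNReal.ofReal y) y +
    (Ioi x).indicator (fun y => 1 + ENNReal.ofReal (Real.log (y / x))) y

lemma measurable_tailKernel : Measurable (Function.uncurry tailKernel) := by
  refine Measurable.add ?_ ?_
  · exact Measurable.indicator (s := {z : ℝ × ℝ | z.2 ≤ z.1})
      (f := fun z => (ENNReal.ofReal z.1)⁻¹ * ENNReal.ofReal z.2)
      ((ENNReal.measurable_ofReal.comp measurable_fst).inv.mul
        (ENNReal.measurable_ofReal.comp measurable_snd))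
      (measurableSet_le measurable_snd measurable_fst)
  · exact Measurable.indicator (s := {z : ℝ × ℝ | z.1 < z.2})
      (f := fun z => 1 + ENNReal.ofReal (Real.log (z.2 / z.1)))
      (measurable_const.add
        (Real.measurable_log.comp (measurable_snd.div measurable_fst)).ennreal_ofReal)
      (measurableSet_lt measurable_fst measurable_snd)

lemma measurable_tailKernel_right (x : ℝ) : Measurable (tailKernel x) :=
  measurable_tailKernel.of_uncurry_left

lemma lintegral_tailKernel (η : Measure ℝ) (x : ℝ) :
    ∫⁻ y, tailKernel x y ∂η = (ENNReal.ofReal x)⁻¹ * ∫⁻ y in Iic x, ENNReal.ofReal y ∂η +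
      (η (Ioi x) + ∫⁻ y in Ioi x, ENNReal.ofReal (Real.log (y / x)) ∂η) := by
  simp only [tailKernel]
  rw [lintegral_add_left ((ENNReal.measurable_ofReal.const_mul _).indicator measurableSet_Iic),
    lintegral_indicator measurableSet_Iic, lintegral_indicator measurableSet_Ioi,
    lintegral_const_mul _ ENNReal.measurable_ofReal, lintegral_add_left measurable_const,
    setLIntegral_one]

/-- The sets on which truncated functions are supported. -/
def truncSet (m : Measure ℝ) (n : ℕ) : Set ℝ := {y | y < n ∧ (n : ℝ≥0∞)⁻¹ < m (Iio y)}

lemma measurableSet_truncSet (m : Measure ℝ) (n : ℕ) : MeasurableSet (truncSet m n) :=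
  measurableSet_Iio.inter (measurableSet_lt measurable_const (measurable_measure_Iio m))

lemma truncSet_mono (m : Measure ℝ) : Monotone (truncSet m) := fun a b h y hy =>
  ⟨hy.1.trans_le (by exact_mod_cast h),
    lt_of_le_of_lt (ENNReal.inv_le_inv.2 (by exact_mod_cast h)) hy.2⟩

lemma exists_mem_truncSet {y : ℝ} (h : 0 < m (Iio y)) : ∃ n, y ∈ truncSet m n := by
  obtain ⟨a, ha⟩ := exists_nat_gt y
  obtain ⟨b, hb⟩ := ENNReal.exists_inv_nat_lt h.ne'
  refine ⟨max a b, ha.trans_le (by exact_mod_cast le_max_left a b), lt_of_le_of_lt ?_ hb⟩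
  exact ENNReal.inv_le_inv.2 (by exact_mod_cast le_max_right a b)

/-- Bounded functions supported on a truncation set. -/
def IsTruncated (m : Measure ℝ) (g : ℝ → ℝ≥0∞) : Prop :=
  ∃ (n : ℕ) (M : ℝ≥0), ∀ y, g y ≤ (truncSet m n).indicator (fun _ => (M : ℝ≥0∞)) y

/-- On the truncation set 1/m(-∞,y) ≤ n, so the density is at most M·n and lives on a half-line of
finite m-measure. Finite mass and support bounded above keep all level functions finite. -/
lemma IsTruncated.exists_bound (hm : ∀ x, m (Iio x) ≠ ∞) (hgT : IsTruncated m g) :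
    hardyMeasure m g univ ≠ ∞ ∧ ∃ b, 0 < b ∧ hardyMeasure m g (Ici b) = 0 := by
  obtain ⟨n, M, h⟩ := hgT
  have hle : ∀ y, g y / m (Iio y) ≤ (Iio (n : ℝ)).indicator (fun _ => (M : ℝ≥0∞) * n) y := by
    intro y
    by_cases hy : y ∈ truncSet m n
    · rw [indicator_of_mem (show y ∈ Iio (n : ℝ) from hy.1), div_eq_mul_inv]
      have := h y
      rw [indicator_of_mem hy] at this
      gcongr
      exact ENNReal.inv_le_iff_inv_le.2 hy.2.le
    · have := h y
      rw [indicator_of_notMem hy, nonpos_iff_eq_zero] at this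
      simp [this]
  constructor
  · rw [hardyMeasure, withDensity_apply _ MeasurableSet.univ, Measure.restrict_univ]
    refine ((lintegral_mono hle).trans_lt ?_).ne
    rw [lintegral_indicator_const measurableSet_Iio]
    exact ENNReal.mul_lt_top (ENNReal.mul_lt_top ENNReal.coe_lt_top (by simp)) (hm _).lt_top
  · refine ⟨n + 1, by positivity, ?_⟩
    rw [hardyMeasure, withDensity_apply _ measurableSet_Ici, ← nonpos_iff_eq_zero]
    refine (lintegral_mono hle).trans ?_
    rw [lintegral_indicator_const measurableSet_Iio, Measure.restrict_apply measurableSet_Iio]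
    have : Iio (n : ℝ) ∩ Ici ((n : ℝ) + 1) = ∅ := by
      ext y; simp only [mem_inter_iff, mem_Iio, mem_Ici, mem_empty_iff_false, iff_false, not_and]
      intro h; linarith
    simp [this]

/-- The constant is 112 = 28·4. Here 28 = 4 + 4 + 4 + 16 collects the majorants, the 16 coming from
the logarithmic correction, which pays the factor 4 twice. The remaining 4C enters by convexity and
cancels the sum of four modulars, each at most C times the right side. -/
lemma lintegral_hardySum_truncated_le [NullSingletonClass m] [SFinite m]
    (hm : ∀ x, m (Iio x) ≠ ∞) (h0 : m (Iic 0) = 0) (hμ : μ (Iic 0) = 0) {C : ℝ≥0} (hC1 : 1 ≤ C)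
    (hC : ∀ {ι : Type} [Countable ι] (a : ι → ℝ≥0∞),
      ∑' i, Ψ.val (Φ.inv (a i)) ≤ C * Ψ.val (Φ.inv (∑' i, a i)))
    (hT : TestBounds Φ Ψ m μ w A) (hg : Measurable g) (hw : AEMeasurable w μ)
    (hgT : IsTruncated m g) :
    ∫⁻ x, Ψ.val (w x * ((2 * (A : ℝ≥0∞))⁻¹ * ∫⁻ y, tailKernel x y ∂hardyMeasure m g) /
      (112 * C : ℝ≥0)) ∂μ ≤ Ψ.val (Φ.inv (∫⁻ y, Φ.val (g y) ∂m)) := by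
  obtain ⟨hfin, b, hb0, hb⟩ := hgT.exists_bound hm
  have hηfin : ∀ s, hardyMeasure m g s ≠ ∞ := fun s =>
    ((measure_mono (subset_univ s)).trans_lt hfin.lt_top).ne
  obtain ⟨U₁, h1, h1', h1''⟩ := exists_majorant_mean hC hT hg hw h0 (by
    intro x
    refine ((setLIntegral_mono' measurableSet_Iic fun y hy =>
      ENNReal.ofReal_le_ofReal hy).trans_lt (b := ∫⁻ _ in Iic x, ENNReal.ofReal x ∂_) ?_).ne
    rw [setLIntegral_const]
    exact ENNReal.mul_lt_top ENNReal.ofReal_lt_top (hηfin _).lt_top)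
  obtain ⟨U₂, U₄, h2, h4, h2', h4', h2'', h4''⟩ := exists_majorant_tail hC hT hg hw
    fun x => hηfin _
  obtain ⟨U₃, h3, h3', h3''⟩ := exists_majorant_logTail hC hT hg hw hfin (by
    intro x hx
    have hlt : ∀ᵐ y ∂(hardyMeasure m g).restrict (Ioi x), y < b :=
      ae_restrict_of_ae (by rw [ae_iff]; simpa [Ici] using hb)
    refine (lt_of_le_of_lt (b := ∫⁻ _ in Ioi x, ENNReal.ofReal (Real.log (b / x)) ∂_)
      (lintegral_mono_ae ?_) ?_).ne
    · filter_upwards [hlt, ae_restrict_mem measurableSet_Ioi] with y hy hxy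
      have : 0 < y := hx.trans hxy
      gcongr
    · rw [setLIntegral_const]
      exact ENNReal.mul_lt_top ENNReal.ofReal_lt_top (hηfin _).lt_top)
  set X := Ψ.val (Φ.inv (∫⁻ y, Φ.val (g y) ∂m))
  have hC0 : (C : ℝ≥0∞) ≠ 0 := by exact_mod_cast (zero_lt_one.trans_le hC1).ne'
  have hμ0 : ∀ᵐ x ∂μ, 0 < x := by
    rw [ae_iff]; simpa [Iic] using hμ
  calc _ ≤ ∫⁻ x, (Ψ.val (U₁ x) + (Ψ.val (U₂ x) + (Ψ.val (U₃ x) + Ψ.val (U₄ x)))) /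
          (4 * C : ℝ≥0) ∂μ := by
        refine lintegral_mono_ae ?_
        filter_upwards [hμ0] with x hx
        obtain ⟨ρ, hρ, hρ'⟩ := h3'' x hx
        set M := U₁ x ⊔ (U₂ x ⊔ (U₃ x ⊔ U₄ x)) with hM
        have e1 : U₁ x ≤ M := le_sup_left
        have e2 : U₂ x ≤ M := le_sup_left.trans le_sup_right
        have e3 : U₃ x ≤ M := le_sup_left.trans (le_sup_right.trans le_sup_right)
        have e4 : U₄ x ≤ M := le_sup_right.trans (le_sup_right.trans le_sup_right)
        have hle : w x * ((2 * (A : ℝ≥0∞))⁻¹ * ∫⁻ y, tailKernel x y ∂hardyMeasure m g) ≤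
            28 * M := by
          rw [lintegral_tailKernel]
          calc _ = w x * ((2 * (A : ℝ≥0∞))⁻¹ * (ENNReal.ofReal x)⁻¹ *
                  ∫⁻ y in Iic x, ENNReal.ofReal y ∂hardyMeasure m g) +
                (w x * ((2 * (A : ℝ≥0∞))⁻¹ * hardyMeasure m g (Ioi x)) +
                w x * ((2 * (A : ℝ≥0∞))⁻¹ *
                  ∫⁻ y in Ioi x, ENNReal.ofReal (Real.log (y / x)) ∂hardyMeasure m g)) := by
                ring
            _ ≤ 4 * U₁ x + (4 * U₂ x + (4 * U₃ x + 4 * (4 * U₄ x))) := by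
                refine add_le_add (h1'' x) (add_le_add (h2'' x hx) (hρ'.trans ?_))
                exact add_le_add le_rfl (mul_le_mul_right (h4'' x ρ hx hρ) 4)
            _ ≤ 4 * M + (4 * M + (4 * M + 4 * (4 * M))) := by gcongr
            _ = 28 * M := by ring
        have hdiv : w x * ((2 * (A : ℝ≥0∞))⁻¹ * ∫⁻ y, tailKernel x y ∂hardyMeasure m g) /
            (112 * C : ℝ≥0) ≤ M / (4 * C : ℝ≥0) := by
          refine ENNReal.div_le_of_le_mul (hle.trans (le_of_eq ?_))
          rw [div_eq_mul_inv]
          have h4C : ((4 * C : ℝ≥0) : ℝ≥0∞) ≠ 0 := by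
            push_cast; exact mul_ne_zero (by norm_num) hC0
          have : ((112 * C : ℝ≥0) : ℝ≥0∞) = 28 * (4 * C : ℝ≥0) := by
            push_cast; ring
          rw [this]
          calc 28 * M = 28 * M * (((4 * C : ℝ≥0) : ℝ≥0∞)⁻¹ * (4 * C : ℝ≥0)) := by
                rw [ENNReal.inv_mul_cancel h4C ENNReal.coe_ne_top, mul_one]
            _ = _ := by ring
        refine (Ψ.val_mono hdiv).trans ((integralFrom_div_le Ψ.gen_mono ?_ M).trans ?_)
        · calc (1 : ℝ≥0) ≤ 4 * 1 := by norm_num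
            _ ≤ 4 * C := by gcongr
        · gcongr
          change Ψ.val M ≤ _
          rw [hM, Ψ.val_mono.map_sup, Ψ.val_mono.map_sup, Ψ.val_mono.map_sup]
          refine sup_le le_self_add (sup_le ?_ (sup_le ?_ ?_))
          · exact le_self_add.trans le_add_self
          · exact le_self_add.trans (le_add_self.trans le_add_self)
          · exact le_add_self.trans (le_add_self.trans le_add_self)
    _ = (∫⁻ x, Ψ.val (U₁ x) ∂μ + (∫⁻ x, Ψ.val (U₂ x) ∂μ + (∫⁻ x, Ψ.val (U₃ x) ∂μ +
          ∫⁻ x, Ψ.val (U₄ x) ∂μ))) / (4 * C : ℝ≥0) := by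
        simp_rw [div_eq_mul_inv]
        rw [lintegral_mul_const', lintegral_add_left' (f := fun x => Ψ.val (U₁ x))
            (Ψ.measurable_val.comp_aemeasurable h1),
          lintegral_add_left' (f := fun x => Ψ.val (U₂ x))
            (Ψ.measurable_val.comp_aemeasurable h2),
          lintegral_add_left' (f := fun x => Ψ.val (U₃ x))
            (Ψ.measurable_val.comp_aemeasurable h3)]
        refine ENNReal.inv_ne_top.2 ?_
        push_cast; exact mul_ne_zero (by norm_num) hC0
    _ ≤ (C * X + (C * X + (C * X + C * X))) / (4 * C : ℝ≥0) := by gcongr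
    _ ≤ X := by
        refine ENNReal.div_le_of_le_mul (le_of_eq ?_)
        push_cast; ring

/-- Truncation of a function. -/
def truncate (m : Measure ℝ) (g : ℝ → ℝ≥0∞) (n : ℕ) : ℝ → ℝ≥0∞ :=
  (truncSet m n).indicator fun y => min (g y) n

lemma measurable_truncate (hg : Measurable g) (n : ℕ) : Measurable (truncate m g n) :=
  (hg.min measurable_const).indicator (measurableSet_truncSet m n)

lemma isTruncated_truncate (m : Measure ℝ) (g : ℝ → ℝ≥0∞) (n : ℕ) :
    IsTruncated m (truncate m g n) :=
  ⟨n, n, fun _ => indicator_le_indicator (by simp)⟩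

lemma truncate_le (m : Measure ℝ) (g : ℝ → ℝ≥0∞) (n : ℕ) (y : ℝ) : truncate m g n y ≤ g y :=
  indicator_le (s := truncSet m n) (f := fun y => min (g y) n) (g := g)
    (fun _ _ => min_le_left _ _) y

lemma truncate_mono (m : Measure ℝ) (g : ℝ → ℝ≥0∞) (y : ℝ) :
    Monotone fun n => truncate m g n y := fun a b h => by
  refine (indicator_le_indicator_of_subset (truncSet_mono m h) (fun _ => zero_le) y).trans ?_
  exact indicator_le_indicator (min_le_min_left _ (by exact_mod_cast h))

lemma iSup_truncate {y : ℝ} (h : 0 < m (Iio y)) : ⨆ n, truncate m g n y = g y := by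
  refine le_antisymm (iSup_le fun n => truncate_le m g n y) ?_
  obtain ⟨N, hN⟩ := exists_mem_truncSet h
  refine le_of_forall_lt fun c hc => ?_
  obtain ⟨k, hk⟩ := ENNReal.exists_nat_gt hc.ne_top
  refine lt_of_lt_of_le ?_ (le_iSup _ (max N k))
  rw [truncate, indicator_of_mem (truncSet_mono m (le_max_left N k) hN)]
  exact lt_min hc (hk.trans_le (by exact_mod_cast le_max_right N k))

lemma lintegral_hardyMeasure_eq_iSup [NullSingletonClass m] (hg : Measurable g)
    {k : ℝ → ℝ≥0∞} (hk : Measurable k) :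
    ∫⁻ y, k y ∂hardyMeasure m g = ⨆ n, ∫⁻ y, k y ∂hardyMeasure m (truncate m g n) := by
  rw [lintegral_hardyMeasure hg hk]
  simp_rw [lintegral_hardyMeasure (measurable_truncate hg _) hk]
  rw [← lintegral_iSup (f := fun n y => k y * (truncate m g n y / m (Iio y)))
    fun n => hk.mul (measurable_hardyDensity (measurable_truncate hg n))]
  · refine lintegral_congr_ae ?_
    filter_upwards [ae_measure_Iio_pos (m := m)] with y hy
    simp_rw [div_eq_mul_inv, ← mul_assoc]
    rw [← ENNReal.iSup_mul, ← ENNReal.mul_iSup, iSup_truncate hy]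
  · intro a b h y
    dsimp only
    gcongr
    exact truncate_mono m g y h

lemma hardyMeasure_mono {g' : ℝ → ℝ≥0∞} (h : ∀ y, g y ≤ g' y) :
    hardyMeasure m g ≤ hardyMeasure m g' :=
  withDensity_mono (ae_of_all _ fun y => by dsimp only; gcongr; exact h y)

lemma measurable_lintegral_tailKernel [SFinite m] (g : ℝ → ℝ≥0∞) :
    Measurable fun x => ∫⁻ y, tailKernel x y ∂hardyMeasure m g := by
  have : SFinite (hardyMeasure m g) := by unfold hardyMeasure; infer_instance
  exact measurable_tailKernel.lintegral_prod_right'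

/-- The test conditions imply the modular inequality for the operator on tails. -/
lemma exists_lintegral_hardySum_le [NullSingletonClass m] [SFinite m]
    (hm : ∀ x, m (Iio x) ≠ ∞) (h0 : m (Iic 0) = 0) (hμ : μ (Iic 0) = 0) (hP : Prec Φ Ψ)
    (hA : 0 < A) (hT : TestBounds Φ Ψ m μ w A) (hw : AEMeasurable w μ) :
    ∃ D : ℝ≥0, 0 < D ∧ ∀ g : ℝ → ℝ≥0∞, Measurable g →
      ∫⁻ x, Ψ.val (w x * ∫⁻ y, tailKernel x y ∂hardyMeasure m g) ∂μ ≤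
        Ψ.val (Φ.inv (∫⁻ y, Φ.val (D * g y) ∂m)) := by
  obtain ⟨C, hC1, hC⟩ := hP.exists_tsum_le
  have hC0 : 0 < C := zero_lt_one.trans_le hC1
  -- Putting D into g undoes both the factor (2A)⁻¹ and the division by 112C of the truncated
  -- estimate.
  set D : ℝ≥0 := 2 * A * (112 * C) with hD
  have hD0 : (D : ℝ≥0∞) ≠ 0 := by exact_mod_cast (by positivity : D ≠ 0)
  refine ⟨D, by positivity, fun g hg => ?_⟩
  have hDg : Measurable fun y => D * g y := hg.const_mul _
  have hscale : ∀ n x, w x * ((2 * (A : ℝ≥0∞))⁻¹ *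
      ∫⁻ y, tailKernel x y ∂hardyMeasure m (fun y => D * truncate m g n y)) / (112 * C : ℝ≥0) =
      w x * ∫⁻ y, tailKernel x y ∂hardyMeasure m (truncate m g n) := by
    intro n x
    rw [lintegral_hardyMeasure ((measurable_truncate hg n).const_mul _)
      (measurable_tailKernel_right x), lintegral_hardyMeasure (measurable_truncate hg n)
      (measurable_tailKernel_right x)]
    have : ∀ y, tailKernel x y * (D * truncate m g n y / m (Iio y)) =
        D * (tailKernel x y * (truncate m g n y / m (Iio y))) := fun y => by
      simp only [div_eq_mul_inv]; ring
    simp_rw [this]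
    rw [lintegral_const_mul' _ _ ENNReal.coe_ne_top, div_eq_mul_inv]
    have h2 : (2 * (A : ℝ≥0∞))⁻¹ * (((112 * C : ℝ≥0) : ℝ≥0∞)⁻¹ * D) = 1 := by
      rw [← mul_assoc, ← ENNReal.mul_inv (.inr ENNReal.coe_ne_top)
        (.inl (ENNReal.mul_ne_top (by norm_num) ENNReal.coe_ne_top))]
      have : 2 * (A : ℝ≥0∞) * (112 * C : ℝ≥0) = D := by rw [hD]; push_cast; ring
      rw [this, ENNReal.inv_mul_cancel hD0 ENNReal.coe_ne_top]
    generalize (∫⁻ y, tailKernel x y * (truncate m g n y / m (Iio y)) ∂m) = I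
    calc _ = w x * I * ((2 * (A : ℝ≥0∞))⁻¹ * (((112 * C : ℝ≥0) : ℝ≥0∞)⁻¹ * D)) := by ring
      _ = _ := by rw [h2, mul_one]
  have hn : ∀ n, ∫⁻ x, Ψ.val (w x * ∫⁻ y, tailKernel x y ∂hardyMeasure m (truncate m g n)) ∂μ ≤
      Ψ.val (Φ.inv (∫⁻ y, Φ.val (D * g y) ∂m)) := by
    intro n
    simp_rw [← hscale n]
    refine (lintegral_hardySum_truncated_le hm h0 hμ hC1 hC hT
      ((measurable_truncate hg n).const_mul _) hw ?_).trans ?_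
    · obtain ⟨N, M, h⟩ := isTruncated_truncate m g n
      refine ⟨N, D * M, fun y => ?_⟩
      calc D * truncate m g n y ≤ D * (truncSet m N).indicator (fun _ => (M : ℝ≥0∞)) y := by
            gcongr; exact h y
        _ = _ := by by_cases hy : y ∈ truncSet m N <;> simp [hy]
    · refine Ψ.val_mono (Φ.inv_mono (lintegral_mono fun y => Φ.val_mono ?_))
      gcongr
      exact truncate_le m g n y
  -- Monotone convergence in the truncation parameter, inside Ψ and then in the integral over μ.
  simp_rw [lintegral_hardyMeasure_eq_iSup hg (measurable_tailKernel_right _), ENNReal.mul_iSup,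
    Ψ.val_iSup]
  rw [lintegral_iSup']
  · exact iSup_le hn
  · intro n
    exact Ψ.measurable_val.comp_aemeasurable (hw.mul
      (measurable_lintegral_tailKernel _).aemeasurable)
  · refine ae_of_all _ fun x a b h => Ψ.val_mono ?_
    gcongr
    exact hardyMeasure_mono fun y => truncate_mono m g y h

end

/-! ### Non-increasing functions and their tail majorants -/

section

variable {Φ Ψ : NFunction} {m μ : Measure ℝ} {w : ℝ → ℝ≥0∞}

/-- The sum of the averaging operator and its adjoint. -/
def calderon (f : ℝ → ℝ≥0∞) (x : ℝ) : ℝ≥0∞ :=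
  (ENNReal.ofReal x)⁻¹ * (∫⁻ t in Ioo 0 x, f t) + ∫⁻ t in Ioi x, f t / ENNReal.ofReal t

lemma calderon_mono {f g : ℝ → ℝ≥0∞} (h : ∀ t, 0 < t → f t ≤ g t) {x : ℝ} (hx : 0 < x) :
    calderon f x ≤ calderon g x := by
  unfold calderon
  refine add_le_add (mul_le_mul_right ?_ _) ?_
  · exact setLIntegral_mono' measurableSet_Ioo fun t ht => h t ht.1
  · refine setLIntegral_mono' measurableSet_Ioi fun t ht => ?_
    gcongr
    exact h t (hx.trans ht)

/-- The part x·η(x,∞) of ∫_0^x η(t,∞) dt cancels the factor 1/x; it is the summand 1 of the kernel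
on (x,∞). -/
lemma calderon_tail (η : Measure ℝ) [SFinite η] {x : ℝ} (hx : 0 < x) :
    calderon (fun t => η (Ioi t)) x = ∫⁻ y, tailKernel x y ∂η := by
  have h : ENNReal.ofReal x ≠ 0 := (ENNReal.ofReal_pos.2 hx).ne'
  simp only [calderon]
  rw [lintegral_tailKernel, lintegral_tail_Ioo η x, lintegral_tail_div η hx, mul_add,
    ← mul_assoc, ENNReal.inv_mul_cancel h ENNReal.ofReal_ne_top, one_mul, add_assoc]

/-- The infinite total mass is what makes every level 2^j, j ∈ ℤ, attained. -/
lemma exists_dyadic_points [NullSingletonClass m] (hm : ∀ x, m (Iio x) ≠ ∞)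
    (hinf : m univ = ∞) :
    ∃ r : ℤ → ℝ, ∀ j, m (Iic (r j)) = 2 ^ j ∧ ∀ y, 2 ^ j < m (Iic y) ↔ r j < y := by
  have : ∀ j : ℤ, ∃ r, m (Iic r) = 2 ^ j ∧ ∀ y, 2 ^ j < m (Iic y) ↔ r < y := fun j => by
    have hlim := tendsto_measure_Iic_atTop m
    rw [hinf] at hlim
    obtain ⟨a, ha⟩ := (hlim.eventually (lt_mem_nhds (two_zpow_ne_top j).lt_top)).exists
    obtain ⟨r, -, h⟩ := exists_level_Iic (κ := m) (a := a)
      (by rw [← measure_congr (Iio_ae_eq_Iic (μ := m))]; exact hm a) (two_zpow_pos j) ha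
    exact ⟨r, h⟩
  choose r hr using this
  exact ⟨r, hr⟩

/-- A non-increasing function is dominated by a tail with comparable modular. -/
lemma exists_tail_majorant [NullSingletonClass m] (hm : ∀ x, m (Iio x) ≠ ∞) (h0 : m (Iic 0) = 0)
    (hinf : m univ = ∞) (hpos : ∀ x, 0 < x → 0 < m (Iio x)) {f : ℝ → ℝ≥0}
    (hf : AntitoneOn f (Ioi 0)) :
    ∃ g : ℝ → ℝ≥0∞, Measurable g ∧ (∀ x, 0 < x → f x ≤ hardyMeasure m g (Ioi x)) ∧
      ∀ c : ℝ≥0, ∫⁻ y, Φ.val (c * g y) ∂m ≤ ∫⁻ y, Φ.val ((8 * c : ℝ≥0) * f y) ∂m := by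
  obtain ⟨r, hr⟩ := exists_dyadic_points hm hinf
  have hlev : ∀ j, {y | 2 ^ j < m (Iic y) ∧ m (Iic y) ≤ 2 ^ (j + 1)} =
      Ioc (r j) (r (j + 1)) := fun j => by
    ext y
    rw [mem_ofPred_eq, (hr j).2, ← not_lt, (hr (j + 1)).2, not_lt, mem_Ioc]
  have hdisj : Pairwise (Function.onFun Disjoint fun j : ℤ => Ioc (r j) (r (j + 1))) := by
    intro i j hij
    have := pairwise_disjoint_dyadic (fun y => m (Iic y)) hij
    simp only [Function.onFun] at this ⊢
    rwa [hlev, hlev] at this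
  have hle : ∀ j, r j ≤ r (j + 1) := fun j => by
    rw [← not_lt, ← (hr (j + 1)).2, (hr j).1, not_lt]; exact two_zpow_mono (by omega)
  have hr0 : ∀ j, 0 < r j := fun j => by
    by_contra! h
    have : m (Iic (r j)) ≤ 0 := h0 ▸ measure_mono (Iic_subset_Iic.2 h)
    rw [(hr j).1] at this
    exact this.not_gt (two_zpow_pos _)
  have hmeas : ∀ j, m (Ioc (r j) (r (j + 1))) = 2 ^ j := fun j => by
    rw [measure_Ioc_level (hle j) (by rw [(hr j).1]; exact two_zpow_ne_top j), (hr _).1, (hr _).1,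
      two_zpow_add_one_sub]
  have hcov : ∀ y, 0 < y → ∃ j, y ∈ Ioc (r j) (r (j + 1)) := fun y hy => by
    have h1 : m (Iic y) ≠ 0 := by
      rw [← measure_congr (Iio_ae_eq_Iic (μ := m))]; exact (hpos y hy).ne'
    have h2 : m (Iic y) ≠ ∞ := by
      rw [← measure_congr (Iio_ae_eq_Iic (μ := m))]; exact hm y
    obtain ⟨j, h⟩ := exists_zpow_level h1 h2
    exact ⟨j, hlev j ▸ h⟩
  have hrestr : m.restrict (⋃ j, Ioc (r j) (r (j + 1))) = m := by
    refine Measure.restrict_eq_self_of_ae_mem ?_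
    have : ∀ᵐ y ∂m, 0 < y := by rw [ae_iff]; simpa [Iic] using h0
    filter_upwards [this] with y hy using mem_iUnion.2 (hcov y hy)
  have hsum : ∀ F : ℝ → ℝ≥0∞, ∫⁻ y, F y ∂m = ∑' j, ∫⁻ y in Ioc (r j) (r (j + 1)), F y ∂m := by
    intro F
    conv_lhs => rw [← hrestr]
    exact lintegral_iUnion (fun _ => measurableSet_Ioc) hdisj _
  -- For x in block j the tail has to exceed f(r j). Block j+1 alone achieves this: its mass is half
  -- of the bound 2^(j+2) for m(-∞,y) on it, whence the factor 2 and the shifted index.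
  set g : ℝ → ℝ≥0∞ := fun y => ∑' j : ℤ, (Ioc (r j) (r (j + 1))).indicator
    (fun _ => 2 * (f (r (j - 1)) : ℝ≥0∞)) y with hg
  have hgval : ∀ j, ∀ y ∈ Ioc (r j) (r (j + 1)), g y = 2 * (f (r (j - 1)) : ℝ≥0∞) := by
    intro j y hy
    rw [hg]
    dsimp only
    rw [tsum_eq_single j, indicator_of_mem hy]
    intro i hij
    exact indicator_of_notMem (fun h => Set.disjoint_left.1 (hdisj hij) h hy) _
  have hgm : Measurable g := Measurable.tsum fun j =>
    measurable_const.indicator measurableSet_Ioc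
  refine ⟨g, hgm, fun x hx => ?_, fun c => ?_⟩
  · obtain ⟨j, hj⟩ := hcov x hx
    calc (f x : ℝ≥0∞) ≤ f (r j) := ENNReal.coe_le_coe.2 (hf (hr0 j) hx hj.1.le)
      _ = ∫⁻ _ in Ioc (r (j + 1)) (r (j + 1 + 1)), 2 * (f (r j) : ℝ≥0∞) / 2 ^ (j + 1 + 1) ∂m := by
          rw [setLIntegral_const, hmeas, two_zpow_add_one (j + 1)]
          have h1 := (two_zpow_pos (j + 1)).ne'
          rw [ENNReal.mul_div_mul_left _ _ two_ne_zero (by norm_num),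
            ENNReal.div_mul_cancel h1 (two_zpow_ne_top _)]
      _ ≤ ∫⁻ y in Ioc (r (j + 1)) (r (j + 1 + 1)), g y / m (Iio y) ∂m := by
          refine setLIntegral_mono' measurableSet_Ioc fun y hy => ?_
          rw [hgval _ y hy, add_sub_cancel_right]
          gcongr
          rw [measure_congr (Iio_ae_eq_Iic (μ := m))]
          exact (hlev (j + 1) ▸ hy :
            y ∈ {y | 2 ^ (j + 1) < m (Iic y) ∧ m (Iic y) ≤ 2 ^ (j + 1 + 1)}).2
      _ ≤ ∫⁻ y in Ioi x, g y / m (Iio y) ∂m :=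
          lintegral_mono_set fun y hy => hj.2.trans_lt hy.1
      _ = _ := (withDensity_apply _ measurableSet_Ioi).symm
  · calc ∫⁻ y, Φ.val (c * g y) ∂m
        = ∑' j, ∫⁻ y in Ioc (r j) (r (j + 1)), Φ.val (c * g y) ∂m := hsum _
      -- Block j-2 ends at r (j-1), so f ≥ f(r (j-1)) on it, and its mass is a quarter of that of
      -- block j.
      _ ≤ ∑' j, 4 * ∫⁻ y in Ioc (r (j - 2)) (r (j - 2 + 1)), Φ.val (2 * c * f y) ∂m := by
          refine ENNReal.tsum_le_tsum fun j => ?_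
          calc ∫⁻ y in Ioc (r j) (r (j + 1)), Φ.val (c * g y) ∂m
              = ∫⁻ _ in Ioc (r j) (r (j + 1)), Φ.val (2 * c * f (r (j - 1))) ∂m := by
                refine setLIntegral_congr_fun measurableSet_Ioc fun y hy => ?_
                rw [hgval j y hy]
                congr 1; ring
            _ = 4 * ∫⁻ _ in Ioc (r (j - 2)) (r (j - 2 + 1)), Φ.val (2 * c * f (r (j - 1))) ∂m := by
                rw [setLIntegral_const, setLIntegral_const, hmeas, hmeas]
                have : (2 : ℝ≥0∞) ^ j = 4 * 2 ^ (j - 2) := by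
                  rw [← two_zpow_add_two]; congr 1; omega
                rw [this]; ring
            _ ≤ _ := by
                refine mul_le_mul_right (setLIntegral_mono' measurableSet_Ioc fun y hy =>
                  Φ.val_mono ?_) 4
                gcongr
                refine hf ((hr0 _).trans hy.1) (hr0 _) ?_
                rw [show j - 1 = j - 2 + 1 by omega]
                exact hy.2
      _ = 4 * ∑' j, ∫⁻ y in Ioc (r j) (r (j + 1)), Φ.val (2 * c * f y) ∂m := by
          rw [ENNReal.tsum_mul_left]
          congr 1
          exact (Equiv.subRight (2 : ℤ)).tsum_eq
            fun j => ∫⁻ y in Ioc (r j) (r (j + 1)), Φ.val (2 * c * f y) ∂m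
      _ = 4 * ∫⁻ y, Φ.val (2 * c * f y) ∂m := by rw [← hsum]
      _ = ∫⁻ y, 4 * Φ.val (2 * c * f y) ∂m := (lintegral_const_mul' _ _ (by norm_num)).symm
      -- The factor 4 moves inside Φ by convexity, giving 8 = 4·2.
      _ ≤ _ := by
          refine lintegral_mono fun y => ?_
          have := mul_integralFrom_le Φ.gen_mono (c := 4) (by norm_num) (2 * c * f y)
          refine le_trans this (le_of_eq ?_)
          change Φ.val _ = _
          congr 1; push_cast; ring

/-- If `m` vanishes near the origin, the inequality on tails forces the weight to vanish. -/
lemma ae_eq_zero_of_measure_Iio_eq_zero [NullSingletonClass m] (hm : ∀ x, m (Iio x) ≠ ∞)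
    (hinf : m univ = ∞) (hμ : μ (Iic 0) = 0) (hw : AEMeasurable w μ) {D : ℝ≥0} (hD : 0 < D)
    (hS : ∀ g : ℝ → ℝ≥0∞, Measurable g →
      ∫⁻ x, Ψ.val (w x * ∫⁻ y, tailKernel x y ∂hardyMeasure m g) ∂μ ≤
        Ψ.val (Φ.inv (∫⁻ y, Φ.val (D * g y) ∂m))) {a : ℝ} (ha : 0 < a) (hma : m (Iio a) = 0) :
    ∀ᵐ x ∂μ, w x = 0 := by
  obtain ⟨r, hr⟩ := exists_dyadic_points hm hinf
  have hμ0 : ∀ᵐ x ∂μ, 0 < x := by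
    rw [ae_iff]; simpa [Iic] using hμ
  -- A lower bound for the tail kernel at (x, y), valid for all y ≥ a.
  set t : ℝ → ℝ≥0∞ := fun x => min 1 ((ENNReal.ofReal x)⁻¹ * ENNReal.ofReal a) with ht
  have htm : Measurable t :=
    measurable_const.min (ENNReal.measurable_ofReal.inv.mul_const _)
  have key : ∀ j : ℤ, ∫⁻ x, Ψ.val (w x * t x) ∂μ ≤ Ψ.val (Φ.inv (Φ.val D * 2 ^ j)) := by
    intro j
    -- The modular of D·g is Φ(D)·2^j, which tends to 0 as j → -∞. Yet η[a,∞) ≥ 1 for every j, since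
    -- all the m-mass 2^j of (-∞, r j] lies in [a,∞) and m(-∞,y) ≤ 2^j there.
    set g : ℝ → ℝ≥0∞ := (Iic (r j)).indicator 1 with hg
    have hgm : Measurable g := measurable_one.indicator measurableSet_Iic
    refine le_trans (lintegral_mono_ae ?_) ((hS g hgm).trans (Ψ.val_mono (Φ.inv_mono ?_)))
    · filter_upwards [hμ0] with x hx
      refine Ψ.val_mono ?_
      gcongr
      have hη : 1 ≤ hardyMeasure m g (Ici a) := by
        rw [hardyMeasure, withDensity_apply _ measurableSet_Ici]
        have h1 : m (Iic (r j) ∩ Ici a) = 2 ^ j := by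
          rw [← (hr j).1]
          refine measure_inter_conull ?_
          refine measure_mono_null (fun y hy => ?_) hma
          exact not_le.1 (show ¬ a ≤ y from hy)
        calc (1 : ℝ≥0∞) = ∫⁻ _ in Iic (r j) ∩ Ici a, (2 ^ j)⁻¹ ∂m := by
              rw [setLIntegral_const, h1, ENNReal.inv_mul_cancel (two_zpow_pos j).ne'
                (two_zpow_ne_top j)]
          _ ≤ ∫⁻ y in Iic (r j) ∩ Ici a, g y / m (Iio y) ∂m := by
              refine setLIntegral_mono' (measurableSet_Iic.inter measurableSet_Ici) fun y hy => ?_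
              rw [hg, indicator_of_mem hy.1, Pi.one_apply, one_div]
              refine ENNReal.inv_le_inv.2 ?_
              rw [← (hr j).1]
              exact measure_mono fun z hz => (le_of_lt (mem_Iio.1 hz)).trans hy.1
          _ ≤ _ := lintegral_mono_set inter_subset_right
      calc t x ≤ t x * hardyMeasure m g (Ici a) := le_mul_of_one_le_right zero_le hη
        _ = ∫⁻ _ in Ici a, t x ∂hardyMeasure m g := (setLIntegral_const _ _).symm
        _ ≤ ∫⁻ y in Ici a, tailKernel x y ∂hardyMeasure m g := by
            refine setLIntegral_mono' measurableSet_Ici fun y hy => ?_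
            rcases le_or_gt y x with h | h
            · rw [tailKernel, indicator_of_mem (mem_Iic.2 h)]
              refine le_add_right ((min_le_right _ _).trans ?_)
              gcongr
              exact hy
            · rw [tailKernel, indicator_of_mem (mem_Ioi.2 h)]
              exact (min_le_left _ _).trans (le_self_add.trans le_add_self)
        _ ≤ _ := setLIntegral_le_lintegral _ _
    · have : ∀ y, Φ.val (D * g y) = (Iic (r j)).indicator (fun _ => Φ.val D) y := fun y => by
        by_cases hy : y ∈ Iic (r j) <;> simp [hg, hy, Φ.val_zero]
      simp_rw [this]
      rw [lintegral_indicator_const measurableSet_Iic, (hr j).1]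
  have hzero : ∫⁻ x, Ψ.val (w x * t x) ∂μ = 0 := by
    by_contra hL
    set L := ∫⁻ x, Ψ.val (w x * t x) ∂μ
    have he : Φ.val (Ψ.inv L) ≠ 0 := by
      rw [Ne, Φ.val_eq_zero, ← Ψ.val_eq_zero, Ψ.val_inv]; exact hL
    have hD1 : Φ.val D ≠ 0 := by
      rw [Ne, Φ.val_eq_zero]; exact_mod_cast hD.ne'
    -- If L were positive, a j with Φ(D)·2^j < Φ(Ψ⁻¹(L)) would contradict `key`. The minimum with 1
    -- only guards against L = ∞.
    have h2 : min 1 (Φ.val (Ψ.inv L)) / Φ.val D ≠ 0 :=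
      (ENNReal.div_pos (by simpa [min_eq_bot] using he) (Φ.val_lt_top D).ne).ne'
    obtain ⟨j, hj, -⟩ := exists_zpow_level h2
      (ENNReal.div_ne_top (ne_top_of_le_ne_top ENNReal.one_ne_top (min_le_left _ _)) hD1)
    rw [ENNReal.lt_div_iff_mul_lt (.inl hD1) (.inl (Φ.val_lt_top D).ne), mul_comm] at hj
    have h3 : Φ.val (Ψ.inv L) ≤ Φ.val D * 2 ^ j := by
      rw [← Φ.val_inv (Φ.val D * 2 ^ j)]
      exact Φ.val_mono (Ψ.inv_le_iff.2 (key j))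
    exact (h3.trans_lt (hj.trans_le (min_le_right _ _))).false
  rw [lintegral_eq_zero_iff' (f := fun x => Ψ.val (w x * t x))
    (Ψ.measurable_val.comp_aemeasurable (hw.mul htm.aemeasurable))] at hzero
  filter_upwards [hzero, hμ0] with x hx hx0
  have : w x * t x = 0 := Ψ.val_eq_zero.1 hx
  refine (mul_eq_zero.1 this).resolve_right ?_
  rw [ht]
  refine (lt_min one_pos ?_).ne'
  exact ENNReal.mul_pos (by simp) (ENNReal.ofReal_pos.2 ha).ne'

end

section

variable {Φ Ψ : NFunction} {m μ : Measure ℝ} {w g : ℝ → ℝ≥0∞}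

/-! ### Hardy's inequality for tails -/

lemma antitone_measure_Ioi (κ : Measure ℝ) : Antitone fun y => κ (Ioi y) :=
  fun _ _ h => measure_mono (Ioi_subset_Ioi h)

lemma measure_Ioi_inter_level {κ : Measure ℝ} [IsFiniteMeasure κ] [NullSingletonClass κ] {x : ℝ}
    {c : ℝ≥0∞} (hc : 0 < c) (hcx : c < κ (Ioi x)) : κ (Ioi x ∩ {y | κ (Ioi y) ≤ c}) = c := by
  obtain ⟨r, hxr, hr, hr'⟩ := exists_level_Ioi (measure_ne_top κ _) hc hcx
  have : Ioi x ∩ {y | κ (Ioi y) ≤ c} = Ici r := by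
    ext y
    simp only [mem_inter_iff, mem_Ioi, mem_ofPred_eq, mem_Ici]
    rw [← not_lt, hr', not_lt]
    exact ⟨fun h => h.2, fun h => ⟨hxr.trans_le h, h⟩⟩
  rw [this, ← measure_congr (Ioi_ae_eq_Ici (μ := κ)), hr]

/-- A finite atomless measure is mapped to Lebesgue measure by its tail function. -/
lemma map_tail (κ : Measure ℝ) [IsFiniteMeasure κ] [NullSingletonClass κ] (x : ℝ) :
    (κ.restrict (Ioi x)).map (fun y => (κ (Ioi y)).toReal) =
      volume.restrict (Ioo 0 (κ (Ioi x)).toReal) := by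
  have hF : Measurable fun y => (κ (Ioi y)).toReal :=
    (antitone_measure_Ioi κ).measurable.ennreal_toReal
  have : IsFiniteMeasure (volume.restrict (Ioo 0 (κ (Ioi x)).toReal)) := ⟨by simp⟩
  refine Measure.ext_of_Iic _ _ fun c => ?_
  rw [Measure.map_apply hF measurableSet_Iic, Measure.restrict_apply measurableSet_Iic,
    Measure.restrict_apply (hF measurableSet_Iic), inter_comm]
  have hset : ∀ c : ℝ, 0 ≤ c → (fun y => (κ (Ioi y)).toReal) ⁻¹' Iic c =
      {y | κ (Ioi y) ≤ ENNReal.ofReal c} := fun c hc => by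
    ext y
    simp only [mem_preimage, mem_Iic, mem_ofPred_eq]
    rw [ENNReal.le_ofReal_iff_toReal_le (measure_ne_top κ _) hc]
  rcases le_or_gt c 0 with hc | hc
  · have h1 : Iic c ∩ Ioo 0 (κ (Ioi x)).toReal = ∅ := by
      ext t; simp only [mem_inter_iff, mem_Iic, mem_Ioo, mem_empty_iff_false, iff_false]
      rintro ⟨h1, h2, -⟩; exact h2.not_ge (h1.trans hc)
    rw [h1, measure_empty, ← nonpos_iff_eq_zero]
    -- The points with zero tail lie, for every small e > 0, in a set of κ-mass e, so they form a
    -- null set.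
    refine le_of_forall_gt fun d hd => ?_
    rcases eq_or_ne (κ (Ioi x)) 0 with h0 | h0
    · exact (measure_mono inter_subset_left).trans_lt (h0 ▸ hd)
    obtain ⟨e, he0, he⟩ := exists_between (lt_min hd (pos_iff_ne_zero.2 h0))
    refine lt_of_le_of_lt ?_ (he.trans_le (min_le_left _ _))
    rw [← measure_Ioi_inter_level he0 (he.trans_le (min_le_right _ _))]
    refine measure_mono (inter_subset_inter_right _ fun y hy => ?_)
    have hy' : (κ (Ioi y)).toReal ≤ 0 := le_trans hy hc
    have : κ (Ioi y) = 0 := by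
      have := le_antisymm hy' ENNReal.toReal_nonneg
      exact ((ENNReal.toReal_eq_zero_iff _).1 this).resolve_right (measure_ne_top κ _)
    change κ (Ioi y) ≤ e
    rw [this]; exact zero_le
  rw [hset c hc.le]
  rcases lt_or_ge (ENNReal.ofReal c) (κ (Ioi x)) with h | h
  · rw [measure_Ioi_inter_level (ENNReal.ofReal_pos.2 hc) h]
    have h2 : c < (κ (Ioi x)).toReal := (ENNReal.ofReal_lt_iff_lt_toReal hc.le
      (measure_ne_top κ _)).1 h
    have : Iic c ∩ Ioo 0 (κ (Ioi x)).toReal = Ioc 0 c := by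
      ext t; simp only [mem_inter_iff, mem_Iic, mem_Ioo, mem_Ioc]
      exact ⟨fun h => ⟨h.2.1, h.1⟩, fun h => ⟨h.2, h.1, h.2.trans_lt h2⟩⟩
    rw [this]; simp
  · have h2 : (κ (Ioi x)).toReal ≤ c := ENNReal.toReal_le_of_le_ofReal hc.le h
    rw [inter_eq_left.2, inter_eq_right.2, Real.volume_Ioo, sub_zero,
      ENNReal.ofReal_toReal (measure_ne_top κ _)]
    · exact fun t ht => ht.2.le.trans h2
    · exact fun y hy => (antitone_measure_Ioi κ (le_of_lt hy)).trans h

/-- The change of variables t = κ(y,∞), justified by `map_tail`, in the integral defining Φ; it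
takes the place of the chain rule. -/
lemma val_tail_eq (κ : Measure ℝ) [IsFiniteMeasure κ] [NullSingletonClass κ] (x : ℝ) :
    Φ.val (κ (Ioi x)) = ∫⁻ y in Ioi x, (Φ.gen (κ (Ioi y)).toNNReal : ℝ≥0∞) ∂κ := by
  have hF : Measurable fun y => (κ (Ioi y)).toReal :=
    (antitone_measure_Ioi κ).measurable.ennreal_toReal
  have hgen : Measurable fun t : ℝ => (Φ.gen t.toNNReal : ℝ≥0∞) :=
    (Φ.gen_mono.measurable.comp measurable_real_toNNReal).coe_nnreal_ennreal
  have h1 : κ (Ioi x) = ((κ (Ioi x)).toNNReal : ℝ≥0∞) :=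
    (ENNReal.coe_toNNReal (measure_ne_top κ _)).symm
  have h2 : Φ.val (κ (Ioi x)) =
      ∫⁻ t in Ioo 0 (κ (Ioi x)).toReal, (Φ.gen t.toNNReal : ℝ≥0∞) := by
    rw [NFunction.val, integralFrom_def, h1, initialSeg_coe]; rfl
  rw [h2, ← map_tail κ x, lintegral_map hgen hF]
  refine lintegral_congr fun y => ?_
  rw [ENNReal.toReal, Real.toNNReal_coe]

lemma lintegral_lintegral_Ioi (κ η : Measure ℝ) [SFinite κ] [SFinite η] {h : ℝ → ℝ≥0∞}
    (hh : Measurable h) :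
    ∫⁻ x, ∫⁻ y in Ioi x, h y ∂η ∂κ = ∫⁻ y, h y * κ (Iio y) ∂η := by
  have hm : Measurable (Function.uncurry fun x y : ℝ => {z : ℝ × ℝ | z.1 < z.2}.indicator
      (fun z => h z.2) (x, y)) :=
    (hh.comp measurable_snd).indicator (measurableSet_lt measurable_fst measurable_snd)
  calc ∫⁻ x, ∫⁻ y in Ioi x, h y ∂η ∂κ
      = ∫⁻ x, ∫⁻ y, {z : ℝ × ℝ | z.1 < z.2}.indicator (fun z => h z.2) (x, y) ∂η ∂κ := by
        refine lintegral_congr fun x => ?_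
        rw [← lintegral_indicator measurableSet_Ioi]
        rfl
    _ = ∫⁻ y, ∫⁻ x, {z : ℝ × ℝ | z.1 < z.2}.indicator (fun z => h z.2) (x, y) ∂κ ∂η :=
        lintegral_lintegral_swap hm.aemeasurable
    _ = _ := by
        refine lintegral_congr fun y => ?_
        rw [← lintegral_indicator_const measurableSet_Iio]
        rfl

/-- The modular Hardy inequality for tails. -/
lemma lintegral_val_tail_le [NullSingletonClass m] [SFinite m] (hm : ∀ x, m (Iio x) ≠ ∞)
    {β : ℝ≥0} (hβ : 1 ≤ β) (hΦ : ∀ t : ℝ≥0, (Φ.gen t : ℝ≥0∞) * t ≤ β * Φ.val t)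
    (hg : Measurable g) (hgT : IsTruncated m g) :
    ∫⁻ x, Φ.val (hardyMeasure m g (Ioi x)) ∂m ≤ ∫⁻ y, Φ.val ((2 * β : ℝ≥0) * g y) ∂m := by
  obtain ⟨hfin, b, hb0, hb⟩ := hgT.exists_bound hm
  set η := hardyMeasure m g with hη
  have : NullSingletonClass η := nullSingletonClass_withDensity _
  have : IsFiniteMeasure η := ⟨hfin.lt_top⟩
  set F : ℝ → ℝ≥0 := fun y => (η (Ioi y)).toNNReal with hF
  have hFm : Measurable F := (antitone_measure_Ioi η).measurable.ennreal_toNNReal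
  have hFc : ∀ y, (F y : ℝ≥0∞) = η (Ioi y) := fun y => ENNReal.coe_toNNReal (measure_ne_top η _)
  have hgenm : Measurable fun y => (Φ.gen (F y) : ℝ≥0∞) :=
    (Φ.gen_mono.measurable.comp hFm).coe_nnreal_ennreal
  set I := ∫⁻ x, Φ.val (η (Ioi x)) ∂m with hI
  set J := ∫⁻ y, Φ.val ((2 * β : ℝ≥0) * g y) ∂m with hJ
  have hgfin : ∀ y, g y ≠ ∞ := fun y => by
    obtain ⟨n, M, h⟩ := hgT
    refine ((h y).trans_lt ?_).ne
    exact (indicator_le_self' (fun _ _ => zero_le) y).trans_lt ENNReal.coe_lt_top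
  have hIfin : I ≠ ∞ := by
    have : ∀ x, Φ.val (η (Ioi x)) ≤ (Iio b).indicator (fun _ => Φ.val (η univ)) x := fun x => by
      by_cases hx : x < b
      · rw [indicator_of_mem (mem_Iio.2 hx)]
        exact Φ.val_mono (measure_mono (subset_univ _))
      · have h0 : η (Ioi x) = 0 :=
          measure_mono_null (fun y hy => (not_lt.1 hx).trans (le_of_lt hy)) hb
        rw [h0, Φ.val_zero]; exact zero_le
    refine ((lintegral_mono this).trans_lt ?_).ne
    rw [lintegral_indicator_const measurableSet_Iio]
    refine ENNReal.mul_lt_top ?_ (hm b).lt_top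
    rw [lt_top_iff_ne_top, Ne, Φ.val_eq_top]
    exact hfin
  -- Interchanging the integrals produces the factor m(-∞,y), which cancels the denominator in the
  -- density of η.
  have hkey : I = ∫⁻ y, Φ.gen (F y) * g y ∂m := by
    simp_rw [hI, val_tail_eq]
    rw [lintegral_lintegral_Ioi m η hgenm, hη, lintegral_hardyMeasure hg
      (k := fun y => Φ.gen (F y) * m (Iio y)) (hgenm.mul (measurable_measure_Iio m))]
    refine lintegral_congr_ae ?_
    filter_upwards [ae_measure_Iio_pos (m := m)] with y hy
    rw [mul_assoc, ENNReal.mul_div_cancel hy.ne' (hm y)]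
  -- The larger of F and 2βg absorbs the product through gen(t)·t ≤ βΦ(t). The factor 2 leaves one
  -- spare copy of I on the left.
  have hpt : ∀ y, (2 * β : ℝ≥0) * (Φ.gen (F y) * g y) ≤
      β * (Φ.val (η (Ioi y)) + Φ.val ((2 * β : ℝ≥0) * g y)) := by
    intro y
    obtain ⟨a, ha⟩ : ∃ a : ℝ≥0, (a : ℝ≥0∞) = g y := ⟨_, ENNReal.coe_toNNReal (hgfin y)⟩
    rw [← ha, ← hFc, ← ENNReal.coe_mul]
    rcases le_total (2 * β * a) (F y) with h | h
    · calc ((2 * β : ℝ≥0) : ℝ≥0∞) * (Φ.gen (F y) * a) = Φ.gen (F y) * (2 * β * a : ℝ≥0) := by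
            push_cast; ring
        _ ≤ Φ.gen (F y) * F y := by gcongr
        _ ≤ β * Φ.val (F y) := hΦ _
        _ ≤ _ := by gcongr; exact le_self_add
    · calc ((2 * β : ℝ≥0) : ℝ≥0∞) * (Φ.gen (F y) * a) = Φ.gen (F y) * (2 * β * a : ℝ≥0) := by
            push_cast; ring
        _ ≤ Φ.gen (2 * β * a) * (2 * β * a : ℝ≥0) := by gcongr; exact Φ.gen_mono h
        _ ≤ β * Φ.val (2 * β * a : ℝ≥0) := hΦ _
        _ ≤ _ := by gcongr; exact le_add_self
  have hsum : (2 * β : ℝ≥0) * I ≤ β * (I + J) := by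
    calc (2 * β : ℝ≥0) * I = ∫⁻ y, (2 * β : ℝ≥0) * (Φ.gen (F y) * g y) ∂m := by
          rw [lintegral_const_mul' _ _ ENNReal.coe_ne_top, ← hkey]
      _ ≤ ∫⁻ y, β * (Φ.val (η (Ioi y)) + Φ.val ((2 * β : ℝ≥0) * g y)) ∂m := lintegral_mono hpt
      _ = _ := by
          rw [lintegral_const_mul' _ _ ENNReal.coe_ne_top, lintegral_add_left]
          exact Φ.measurable_val.comp (antitone_measure_Ioi η).measurable
  have hβ0 : (β : ℝ≥0∞) ≠ 0 := by exact_mod_cast (zero_lt_one.trans_le hβ).ne'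
  have h2 : (β : ℝ≥0∞) * (I + I) ≤ β * (I + J) := by
    refine le_trans (le_of_eq ?_) hsum
    push_cast; ring
  rw [ENNReal.mul_le_mul_iff_right hβ0 ENNReal.coe_ne_top] at h2
  -- Cancelling I requires it to be finite, which the truncation of g guarantees.
  exact ENNReal.le_of_add_le_add_left hIfin h2

lemma lintegral_hardyMeasure_const_mul (hg : Measurable g) (c : ℝ≥0) {k : ℝ → ℝ≥0∞}
    (hk : Measurable k) :
    ∫⁻ y, k y ∂hardyMeasure m (fun y => c * g y) = c * ∫⁻ y, k y ∂hardyMeasure m g := by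
  rw [lintegral_hardyMeasure (hg.const_mul _) hk, lintegral_hardyMeasure hg hk,
    ← lintegral_const_mul' _ _ ENNReal.coe_ne_top]
  refine lintegral_congr fun y => ?_
  simp only [div_eq_mul_inv]; ring

lemma hardyMeasure_const_mul_Ioi (hg : Measurable g) (c : ℝ≥0) (x : ℝ) :
    hardyMeasure m (fun y => c * g y) (Ioi x) = c * hardyMeasure m g (Ioi x) := by
  have := lintegral_hardyMeasure_const_mul (m := m) hg c
    (measurable_one.indicator (measurableSet_Ioi (a := x)))
  simpa [lintegral_indicator measurableSet_Ioi] using this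

lemma IsTruncated.const_mul (hgT : IsTruncated m g) (c : ℝ≥0) :
    IsTruncated m fun y => c * g y := by
  obtain ⟨N, M, h⟩ := hgT
  refine ⟨N, c * M, fun y => ?_⟩
  calc c * g y ≤ c * (truncSet m N).indicator (fun _ => (M : ℝ≥0∞)) y := by
        gcongr; exact h y
    _ = _ := by by_cases hy : y ∈ truncSet m N <;> simp [hy]

/-! ### The converse of Hölder's inequality -/

/-- With u = k/(ε m(-∞,·) lam), the function complGen(u) is nearly extremal in Young's inequality.
As lam is below the norm, J = ∫ Φ̃(u) ε dm exceeds 1, and still does so over a truncated set T n ∩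
B, where it is finite. Dividing complGen(u) by βJ brings the modular below 1/ε, by Δ₂ for Φ̃ and
convexity of Φ, and the pairing with k loses only the factor β. -/
lemma exists_dual_function [NullSingletonClass m] (hm : ∀ x, m (Iio x) ≠ ∞) {β : ℝ≥0}
    (hβ : 1 ≤ β) (hΦ : ∀ t : ℝ≥0, (Φ.complGen t : ℝ≥0∞) * t ≤ β * Φ.compl t) {ε : ℝ≥0}
    (hε : 0 < ε) {B : Set ℝ} (hB : MeasurableSet B) {k : ℝ → ℝ≥0∞} (hk : Measurable k)
    (hkfin : ∀ y, k y ≠ ∞) {lam : ℝ≥0∞} (h0 : 0 < lam) (hlam : lam < dualNorm Φ m ε B k) :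
    ∃ g : ℝ → ℝ≥0∞, Measurable g ∧ IsTruncated m g ∧ ∫⁻ y, Φ.val (g y) ∂m ≤ 1 / ε ∧
      lam ≤ β * ∫⁻ y in B, k y ∂hardyMeasure m g := by
  have hlt : lam ≠ ∞ := hlam.ne_top
  have hε0 : (ε : ℝ≥0∞) ≠ 0 := by exact_mod_cast hε.ne'
  set u : ℝ → ℝ≥0∞ := fun y => k y / (ε * m (Iio y)) / lam with hu
  have hum : Measurable u := (hk.div ((measurable_measure_Iio m).const_mul _)).div_const _
  have hgt : 1 < ∫⁻ y in B, Φ.compl (u y) * ε ∂m := by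
    by_contra! h
    exact hlam.not_ge (sInf_le ⟨h0, hlt.lt_top, h⟩)
  set T : ℕ → Set ℝ := fun n => truncSet m n ∩ {y | k y ≤ n} with hT
  have hTm : ∀ n, MeasurableSet (T n) := fun n =>
    (measurableSet_truncSet m n).inter (measurableSet_le hk measurable_const)
  have hTmono : Monotone T := fun a b h => inter_subset_inter (truncSet_mono m h)
    fun y (hy : k y ≤ a) => hy.trans (by exact_mod_cast h : (a : ℝ≥0∞) ≤ b)
  have hTcov : ∀ y, 0 < m (Iio y) → ∃ n, y ∈ T n := fun y hy => by
    obtain ⟨a, ha⟩ := exists_mem_truncSet hy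
    obtain ⟨b, hb⟩ := ENNReal.exists_nat_gt (hkfin y)
    exact ⟨max a b, truncSet_mono m (le_max_left _ _) ha,
      hb.le.trans (by exact_mod_cast le_max_right a b)⟩
  obtain ⟨n, hn⟩ : ∃ n, 1 < ∫⁻ y in T n ∩ B, Φ.compl (u y) * ε ∂m := by
    by_contra! h
    refine hgt.not_ge ?_
    calc ∫⁻ y in B, Φ.compl (u y) * ε ∂m
        = ∫⁻ y in ⋃ n, T n, Φ.compl (u y) * ε ∂(m.restrict B) := by
          rw [Measure.restrict_eq_self_of_ae_mem (μ := m.restrict B) (s := ⋃ n, T n)]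
          filter_upwards [ae_restrict_of_ae (ae_measure_Iio_pos (m := m))] with y hy
          exact mem_iUnion.2 (hTcov y hy)
      _ = ⨆ n, ∫⁻ y in T n, Φ.compl (u y) * ε ∂(m.restrict B) :=
          setLIntegral_iUnion_of_directed _ hTmono.directed_le
      _ ≤ 1 := iSup_le fun n => by rw [Measure.restrict_restrict (hTm n)]; exact h n
  set J := ∫⁻ y in T n ∩ B, Φ.compl (u y) * ε ∂m with hJ
  obtain ⟨c, hc⟩ : ∃ c : ℝ≥0, ∀ y ∈ T n, u y ≤ c := by
    have hfin : (n : ℝ≥0∞) * ((ε : ℝ≥0∞)⁻¹ * n) / lam ≠ ∞ :=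
      ENNReal.div_ne_top (ENNReal.mul_ne_top (by simp) (ENNReal.mul_ne_top
        (ENNReal.inv_ne_top.2 hε0) (by simp))) h0.ne'
    refine ⟨_, fun y hy => (?_ : _ ≤ _).trans (ENNReal.coe_toNNReal hfin).ge⟩
    rw [hu]
    dsimp only
    rw [div_eq_mul_inv (k y), ENNReal.mul_inv (.inl hε0) (.inl ENNReal.coe_ne_top)]
    gcongr
    · exact hy.2
    · exact ENNReal.inv_le_iff_inv_le.2 hy.1.2.le
  have hJfin : J ≠ ∞ := by
    refine ((setLIntegral_mono' ((hTm n).inter hB) fun y hy => mul_le_mul_left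
      (Φ.compl_mono (hc y hy.1)) (ε : ℝ≥0∞)).trans_lt ?_).ne
    rw [setLIntegral_const]
    refine ENNReal.mul_lt_top (ENNReal.mul_lt_top (integralFrom_lt_top Φ.complGen_mono c)
      ENNReal.coe_lt_top) ((measure_mono fun y hy => ?_).trans_lt (hm n).lt_top)
    exact hy.1.1.1
  lift J to ℝ≥0 using hJfin with J' hJ'
  have hJ1 : 1 ≤ J' := by exact_mod_cast hn.le
  have hβJ : 1 ≤ β * J' := one_le_mul hβ hJ1
  have hβJ0 : ((β * J' : ℝ≥0) : ℝ≥0∞) ≠ 0 := by exact_mod_cast (zero_lt_one.trans_le hβJ).ne'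
  set G : ℝ → ℝ≥0 := fun y => Φ.complGen (u y).toNNReal with hG
  have hGm : Measurable G := Φ.complGen_mono.measurable.comp hum.ennreal_toNNReal
  have hucoe : ∀ y ∈ T n, u y = (u y).toNNReal := fun y hy =>
    (ENNReal.coe_toNNReal ((hc y hy).trans_lt ENNReal.coe_lt_top).ne).symm
  set g : ℝ → ℝ≥0∞ := (T n ∩ B).indicator fun y => G y / (β * J' : ℝ≥0) with hg
  have hgm : Measurable g :=
    (hGm.coe_nnreal_ennreal.div_const _).indicator ((hTm n).inter hB)
  refine ⟨g, hgm, ⟨n, Φ.complGen c, fun y => ?_⟩, ?_, ?_⟩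
  · by_cases hy : y ∈ T n ∩ B
    · rw [hg, indicator_of_mem hy, indicator_of_mem hy.1.1]
      refine (ENNReal.div_le_of_le_mul' ?_ : _ ≤ (Φ.complGen c : ℝ≥0∞))
      refine (ENNReal.coe_le_coe.2 (Φ.complGen_mono ?_)).trans
        (le_mul_of_one_le_left zero_le (by exact_mod_cast hβJ))
      rw [← ENNReal.coe_le_coe, ← hucoe y hy.1]; exact hc y hy.1
    · rw [hg, indicator_of_notMem hy]; exact zero_le
  · rw [ENNReal.le_div_iff_mul_le (.inl hε0) (.inl ENNReal.coe_ne_top)]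
    calc (∫⁻ y, Φ.val (g y) ∂m) * ε = ∫⁻ y, Φ.val (g y) * ε ∂m :=
          (lintegral_mul_const' _ _ ENNReal.coe_ne_top).symm
      _ ≤ ∫⁻ y, (T n ∩ B).indicator (fun y => Φ.compl (u y) * ε / J') y ∂m := by
          refine lintegral_mono fun y => ?_
          by_cases hy : y ∈ T n ∩ B
          · rw [hg, indicator_of_mem hy, indicator_of_mem hy, ENNReal.mul_div_right_comm]
            gcongr
            refine (integralFrom_div_le Φ.gen_mono hβJ _).trans ?_
            refine ENNReal.div_le_of_le_mul ?_
            refine (Φ.val_complGen_le _).trans ((hΦ _).trans (le_of_eq ?_))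
            rw [← hucoe y hy.1]
            have hJ0 : (J' : ℝ≥0∞) ≠ 0 := by exact_mod_cast (zero_lt_one.trans_le hJ1).ne'
            push_cast
            calc β * Φ.compl (u y) = β * (Φ.compl (u y) / J' * J') := by
                  rw [ENNReal.div_mul_cancel hJ0 ENNReal.coe_ne_top]
              _ = _ := by ring
          · rw [hg, indicator_of_notMem hy, Φ.val_zero, zero_mul]; exact zero_le
      _ = 1 := by
          rw [lintegral_indicator ((hTm n).inter hB)]
          simp_rw [div_eq_mul_inv]
          have hJ0 : (J' : ℝ≥0∞) ≠ 0 := by exact_mod_cast (zero_lt_one.trans_le hJ1).ne'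
          rw [lintegral_mul_const' _ _ (ENNReal.inv_ne_top.2 hJ0), ← hJ,
            ENNReal.mul_inv_cancel hJ0 ENNReal.coe_ne_top]
  -- This uses Φ̃(u) ≤ complGen(u)·u together with k/m(-∞,y) = lam·ε·u.
  · have hpt : ∀ y ∈ T n ∩ B, lam * (Φ.compl (u y) * ε) ≤
        J' * (β * (k y * (g y / m (Iio y)))) := by
      intro y hy
      rw [hg, indicator_of_mem hy]
      have hV : k y / m (Iio y) = lam * ε * u y := by
        rw [hu]
        simp only [div_eq_mul_inv]
        rw [ENNReal.mul_inv (.inl hε0) (.inl ENNReal.coe_ne_top)]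
        have h1 := ENNReal.mul_inv_cancel hε0 ENNReal.coe_ne_top
        have h2 := ENNReal.mul_inv_cancel h0.ne' hlt
        calc _ = (ε * (ε : ℝ≥0∞)⁻¹) * (lam * lam⁻¹) * (k y * (m (Iio y))⁻¹) := by
              rw [h1, h2]; simp
          _ = _ := by ring
      calc lam * (Φ.compl (u y) * ε) ≤ lam * ((G y * u y) * ε) := by
            gcongr
            have := integralFrom_le Φ.complGen_mono (u y).toNNReal
            rwa [← hucoe y hy.1] at this
        _ = G y * (k y / m (Iio y)) := by rw [hV]; ring
        _ = ((β * J' : ℝ≥0) : ℝ≥0∞) * (G y / (β * J' : ℝ≥0)) * (k y / m (Iio y)) := by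
            rw [ENNReal.mul_div_cancel hβJ0 ENNReal.coe_ne_top]
        _ = _ := by simp only [div_eq_mul_inv, ENNReal.coe_mul]; ring
    have hJ0 : (J' : ℝ≥0∞) ≠ 0 := by exact_mod_cast (zero_lt_one.trans_le hJ1).ne'
    rw [← ENNReal.mul_le_mul_iff_right hJ0 ENNReal.coe_ne_top,
      setLIntegral_hardyMeasure hgm hk hB]
    calc (J' : ℝ≥0∞) * lam = ∫⁻ y in T n ∩ B, lam * (Φ.compl (u y) * ε) ∂m := by
          rw [lintegral_const_mul' _ _ hlt, ← hJ, mul_comm]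
      _ ≤ ∫⁻ y in T n ∩ B, J' * (β * (k y * (g y / m (Iio y)))) ∂m :=
          setLIntegral_mono' ((hTm n).inter hB) hpt
      _ ≤ ∫⁻ y in B, J' * (β * (k y * (g y / m (Iio y)))) ∂m :=
          lintegral_mono_set inter_subset_right
      _ = _ := by
          rw [lintegral_const_mul' _ _ ENNReal.coe_ne_top,
            lintegral_const_mul' _ _ ENNReal.coe_ne_top]

end

section

variable {Φ Ψ : NFunction} {m μ : Measure ℝ} {w g : ℝ → ℝ≥0∞}

/-! ### Necessity of the test conditions -/

/-- The tail of a truncated g is finite and non-increasing, hence admissible in the modular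
inequality; Hardy's inequality then replaces its modular by that of g. -/
lemma lintegral_hardySum_le_of_modular [NullSingletonClass m] [SFinite m]
    (hm : ∀ x, m (Iio x) ≠ ∞) (hμ : μ (Iic 0) = 0) {β : ℝ≥0} (hβ : 1 ≤ β)
    (hΦ : ∀ t : ℝ≥0, (Φ.gen t : ℝ≥0∞) * t ≤ β * Φ.val t) {C : ℝ≥0}
    (hN : ∀ f : ℝ → ℝ≥0, AntitoneOn f (Ioi 0) →
      ∫⁻ x, Ψ.val (w x * calderon (fun t => f t) x) ∂μ ≤
        Ψ.val (Φ.inv (∫⁻ x, Φ.val (C * f x) ∂m)))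
    (hg : Measurable g) (hgT : IsTruncated m g) :
    ∫⁻ x, Ψ.val (w x * ∫⁻ y, tailKernel x y ∂hardyMeasure m g) ∂μ ≤
      Ψ.val (Φ.inv (∫⁻ y, Φ.val ((2 * β * C : ℝ≥0) * g y) ∂m)) := by
  have hfin := (hgT.exists_bound hm).1
  have : IsFiniteMeasure (hardyMeasure m g) := ⟨hfin.lt_top⟩
  have hc : ∀ y, ((hardyMeasure m g (Ioi y)).toNNReal : ℝ≥0∞) = hardyMeasure m g (Ioi y) :=
    fun y => ENNReal.coe_toNNReal (measure_ne_top _ _)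
  have hμ0 : ∀ᵐ x ∂μ, 0 < x := by
    rw [ae_iff]; simpa [Iic] using hμ
  have := hN (fun y => (hardyMeasure m g (Ioi y)).toNNReal) (fun a _ b _ h =>
    ENNReal.toNNReal_mono (measure_ne_top _ _) (antitone_measure_Ioi _ h))
  simp_rw [hc] at this
  calc _ = ∫⁻ x, Ψ.val (w x * calderon (fun t => hardyMeasure m g (Ioi t)) x) ∂μ := by
        refine lintegral_congr_ae ?_
        filter_upwards [hμ0] with x hx
        rw [calderon_tail _ hx]
    _ ≤ _ := this
    _ ≤ _ := by
        refine Ψ.val_mono (Φ.inv_mono ?_)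
        simp_rw [← hardyMeasure_const_mul_Ioi hg C]
        refine (lintegral_val_tail_le hm hβ hΦ (hg.const_mul _) (hgT.const_mul C)).trans
          (le_of_eq ?_)
        refine lintegral_congr fun y => ?_
        congr 1; push_cast; ring

/-- Common source of the four test conditions; `hker` asks that the test kernel be dominated by the
tail kernel. The norm is approached by strictly smaller lam, since it may be infinite. -/
lemma lintegral_val_dualNorm_le [NullSingletonClass m] (hm : ∀ x, m (Iio x) ≠ ∞)
    (hμ : μ (Iic 0) = 0) (hw : AEMeasurable w μ) {β N : ℝ≥0} (hβ : 1 ≤ β) (hN0 : 0 < N)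
    (hΦ : ∀ t : ℝ≥0, (Φ.complGen t : ℝ≥0∞) * t ≤ β * Φ.compl t)
    (hS : ∀ g : ℝ → ℝ≥0∞, Measurable g → IsTruncated m g →
      ∫⁻ x, Ψ.val (w x * ∫⁻ y, tailKernel x y ∂hardyMeasure m g) ∂μ ≤
        Ψ.val (Φ.inv (∫⁻ y, Φ.val (N * g y) ∂m)))
    {ε : ℝ≥0} (hε : 0 < ε) {X B : Set ℝ} (hX : MeasurableSet X) (hB : MeasurableSet B)
    {k ω : ℝ → ℝ≥0∞} (hk : Measurable k) (hkfin : ∀ y, k y ≠ ∞) (hω : Measurable ω)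
    (hker : ∀ η : Measure ℝ, ∀ x ∈ X, 0 < x →
      ω x * ∫⁻ y in B, k y ∂η ≤ ∫⁻ y, tailKernel x y ∂η) :
    ∫⁻ x in X, Ψ.val (w x * (((β * N : ℝ≥0) : ℝ≥0∞)⁻¹ * ω x * dualNorm Φ m ε B k)) ∂μ ≤
      Ψ.val (Φ.inv (1 / ε)) := by
  have hμ0 : ∀ᵐ x ∂μ, 0 < x := by
    rw [ae_iff]; simpa [Iic] using hμ
  have hβN0 : ((β * N : ℝ≥0) : ℝ≥0∞) ≠ 0 := by
    exact_mod_cast (mul_pos (zero_lt_one.trans_le hβ) hN0).ne'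
  have key : ∀ lam, 0 < lam → lam < dualNorm Φ m ε B k →
      ∫⁻ x in X, Ψ.val (w x * (((β * N : ℝ≥0) : ℝ≥0∞)⁻¹ * ω x * lam)) ∂μ ≤
        Ψ.val (Φ.inv (1 / ε)) := by
    intro lam h0 hlam
    obtain ⟨g, hg, hgT, hg1, hg2⟩ := exists_dual_function hm hβ hΦ hε hB hk hkfin h0 hlam
    calc _ ≤ ∫⁻ x in X, Ψ.val (w x * ∫⁻ y, tailKernel x y
            -- Dividing the dual function by N makes the right side of `hS` exactly its modular, at
            -- most 1/ε.
            ∂hardyMeasure m (fun y => (N⁻¹ : ℝ≥0) * g y)) ∂μ := by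
          refine lintegral_mono_ae ?_
          filter_upwards [ae_restrict_of_ae hμ0, ae_restrict_mem hX] with x hx0 hxX
          refine Ψ.val_mono ?_
          gcongr
          rw [lintegral_hardyMeasure_const_mul hg _ (measurable_tailKernel_right x)]
          calc _ ≤ ((β * N : ℝ≥0) : ℝ≥0∞)⁻¹ * ω x *
                (β * ∫⁻ y in B, k y ∂hardyMeasure m g) := by gcongr
            _ = (((β * N : ℝ≥0) : ℝ≥0∞)⁻¹ * β) *
                (ω x * ∫⁻ y in B, k y ∂hardyMeasure m g) := by ring
            _ ≤ (N⁻¹ : ℝ≥0) * ∫⁻ y, tailKernel x y ∂hardyMeasure m g := by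
                refine mul_le_mul' (le_of_eq ?_) (hker _ x hxX hx0)
                rw [← ENNReal.coe_inv (by exact_mod_cast hβN0), ← ENNReal.coe_mul]
                congr 1
                have := (zero_lt_one.trans_le hβ).ne'
                field_simp
      _ ≤ _ := setLIntegral_le_lintegral _ _
      _ ≤ _ := hS _ (hg.const_mul _) (hgT.const_mul _)
      _ ≤ _ := by
          refine Ψ.val_mono (Φ.inv_mono (le_trans (lintegral_mono fun y => ?_) hg1))
          rw [← mul_assoc, ← ENNReal.coe_mul, mul_inv_cancel₀ hN0.ne', ENNReal.coe_one, one_mul]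
  rcases eq_or_ne (dualNorm Φ m ε B k) 0 with h | h
  · simp [h, Ψ.val_zero]
  obtain ⟨u, hu, hu', hlim⟩ := exists_seq_strictMono_tendsto' (pos_iff_ne_zero.2 h)
  rw [← iSup_eq_of_tendsto hu.monotone hlim]
  simp_rw [ENNReal.mul_iSup, Ψ.val_iSup]
  rw [lintegral_iSup']
  · exact iSup_le fun n => key _ (hu' n).1 (hu' n).2
  · intro n
    exact Ψ.measurable_val.comp_aemeasurable (hw.restrict.mul
      ((hω.const_mul _).mul_const _).aemeasurable)
  · refine ae_of_all _ fun x a b hab => Ψ.val_mono ?_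
    gcongr
    exact hu.monotone hab

/-- The modular inequality implies the test conditions. -/
lemma exists_testBounds_of_modular [NullSingletonClass m] [SFinite m]
    (hm : ∀ x, m (Iio x) ≠ ∞) (hμ : μ (Iic 0) = 0) (hw : AEMeasurable w μ)
    (hΦ : DeltaTwo Φ.val) (hΦc : DeltaTwo Φ.compl) {C : ℝ≥0} (hC : 0 < C)
    (hN : ∀ f : ℝ → ℝ≥0, AntitoneOn f (Ioi 0) →
      ∫⁻ x, Ψ.val (w x * calderon (fun t => f t) x) ∂μ ≤
        Ψ.val (Φ.inv (∫⁻ x, Φ.val (C * f x) ∂m))) :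
    ∃ A : ℝ≥0, 0 < A ∧ TestBounds Φ Ψ m μ w A := by
  obtain ⟨β, hβ, hβΦ⟩ := Φ.exists_gen_mul_le hΦ
  obtain ⟨γ, hγ, hγΦ⟩ := Φ.exists_complGen_mul_le hΦc
  have hβ0 := zero_lt_one.trans_le hβ
  have hγ0 := zero_lt_one.trans_le hγ
  have hS := fun g hg hgT => lintegral_hardySum_le_of_modular (g := g) hm hμ hβ hβΦ hN hg hgT
  have hN0 : 0 < 2 * β * C := by positivity
  have hlogm : ∀ r, Measurable fun y => ENNReal.ofReal (Real.log (y / r)) := fun r =>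
    (Real.measurable_log.comp (measurable_id.div_const r)).ennreal_ofReal
  have hlogm' : ∀ r, Measurable fun x => ENNReal.ofReal (Real.log (r / x)) := fun r =>
    (Real.measurable_log.comp (measurable_const.div measurable_id)).ennreal_ofReal
  -- Here γ comes from the converse of Hölder's inequality and 2βC from Hardy's. The kernel bounds
  -- are y/x for y < r < x and, for x < r < y, 1 as well as log(y/r) and log(r/x), both at most
  -- log(y/x).
  refine ⟨γ * (2 * β * C), by positivity, fun r ε hr hε => ?_, fun r ε hr hε => ?_,
    fun r ε hr hε => ?_, fun r ε hr hε => ?_⟩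
  · refine lintegral_val_dualNorm_le hm hμ hw hγ hN0 hγΦ hS hε measurableSet_Ioi measurableSet_Iio
      ENNReal.measurable_ofReal (fun _ => ENNReal.ofReal_ne_top) ENNReal.measurable_ofReal.inv
      fun η x hx hx0 => ?_
    rw [lintegral_tailKernel]
    refine le_add_right ?_
    gcongr
    exact fun y hy => (le_of_lt (mem_Iio.1 hy)).trans (le_of_lt (mem_Ioi.1 hx))
  · have := lintegral_val_dualNorm_le (Ψ := Ψ) (ω := 1) (k := 1) (X := Iio r) (B := Ioi r)
      hm hμ hw hγ hN0 hγΦ hS hε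
      measurableSet_Iio measurableSet_Ioi measurable_one (fun _ => ENNReal.one_ne_top)
      measurable_one fun η x hx hx0 => by
        rw [lintegral_tailKernel]
        refine le_add_left (le_add_right ?_)
        simp only [Pi.one_apply, one_mul, setLIntegral_one]
        exact antitone_measure_Ioi η (le_of_lt hx)
    simpa using this
  · have := lintegral_val_dualNorm_le (Ψ := Ψ) (ω := 1) (X := Iio r) (B := Ioi r)
      (k := fun y => ENNReal.ofReal (Real.log (y / r)))
      hm hμ hw hγ hN0 hγΦ hS hε
      measurableSet_Iio measurableSet_Ioi (hlogm r) (fun _ => ENNReal.ofReal_ne_top)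
      measurable_one fun η x hx hx0 => by
        rw [lintegral_tailKernel]
        refine le_add_left (le_add_left ?_)
        rw [Pi.one_apply, one_mul]
        refine le_trans (setLIntegral_mono' measurableSet_Ioi fun y hy => ?_)
          (lintegral_mono_set (Ioi_subset_Ioi (le_of_lt hx)))
        have hy0 : 0 < y := hr.trans hy
        have := le_of_lt (mem_Iio.1 hx)
        gcongr
    simpa using this
  · refine lintegral_val_dualNorm_le hm hμ hw hγ hN0 hγΦ hS hε measurableSet_Iio measurableSet_Ioi
      measurable_one (fun _ => ENNReal.one_ne_top) (hlogm' r) fun η x hx hx0 => ?_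
    rw [lintegral_tailKernel]
    refine le_add_left (le_add_left ?_)
    simp only [Pi.one_apply, setLIntegral_one]
    rw [← setLIntegral_const]
    refine le_trans (setLIntegral_mono' measurableSet_Ioi fun y hy => ?_)
      (lintegral_mono_set (Ioi_subset_Ioi (le_of_lt hx)))
    have := le_of_lt (mem_Ioi.1 hy)
    gcongr

/-- The test conditions imply the modular inequality for non-increasing functions. -/
lemma exists_modular_of_testBounds [NullSingletonClass m] [SFinite m]
    (hm : ∀ x, m (Iio x) ≠ ∞) (h0 : m (Iic 0) = 0) (hinf : m univ = ∞) (hμ : μ (Iic 0) = 0)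
    (hP : Prec Φ Ψ) {A : ℝ≥0} (hA : 0 < A) (hT : TestBounds Φ Ψ m μ w A)
    (hw : AEMeasurable w μ) :
    ∃ D : ℝ≥0, 0 < D ∧ ∀ f : ℝ → ℝ≥0, AntitoneOn f (Ioi 0) →
      ∫⁻ x, Ψ.val (w x * calderon (fun t => f t) x) ∂μ ≤
        Ψ.val (Φ.inv (∫⁻ x, Φ.val (D * f x) ∂m)) := by
  obtain ⟨D, hD, hS⟩ := exists_lintegral_hardySum_le hm h0 hμ hP hA hT hw
  have hμ0 : ∀ᵐ x ∂μ, 0 < x := by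
    rw [ae_iff]; simpa [Iic] using hμ
  refine ⟨8 * D, by positivity, fun f hf => ?_⟩
  -- If m vanishes on (0, a), the modular of f does not see f there and no tail majorant need exist;
  -- in that case the weight vanishes a.e.
  by_cases hpos : ∀ x, 0 < x → 0 < m (Iio x)
  · obtain ⟨g, hg, hfg, hgc⟩ := exists_tail_majorant (Φ := Φ) hm h0 hinf hpos hf
    refine le_trans (lintegral_mono_ae ?_)
      ((hS g hg).trans (Ψ.val_mono (Φ.inv_mono (hgc D))))
    filter_upwards [hμ0] with x hx
    have : SFinite (hardyMeasure m g) := by unfold hardyMeasure; infer_instance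
    rw [← calderon_tail _ hx]
    refine Ψ.val_mono ?_
    gcongr
    exact calderon_mono hfg hx
  · push Not at hpos
    obtain ⟨a, ha, hma⟩ := hpos
    have := ae_eq_zero_of_measure_Iio_eq_zero hm hinf hμ hw hD hS ha (nonpos_iff_eq_zero.1 hma)
    rw [lintegral_congr_ae (g := fun _ => 0)]
    · simp
    · filter_upwards [this] with x hx
      simp [hx, Ψ.val_zero]

end

section

variable {Φ Ψ : NFunction}

/-! ### The Dunkl-Hausdorff operator -/

lemma calderon_const_mul (c : ℝ≥0) (f : ℝ → ℝ≥0∞) (x : ℝ) :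
    calderon (fun t => c * f t) x = c * calderon f x := by
  unfold calderon
  simp_rw [mul_div_assoc]
  rw [lintegral_const_mul' _ _ ENNReal.coe_ne_top, lintegral_const_mul' _ _ ENNReal.coe_ne_top]
  ring

lemma lintegral_image_const_div {x : ℝ} (hx : 0 < x) {s : Set ℝ} (hs : MeasurableSet s)
    (hs0 : ∀ t ∈ s, 0 < t) (F : ℝ → ℝ≥0∞) :
    ∫⁻ u in (fun t => x / t) '' s, F u = ∫⁻ t in s, ENNReal.ofReal (x / t ^ 2) * F (x / t) := by
  rw [lintegral_image_eq_lintegral_abs_deriv_mul hs (f' := fun t => -x / t ^ 2)]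
  · refine setLIntegral_congr_fun hs fun t ht => ?_
    rw [neg_div, abs_neg, abs_of_pos (div_pos hx (pow_pos (hs0 t ht) 2))]
  · intro t ht
    have := (hasDerivAt_inv (hs0 t ht).ne').const_mul x
    refine (this.hasDerivWithinAt (s := s)).congr_deriv ?_
    ring
  · intro a ha b hb hab
    have h1 := (hs0 a ha).ne'
    have h2 := (hs0 b hb).ne'
    have h3 : x / a = x / b := hab
    rw [div_eq_div_iff h1 h2] at h3
    exact (mul_left_cancel₀ hx.ne' h3).symm

/-- The map t ↦ x/t carries (1,∞) onto (0,x) and (0,1) onto (x,∞) with Jacobian x/t²; the factors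
1/x and 1/u = t/x turn it into t⁻² and t⁻¹. -/
lemma calderon_eq {x : ℝ} (hx : 0 < x) (f : ℝ → ℝ≥0∞) :
    calderon f x = (∫⁻ t in Ioi 1, ENNReal.ofReal (t ^ 2)⁻¹ * f (x / t)) +
      ∫⁻ t in Ioo 0 1, ENNReal.ofReal t⁻¹ * f (x / t) := by
  have i1 : (fun t => x / t) '' Ioi 1 = Ioo 0 x := by
    ext u
    simp only [mem_image, mem_Ioi, mem_Ioo]
    constructor
    · rintro ⟨t, ht, rfl⟩
      exact ⟨div_pos hx (one_pos.trans ht), div_lt_self hx ht⟩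
    · rintro ⟨hu, hux⟩
      exact ⟨x / u, (one_lt_div hu).2 hux, by field_simp⟩
  have i2 : (fun t => x / t) '' Ioo 0 1 = Ioi x := by
    ext u
    simp only [mem_image, mem_Ioi, mem_Ioo]
    constructor
    · rintro ⟨t, ⟨ht, ht1⟩, rfl⟩
      rw [lt_div_iff₀ ht]; nlinarith
    · intro hu
      have hu0 := hx.trans hu
      exact ⟨x / u, ⟨div_pos hx hu0, (div_lt_one hu0).2 hu⟩, by field_simp⟩
  unfold calderon
  rw [← i1, ← i2, lintegral_image_const_div hx measurableSet_Ioi fun t ht => one_pos.trans ht,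
    lintegral_image_const_div hx measurableSet_Ioo fun t ht => ht.1,
    ← lintegral_const_mul' _ _ (by simpa using hx)]
  congr 1
  · refine setLIntegral_congr_fun measurableSet_Ioi fun t ht => ?_
    have ht0 : (0 : ℝ) < t := one_pos.trans ht
    rw [← ENNReal.ofReal_inv_of_pos hx, ← mul_assoc, ← ENNReal.ofReal_mul (by positivity)]
    congr 2
    field_simp
  · refine setLIntegral_congr_fun measurableSet_Ioo fun t ht => ?_
    have ht0 : (0 : ℝ) < t := ht.1
    rw [div_eq_mul_inv (f _), ← ENNReal.ofReal_inv_of_pos (div_pos hx ht0), mul_comm (f _),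
      ← mul_assoc, ← ENNReal.ofReal_mul (by positivity)]
    congr 2
    field_simp

/-- Splitting at t = 1 isolates the two quotients of `PowerBounds` and leaves the weights t⁻² and
t⁻¹ of `calderon_eq`. -/
lemma dunklHausdorff_eq (α : ℝ) (φ : ℝ → ℝ) (f : ℝ → ℝ≥0) (x : ℝ) :
    dunklHausdorff α φ f x =
      (∫⁻ t in Ioi 1, ENNReal.ofReal (φ t / t ^ (2 * α) * (t ^ 2)⁻¹) * f (x / t)) +
      ∫⁻ t in Ioo 0 1, ENNReal.ofReal (φ t / t ^ (2 * α + 1) * t⁻¹) * f (x / t) := by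
  have hU : Ioi (0 : ℝ) = Ici 1 ∪ Ioo 0 1 := by
    ext t
    simp only [mem_Ioi, mem_union, mem_Ici, mem_Ioo]
    constructor
    · intro h
      rcases le_or_gt 1 t with h1 | h1
      · exact .inl h1
      · exact .inr ⟨h, h1⟩
    · rintro (h | h)
      · exact one_pos.trans_le h
      · exact h.1
  have hd : Disjoint (Ici (1 : ℝ)) (Ioo 0 1) :=
    Set.disjoint_left.2 fun t h1 h2 => h2.2.not_ge h1
  rw [dunklHausdorff, hU, lintegral_union measurableSet_Ioo hd,
    ← Measure.restrict_congr_set (Ioi_ae_eq_Ici (μ := volume) (a := (1 : ℝ)))]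
  congr 1
  · refine setLIntegral_congr_fun measurableSet_Ioi fun t ht => ?_
    have ht0 : (0 : ℝ) < t := one_pos.trans ht
    rw [Real.rpow_add ht0, Real.rpow_two, ← div_div, div_eq_mul_inv (φ t / _)]
  · refine setLIntegral_congr_fun measurableSet_Ioo fun t ht => ?_
    rw [show 2 * α + 2 = 2 * α + 1 + 1 by ring, Real.rpow_add ht.1 (2 * α + 1), Real.rpow_one,
      ← div_div, div_eq_mul_inv (φ t / _)]

/-- The Dunkl-Hausdorff operator is comparable with the sum of the averaging operator and its
adjoint. -/
lemma exists_dunklHausdorff_bounds {α : ℝ} {φ : ℝ → ℝ} (hφ : PowerBounds α φ) :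
    ∃ c c' : ℝ≥0, 0 < c ∧ 0 < c' ∧ ∀ (f : ℝ → ℝ≥0) (x : ℝ), 0 < x →
      c * calderon (fun t => f t) x ≤ dunklHausdorff α φ f x ∧
      dunklHausdorff α φ f x ≤ c' * calderon (fun t => f t) x := by
  obtain ⟨C₁, C₂, C₃, C₄, h1, h2, h3, h4, hge, hlt⟩ := hφ
  refine ⟨(min C₁ C₃).toNNReal, (max C₂ C₄).toNNReal, by simp [h1, h3], by simp [h2],
    fun f x hx => ?_⟩
  have hmin : 0 ≤ min C₁ C₃ := (lt_min h1 h3).le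
  have hmax : 0 ≤ max C₂ C₄ := h2.le.trans (le_max_left _ _)
  rw [dunklHausdorff_eq, calderon_eq hx, mul_add, mul_add,
    ← lintegral_const_mul' _ _ ENNReal.coe_ne_top, ← lintegral_const_mul' _ _ ENNReal.coe_ne_top,
    ← lintegral_const_mul' _ _ ENNReal.coe_ne_top, ← lintegral_const_mul' _ _ ENNReal.coe_ne_top]
  simp_rw [← mul_assoc]
  change _ + _ ≤ _ ∧ _ ≤ _ + _
  constructor
  · refine add_le_add (setLIntegral_mono' measurableSet_Ioi fun t ht => ?_)
      (setLIntegral_mono' measurableSet_Ioo fun t ht => ?_)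
    · have ht0 : (0 : ℝ) < t := one_pos.trans ht
      gcongr
      change ENNReal.ofReal _ * _ ≤ _
      rw [← ENNReal.ofReal_mul hmin]
      gcongr
      exact (min_le_left _ _).trans (hge t (le_of_lt ht)).1
    · have ht0 : (0 : ℝ) < t := ht.1
      gcongr
      change ENNReal.ofReal _ * _ ≤ _
      rw [← ENNReal.ofReal_mul hmin]
      gcongr
      exact (min_le_right _ _).trans (hlt t ht.1 ht.2).1
  · refine add_le_add (setLIntegral_mono' measurableSet_Ioi fun t ht => ?_)
      (setLIntegral_mono' measurableSet_Ioo fun t ht => ?_)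
    · have ht0 : (0 : ℝ) < t := one_pos.trans ht
      gcongr
      change _ ≤ ENNReal.ofReal _ * _
      rw [← ENNReal.ofReal_mul hmax]
      gcongr
      exact (hge t (le_of_lt ht)).2.trans (le_max_left _ _)
    · have ht0 : (0 : ℝ) < t := ht.1
      gcongr
      change _ ≤ ENNReal.ofReal _ * _
      rw [← ENNReal.ofReal_mul hmax]
      gcongr
      exact (hlt t ht.1 ht.2).2.trans (le_max_right _ _)

/-! ### Weights as measures -/

/-- The measure on `(0, ∞)` with density `v`. -/
def weightMeasure (v : ℝ → ℝ≥0) : Measure ℝ :=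
  (volume.restrict (Ioi (0 : ℝ))).withDensity fun x => (v x : ℝ≥0∞)

variable {v w : ℝ → ℝ≥0}

/-- Because the density is finite, no measurability of F is needed. -/
lemma setLIntegral_weightMeasure (hv : IsWeight v) {s : Set ℝ} (hs : MeasurableSet s)
    (F : ℝ → ℝ≥0∞) :
    ∫⁻ x in s, F x ∂weightMeasure v = ∫⁻ x in s ∩ Ioi 0, F x * v x := by
  rw [weightMeasure, setLIntegral_withDensity_eq_setLIntegral_mul_non_measurable₀ _ _ _ hs,
    Measure.restrict_restrict hs]
  · simp only [Pi.mul_apply, mul_comm]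
  · exact ae_of_all _ fun x => ENNReal.coe_lt_top
  · exact hv.coe_nnreal_ennreal.restrict

lemma lintegral_weightMeasure (hv : IsWeight v) (F : ℝ → ℝ≥0∞) :
    ∫⁻ x, F x ∂weightMeasure v = ∫⁻ x in Ioi 0, F x * v x := by
  have := setLIntegral_weightMeasure hv MeasurableSet.univ F
  rwa [Measure.restrict_univ, univ_inter] at this

lemma weightMeasure_Iio (v : ℝ → ℝ≥0) (x : ℝ) : weightMeasure v (Iio x) = primitive v x := by
  rw [weightMeasure, withDensity_apply _ measurableSet_Iio,
    Measure.restrict_restrict measurableSet_Iio, Iio_inter_Ioi]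
  rfl

lemma weightMeasure_Iic_zero (v : ℝ → ℝ≥0) : weightMeasure v (Iic 0) = 0 := by
  rw [weightMeasure, withDensity_apply _ measurableSet_Iic,
    Measure.restrict_restrict measurableSet_Iic, Iic_inter_Ioi]
  simp

/-- Since Φ̃(0) = 0, the indicator inside Φ̃ becomes a restriction of the domain of integration. -/
lemma weightNorm_eq (hv : IsWeight v) (ε : ℝ≥0) {E : Set ℝ} (hE : MeasurableSet E)
    (g : ℝ → ℝ) :
    weightNorm Φ v ε E g = dualNorm Φ (weightMeasure v) ε E fun y => ENNReal.ofReal (g y) := by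
  rw [weightNorm, luxNorm, dualNorm]
  congr 1
  ext τ
  simp only [mem_ofPred_eq]
  have : ∫⁻ x in Ioi (0 : ℝ), Φ.compl (E.indicator
      (fun y => ENNReal.ofReal (g y) / (ε * primitive v y)) x / τ) * ((ε * v x : ℝ≥0) : ℝ≥0∞) =
      ∫⁻ y in E, Φ.compl (ENNReal.ofReal (g y) / (ε * weightMeasure v (Iio y)) / τ) * ε
        ∂weightMeasure v := by
    rw [setLIntegral_weightMeasure hv hE, ← setLIntegral_indicator hE]
    refine lintegral_congr fun x => ?_
    by_cases hx : x ∈ E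
    · simp only [indicator_of_mem hx, weightMeasure_Iio]
      push_cast; ring
    · simp [hx, Φ.compl_zero]
  rw [this]

lemma weightNorm_Ioo (hv : IsWeight v) (ε : ℝ≥0) (r : ℝ) :
    weightNorm Φ v ε (Ioo 0 r) (fun y => y) =
      dualNorm Φ (weightMeasure v) ε (Iio r) ENNReal.ofReal := by
  rw [weightNorm_eq hv ε measurableSet_Ioo]
  have h : (Ioo 0 r : Set ℝ) =ᵐ[weightMeasure v] Iio r := by
    have : ∀ᵐ y ∂weightMeasure v, 0 < y := by
      rw [ae_iff]; simpa [Iic] using weightMeasure_Iic_zero v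
    filter_upwards [this] with y hy
    exact propext ⟨fun h => h.2, fun h => ⟨hy, h⟩⟩
  exact le_antisymm (dualNorm_mono h.le _) (dualNorm_mono h.symm.le _)

end

end DunklHausdorff

end

/-! ### The characterization -/

theorem theorem2p1 (Φ Ψ : DunklHausdorff.NFunction)
    (hΦ : DunklHausdorff.DeltaTwo Φ.val) (hΦc : DunklHausdorff.DeltaTwo Φ.compl)
    (hΦΨ : DunklHausdorff.Prec Φ Ψ)
    (w₀ w₁ v : ℝ → ℝ≥0) (hw₀ : DunklHausdorff.IsWeight w₀)
    (hw₁ : DunklHausdorff.IsWeight w₁) (hv : DunklHausdorff.IsWeight v)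
    (hv_fin : ∀ x : ℝ, DunklHausdorff.primitive v x < ∞)
    (hv_inf : ∫⁻ t in Ioi (0 : ℝ), (v t : ℝ≥0∞) = ∞)
    (α : ℝ) (φ : ℝ → ℝ) (hφ_meas : AEMeasurable φ (volume.restrict (Ioi 0)))
    (hφ : DunklHausdorff.PowerBounds α φ) :
    (∃ C : ℝ≥0, 0 < C ∧ ∀ f : ℝ → ℝ≥0, AntitoneOn f (Ioi 0) →
      DunklHausdorff.ModularIneq Φ Ψ w₀ w₁ v α φ C f) ↔
    (∃ A₁ A₂ A₃ : ℝ≥0, 0 < A₁ ∧ 0 < A₂ ∧ 0 < A₃ ∧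
      ∀ (r : ℝ) (ε : ℝ≥0), 0 < r → 0 < ε →
        Ψ.inv (∫⁻ x in Ioi r,
          Ψ.val (w₁ x / (A₁ * ENNReal.ofReal x) *
            DunklHausdorff.weightNorm Φ v ε (Ioo 0 r) (fun y => y)) * w₀ x)
          ≤ Φ.inv (1 / ε) ∧
        Ψ.inv (∫⁻ x in Ioo 0 r,
          Ψ.val (w₁ x / A₂ *
            DunklHausdorff.weightNorm Φ v ε (Ioi r) (fun _ => 1)) * w₀ x)
          ≤ Φ.inv (1 / ε) ∧
        Ψ.inv (∫⁻ x in Ioo 0 r,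
          Ψ.val (w₁ x / A₃ *
            DunklHausdorff.weightNorm Φ v ε (Ioi r) (fun y => Real.log (y / r))) * w₀ x)
          ≤ Φ.inv (1 / ε) ∧
        Ψ.inv (∫⁻ x in Ioo 0 r,
          Ψ.val (w₁ x / A₃ *
            DunklHausdorff.weightNorm Φ v ε (Ioi r) (fun _ => 1) *
              ENNReal.ofReal (Real.log (r / x))) * w₀ x)
          ≤ Φ.inv (1 / ε)) := by
  open DunklHausdorff in
  set m := weightMeasure v with hm_def
  set μ := weightMeasure w₀ with hμ_def
  have : NullSingletonClass m := nullSingletonClass_withDensity _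
  have : SFinite m := by rw [hm_def]; unfold weightMeasure; infer_instance
  have hm : ∀ x, m (Iio x) ≠ ∞ := fun x => by
    rw [hm_def, weightMeasure_Iio]; exact (hv_fin x).ne
  have hinf : m univ = ∞ := by
    have := lintegral_weightMeasure hv (fun _ => 1)
    rw [lintegral_one] at this
    rw [hm_def, this]; simpa using hv_inf
  have hw : AEMeasurable (fun x => (w₁ x : ℝ≥0∞)) μ :=
    AEMeasurable.mono_ac hw₁.coe_nnreal_ennreal (withDensity_absolutelyContinuous _ _)
  have hμ0 : ∀ᵐ x ∂μ, 0 < x := by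
    rw [ae_iff]; simpa [Iic] using weightMeasure_Iic_zero w₀
  have hone : (fun _ : ℝ => ENNReal.ofReal 1) = 1 := by ext; simp
  have hIoi : ∀ r : ℝ, 0 < r → ∀ F : ℝ → ℝ≥0∞,
      ∫⁻ x in Ioi r, F x * w₀ x = ∫⁻ x in Ioi r, F x ∂μ := fun r hr F => by
    rw [setLIntegral_weightMeasure hw₀ measurableSet_Ioi, inter_eq_left.2 (Ioi_subset_Ioi hr.le)]
  have hIio : ∀ (r : ℝ) (F : ℝ → ℝ≥0∞),
      ∫⁻ x in Ioo 0 r, F x * w₀ x = ∫⁻ x in Iio r, F x ∂μ := fun r F => by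
    rw [setLIntegral_weightMeasure hw₀ measurableSet_Iio, Iio_inter_Ioi]
  have hmod : ∀ (C : ℝ≥0) (f : ℝ → ℝ≥0), ModularIneq Φ Ψ w₀ w₁ v α φ C f ↔
      ∫⁻ x, Ψ.val (w₁ x * dunklHausdorff α φ f x) ∂μ ≤
        Ψ.val (Φ.inv (∫⁻ x, Φ.val (C * f x) ∂m)) := fun C f => by
    rw [ModularIneq, Ψ.inv_le_iff, ← lintegral_weightMeasure hw₀, ← lintegral_weightMeasure hv]
  obtain ⟨c, c', hc, hc', hcc⟩ := exists_dunklHausdorff_bounds hφ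
  have hmean : ∀ {A : ℝ≥0}, 0 < A → ∀ x N, (w₁ x : ℝ≥0∞) / (A * ENNReal.ofReal x) * N =
      w₁ x * ((A : ℝ≥0∞)⁻¹ * (ENNReal.ofReal x)⁻¹ * N) := fun {A} hA x N => by
    rw [div_eq_mul_inv, ENNReal.mul_inv (.inl (by exact_mod_cast hA.ne'))
      (.inl ENNReal.coe_ne_top), mul_assoc]
  have htail : ∀ (A : ℝ≥0) x (N : ℝ≥0∞), (w₁ x : ℝ≥0∞) / A * N =
      w₁ x * ((A : ℝ≥0∞)⁻¹ * N) := fun A x N => by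
    rw [div_eq_mul_inv, mul_assoc]
  have htailLog : ∀ (A : ℝ≥0) x (N L : ℝ≥0∞), (w₁ x : ℝ≥0∞) / A * N * L =
      w₁ x * ((A : ℝ≥0∞)⁻¹ * L * N) := fun A x N L => by
    rw [div_eq_mul_inv]; ring
  simp_rw [hmod, Ψ.inv_le_iff, weightNorm_Ioo hv, weightNorm_eq hv _ measurableSet_Ioi, hone, hIio,
    htailLog, htail]
  constructor
  · rintro ⟨C, hC, hCf⟩
    -- Applied to c⁻¹f, the lower comparison gives the inequality for `calderon` with constant
    -- C·c⁻¹.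
    obtain ⟨A, hA, hT⟩ := exists_testBounds_of_modular (Φ := Φ) (Ψ := Ψ) (C := C * c⁻¹) hm
      (weightMeasure_Iic_zero w₀) hw hΦ hΦc (by positivity) fun f hf => by
        have := hCf (fun t => c⁻¹ * f t) fun a ha b hb h => by
          have := hf ha hb h
          dsimp only; gcongr
        have hcf : ∀ t, ((c⁻¹ * f t : ℝ≥0) : ℝ≥0∞) = (c⁻¹ : ℝ≥0) * f t := fun t =>
          ENNReal.coe_mul _ _
        refine le_trans (lintegral_mono_ae ?_) (this.trans (le_of_eq ?_))
        · filter_upwards [hμ0] with x hx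
          refine Ψ.val_mono ?_
          gcongr
          refine le_trans (le_of_eq ?_) (hcc _ x hx).1
          simp_rw [hcf]
          rw [calderon_const_mul, ← mul_assoc, ← ENNReal.coe_mul, mul_inv_cancel₀ hc.ne',
            ENNReal.coe_one, one_mul]
        · simp_rw [ENNReal.coe_mul, mul_assoc]
    refine ⟨A, A, A, hA, hA, hA, fun r ε hr hε => ⟨?_, hT.tail r ε hr hε, hT.logTail r ε hr hε,
      hT.tailLog r ε hr hε⟩⟩
    rw [hIoi r hr]
    simp_rw [hmean hA]
    exact hT.mean r ε hr hε
  · rintro ⟨A₁, A₂, A₃, h1, h2, h3, h⟩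
    -- Each test condition weakens as its constant grows, so the largest one serves for all four.
    set A := max A₁ (max A₂ A₃) with hA
    have e1 : (A : ℝ≥0∞)⁻¹ ≤ (A₁ : ℝ≥0∞)⁻¹ :=
      ENNReal.inv_le_inv.2 (ENNReal.coe_le_coe.2 (le_max_left _ _))
    have e2 : (A : ℝ≥0∞)⁻¹ ≤ (A₂ : ℝ≥0∞)⁻¹ :=
      ENNReal.inv_le_inv.2 (ENNReal.coe_le_coe.2 ((le_max_left _ _).trans (le_max_right _ _)))
    have e3 : (A : ℝ≥0∞)⁻¹ ≤ (A₃ : ℝ≥0∞)⁻¹ :=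
      ENNReal.inv_le_inv.2 (ENNReal.coe_le_coe.2 ((le_max_right _ _).trans (le_max_right _ _)))
    have hT : TestBounds Φ Ψ m μ (fun x => (w₁ x : ℝ≥0∞)) A := by
      refine ⟨fun r ε hr hε => ?_, fun r ε hr hε => ?_, fun r ε hr hε => ?_, fun r ε hr hε => ?_⟩
      · have := (h r ε hr hε).1
        rw [hIoi r hr] at this
        simp_rw [hmean h1] at this
        exact le_trans (lintegral_mono fun x => Ψ.val_mono (by gcongr)) this
      · exact le_trans (lintegral_mono fun x => Ψ.val_mono (by gcongr)) (h r ε hr hε).2.1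
      · exact le_trans (lintegral_mono fun x => Ψ.val_mono (by gcongr)) (h r ε hr hε).2.2.1
      · exact le_trans (lintegral_mono fun x => Ψ.val_mono (by gcongr)) (h r ε hr hε).2.2.2
    obtain ⟨D, hD, hDf⟩ := exists_modular_of_testBounds hm (weightMeasure_Iic_zero v) hinf
      (weightMeasure_Iic_zero w₀) hΦΨ (lt_max_of_lt_left h1) hT hw
    -- The upper comparison constant c' is absorbed by applying the inequality for `calderon` to
    -- c'f.
    refine ⟨D * c', by positivity, fun f hf => ?_⟩
    have := hDf (fun t => c' * f t) fun a ha b hb h => by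
      have := hf ha hb h
      dsimp only; gcongr
    refine le_trans (lintegral_mono_ae ?_) (this.trans (le_of_eq ?_))
    · filter_upwards [hμ0] with x hx
      refine Ψ.val_mono ?_
      gcongr
      refine (hcc _ x hx).2.trans (le_of_eq ?_)
      simp_rw [ENNReal.coe_mul]
      rw [calderon_const_mul]
    · simp_rw [ENNReal.coe_mul, mul_assoc]
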